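/- Let $n\ge 2$, let $U\subset\mathbb{R}^n$ be open (a coordinate domain), let $\omega=(\omega_{ij})$ be a smooth non-degenerate metric on $U$, of any signature, with Christoffel symbols $\gamma^k_{ij}$, Levi-Civita connection $\nabla$ and Riemann tensor $\rho^k_{l,ij}=\partial_i\gamma^k_{lj}-\partial_j\gamma^k_{li}+\gamma^r_{lj}\gamma^k_{ri}-\gamma^r_{li}\gamma^k_{rj}$, and suppose that $\omega$ has constant curvature: $\rho^k_{l,ij}=c(\delta^k_i\omega_{lj}-\delta^k_j\omega_{li})$ for a constant $c$. Let $T$ be the tangent bundle, $F_0=S_2T^*$, and let $g_1\subset T^*\otimes T$ be the Killing symbol, defined by $\omega_{rj}\xi^r_i+\omega_{ir}\xi^r_j=0$, with first prolongation $g_2=(T^*\otimes g_1)\cap(S_2T^*\otimes T)$. Let $Z^s(g_1)$ be the kernel of the Spencer map $\delta:\wedge^sT^*\otimes g_1\to\wedge^{s+1}T^*\otimes T$, $B^s(g_1)$ the image of $\delta:\wedge^{s-1}T^*\otimes g_2\to\wedge^sT^*\otimes g_1$, and $H^s(g_1)=Z^s(g_1)/B^s(g_1)$. Then, at every point of $U$: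 (1) $\dim T=n$, $\dim F_0=n(n+1)/2$; moreover $B^2(g_1)=0$ and $B^3(g_1)=0$, so that one can put $F_1=H^2(g_1)=Z^2(g_1)$ and $F_2=H^3(g_1)=Z^3(g_1)$, and $$\dim F_1=\frac{n^2(n^2-1)}{12},\qquad \dim F_2=\frac{n^2(n^2-1)(n-2)}{24}.$$ The Riemann tensor $\rho$ has values in $F_1$. (2) Let $\mathrm{Killing}:\xi\mapsto\omega_{rj}\partial_i\xi^r+\omega_{ir}\partial_j\xi^r+\xi^r\partial_r\omega_{ij}$; let $\mathrm{Riemann}$ be the linearization at $\omega$ of $\omega\mapsto\rho^k_{l,ij}-c(\delta^k_i\omega_{lj}-\delta^k_j\omega_{li})$; and let $\mathrm{Bianchi}:R^k_{l,ij}\mapsto\nabla_pR^k_{l,ij}+\nabla_iR^k_{l,jp}+\nabla_jR^k_{l,pi}$. These are linear differential operators $$T\xrightarrow{\ \mathrm{Killing}\ }F_0\xrightarrow{\ \mathrm{Riemann}\ }F_1\xrightarrow{\ \mathrm{Bianchi}\ }F_2$$ of respective orders $1,2,1$, between bundles of dimensions $n$, $n(n+1)/2$, $n^2(n^2-1)/12$,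 $n^2(n^2-1)(n-2)/24$, and their symbols $T^*\otimes T\to F_0$, $S_2T^*\otimes F_0\to F_1$, $T^*\otimes F_1\to F_2$ are surjective. (3) The sequence is formally exact, each operator generating the compatibility conditions of the preceding one: $\mathrm{Riemann}\circ\mathrm{Killing}=0$, $\mathrm{Bianchi}\circ\mathrm{Riemann}=0$, and for all $r\ge 0$ the induced sequences of jets $$J_{r+3}(T)\to J_{r+2}(F_0)\to J_r(F_1),\qquad J_{r+3}(F_0)\to J_{r+1}(F_1)\to J_r(F_2)$$ are exact. Moreover $J_2(T)\to J_1(F_0)$ and $J_2(F_0)\to F_1$ are surjective, that is, the operator $\mathrm{Killing}$ has no compatibility condition of order less than $2$ and the operator $\mathrm{Riemann}$ has none of order $0$. -/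

import Mathlib

noncomputable section

namespace KillingSeq

/-! ### Spencer cohomology of a first order symbol, in components

An element of `∧^s T* ⊗ W` over an `n`-dimensional space is a family `ω_I ∈ W` indexed by
`I = (i_1, …, i_s)` that is alternating in `I`; an element of `T* ⊗ W` is a family `Fin n → W`. -/

section Spencer

variable {n : ℕ} {W : Type*} [AddCommGroup W] [Module ℝ W]

/-- The space `∧^s T* ⊗ g` of alternating `s`-forms with values in a subspace `g` of `W`. -/
def formsIn (s : ℕ) (g : Submodule ℝ W) : Submodule ℝ ((Fin s → Fin n) → W) where
  carrier := {ω | (∀ I, ω I ∈ g) ∧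
    ∀ (σ : Equiv.Perm (Fin s)) (I : Fin s → Fin n),
      ω (I ∘ σ) = ((Equiv.Perm.sign σ : ℤ) : ℝ) • ω I}
  add_mem' := by
    rintro a b ⟨ha, ha'⟩ ⟨hb, hb'⟩
    refine ⟨fun I => g.add_mem (ha I) (hb I), fun σ I => ?_⟩
    simp only [Pi.add_apply, ha', hb', smul_add]
  zero_mem' := ⟨fun _ => g.zero_mem, fun _ _ => by simp⟩
  smul_mem' := by
    rintro t a ⟨ha, ha'⟩
    refine ⟨fun I => g.smul_mem t (ha I), fun σ I => ?_⟩
    simp only [Pi.smul_apply, ha', smul_comm t]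

/-- The Spencer map `δ : ∧^s T* ⊗ T* ⊗ W → ∧^(s+1) T* ⊗ W`, `δ ω = ∑ i, dx^i ∧ ω_i`. -/
def delta (s : ℕ) : ((Fin s → Fin n) → (Fin n → W)) →ₗ[ℝ] ((Fin (s + 1) → Fin n) → W) where
  toFun ω I := ∑ a : Fin (s + 1), (-1 : ℝ) ^ (a : ℕ) • ω (I ∘ a.succAbove) (I a)
  map_add' ω η := by
    funext I
    simp [smul_add, Finset.sum_add_distrib]
  map_smul' t ω := by
    funext I
    simp [Finset.smul_sum, smul_comm t]

/-- The first prolongation `g_2 = (T* ⊗ g_1) ∩ (S_2 T* ⊗ W)` of a symbol `g_1` in `T* ⊗ W`. -/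
def prolong (g : Submodule ℝ (Fin n → W)) : Submodule ℝ (Fin n → Fin n → W) where
  carrier := {v | (∀ i, v i ∈ g) ∧ ∀ i j, v i j = v j i}
  add_mem' := by
    rintro a b ⟨ha, ha'⟩ ⟨hb, hb'⟩
    refine ⟨fun i => g.add_mem (ha i) (hb i), fun i j => ?_⟩
    simp only [Pi.add_apply, ha' i j, hb' i j]
  zero_mem' := ⟨fun _ => g.zero_mem, fun _ _ => rfl⟩
  smul_mem' := by
    rintro t a ⟨ha, ha'⟩
    refine ⟨fun i => g.smul_mem t (ha i), fun i j => ?_⟩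
    simp only [Pi.smul_apply, ha' i j]

/-- The cocycles `Z^s(g_1)`: the kernel of `δ : ∧^s T* ⊗ g_1 → ∧^(s+1) T* ⊗ W`. -/
def cocycles (s : ℕ) (g : Submodule ℝ (Fin n → W)) : Submodule ℝ ((Fin s → Fin n) → Fin n → W) :=
  formsIn s g ⊓ LinearMap.ker (delta s)

/-- The coboundaries `B^s(g_1)`: the image of `δ : ∧^(s-1) T* ⊗ g_2 → ∧^s T* ⊗ g_1`. -/
def coboundaries : (s : ℕ) → (g : Submodule ℝ (Fin n → W)) →
    Submodule ℝ ((Fin s → Fin n) → Fin n → W)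
  | 0, _ => ⊥
  | s + 1, g => (formsIn s (prolong g)).map (delta s)

/-- The Spencer cohomology `H^s(g_1) = Z^s(g_1) / B^s(g_1)` at `∧^s T* ⊗ g_1`. -/
abbrev cohomology (s : ℕ) (g : Submodule ℝ (Fin n → W)) : Type _ :=
  cocycles s g ⧸ (coboundaries s g).submoduleOf (cocycles s g)

end Spencer

/-! ### Sections, jets, linear differential operators and compatibility conditions

A vector bundle over an open set `U` of `ℝ^n` is given as a family of subspaces of a fixed
finite-dimensional space. -/

section Operators

variable {n : ℕ} {V W Z : Type*} [NormedAddCommGroup V] [NormedSpace ℝ V]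
  [NormedAddCommGroup W] [NormedSpace ℝ W] [NormedAddCommGroup Z] [NormedSpace ℝ Z]

/-- `f` is a smooth section over `U` of the bundle with fibres `E x`. -/
def IsSection (U : Set (Fin n → ℝ)) (E : (Fin n → ℝ) → Submodule ℝ V)
    (f : (Fin n → ℝ) → V) : Prop :=
  ContDiffOn ℝ ((⊤ : ℕ∞) : WithTop ℕ∞) f U ∧ ∀ x ∈ U, f x ∈ E x

/-- `f` and `g` have the same jet of order `r` at `x`. -/
def SameJet (r : ℕ) (x : Fin n → ℝ) (f g : (Fin n → ℝ) → V) : Prop :=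
  ∀ m ≤ r, iteratedFDeriv ℝ m f x = iteratedFDeriv ℝ m g x

/-- `D` is a linear differential operator of order at most `q` from `E` to `F` over `U`:
it sends smooth sections to smooth sections, linearly, and `(D f)(x)` depends only on the jet
of order `q` of `f` at `x`. -/
structure IsDiffOp (U : Set (Fin n → ℝ)) (E : (Fin n → ℝ) → Submodule ℝ V)
    (F : (Fin n → ℝ) → Submodule ℝ W) (q : ℕ)
    (D : ((Fin n → ℝ) → V) → ((Fin n → ℝ) → W)) : Prop where
  isSection : ∀ f, IsSection U E f → IsSection U F (D f)
  linear : ∀ f g, IsSection U E f → IsSection U E g → ∀ (a b : ℝ), ∀ x ∈ U,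
    D (a • f + b • g) x = a • D f x + b • D g x
  order_le : ∀ f g, IsSection U E f → IsSection U E g → ∀ x ∈ U,
    SameJet q x f g → D f x = D g x

/-- The symbol `S_q T* ⊗ E → F` of the operator `D` of order `q` is surjective at every point:
every vector of `F x` is the value at `x` of `D f` for a section `f` all of whose derivatives of
order less than `q` vanish at `x`. In particular, `D` is not of order less than `q` near any point
over which `F` is not zero. -/
def SymbolSurjective (U : Set (Fin n → ℝ)) (E : (Fin n → ℝ) → Submodule ℝ V)
    (F : (Fin n → ℝ) → Submodule ℝ W) (q : ℕ)
    (D : ((Fin n → ℝ) → V) → ((Fin n → ℝ) → W)) : Prop :=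
  ∀ x ∈ U, ∀ v ∈ F x, ∃ f, IsSection U E f ∧
    (∀ m < q, iteratedFDeriv ℝ m f x = 0) ∧ D f x = v

/-- The operator `D₁ : F → G`, of order `s`, generates the compatibility conditions of
`D : E → F`, of order `q`: one has `D₁ ∘ D = 0`, and for all `r ≥ 0` the sequence of prolongations
`J_(q+r+s)(E) → J_(r+s)(F) → J_r(G)` is exact at every point of `U`. -/
def GeneratesCC (U : Set (Fin n → ℝ)) (E : (Fin n → ℝ) → Submodule ℝ V)
    (F : (Fin n → ℝ) → Submodule ℝ W) (s : ℕ)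
    (D : ((Fin n → ℝ) → V) → ((Fin n → ℝ) → W))
    (D₁ : ((Fin n → ℝ) → W) → ((Fin n → ℝ) → Z)) : Prop :=
  (∀ ξ, IsSection U E ξ → ∀ x ∈ U, D₁ (D ξ) x = 0) ∧
  ∀ x ∈ U, ∀ (r : ℕ) (η : (Fin n → ℝ) → W), IsSection U F η → SameJet r x (D₁ η) 0 →
    ∃ ξ, IsSection U E ξ ∧ SameJet (r + s) x (D ξ) η

/-- `D : E → F` has no compatibility condition of order at most `r`: the prolongation of `D` is
onto `J_r(F)` at every point of `U`. -/
def NoCCUpTo (U : Set (Fin n → ℝ)) (E : (Fin n → ℝ) → Submodule ℝ V)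
    (F : (Fin n → ℝ) → Submodule ℝ W) (r : ℕ)
    (D : ((Fin n → ℝ) → V) → ((Fin n → ℝ) → W)) : Prop :=
  ∀ x ∈ U, ∀ η, IsSection U F η → ∃ ξ, IsSection U E ξ ∧ SameJet r x (D ξ) η

end Operators

/-! ### Metrics, Christoffel symbols, curvature -/

section Metric

variable {n : ℕ}

/-- The partial derivative `∂_i f` of a function of `x^1, …, x^n`. -/
def pd (i : Fin n) (f : (Fin n → ℝ) → ℝ) (x : Fin n → ℝ) : ℝ :=
  fderiv ℝ f x (Pi.single i 1)

/-- The inverse matrix `ω^{ij}`. -/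
def inv (w : Fin n → Fin n → ℝ) (i j : Fin n) : ℝ := (Matrix.of w)⁻¹ i j

/-- `ω = (ω_ij)` is a smooth non-degenerate metric, of any signature, on `U`. -/
structure IsMetric (U : Set (Fin n → ℝ)) (ω : (Fin n → ℝ) → Fin n → Fin n → ℝ) : Prop where
  smooth : ContDiffOn ℝ ((⊤ : ℕ∞) : WithTop ℕ∞) ω U
  symm : ∀ x ∈ U, ∀ i j, ω x i j = ω x j i
  det_ne_zero : ∀ x ∈ U, (Matrix.of (ω x)).det ≠ 0

/-- `∂_i h_rj + ∂_j h_ri - ∂_r h_ij`, twice the Christoffel symbol of the first kind. -/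
def firstKind (h : (Fin n → ℝ) → Fin n → Fin n → ℝ) (r i j : Fin n) (x : Fin n → ℝ) : ℝ :=
  pd i (fun y => h y r j) x + pd j (fun y => h y r i) x - pd r (fun y => h y i j) x

/-- The Christoffel symbols `γ^k_ij = (1/2) ω^{kr} (∂_i ω_rj + ∂_j ω_ri - ∂_r ω_ij)`. -/
def christoffel (ω : (Fin n → ℝ) → Fin n → Fin n → ℝ) (k i j : Fin n) (x : Fin n → ℝ) : ℝ :=
  (1 / 2) * ∑ r, inv (ω x) k r * firstKind ω r i j x

/-- The Riemann tensor
`ρ^k_{l,ij} = ∂_i γ^k_lj - ∂_j γ^k_li + γ^r_lj γ^k_ri - γ^r_li γ^k_rj`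
of `ω`, stored as `curvature ω x ![i, j] l k`. -/
def curvature (ω : (Fin n → ℝ) → Fin n → Fin n → ℝ) (x : Fin n → ℝ) :
    (Fin 2 → Fin n) → Fin n → Fin n → ℝ := fun I l k =>
  pd (I 0) (christoffel ω k l (I 1)) x - pd (I 1) (christoffel ω k l (I 0)) x
    + ∑ r, (christoffel ω r l (I 1) x * christoffel ω k r (I 0) x
      - christoffel ω r l (I 0) x * christoffel ω k r (I 1) x)

/-- The tensor `δ^k_i h_lj - δ^k_j h_li`, with the same storage. -/
def spaceForm (h : Fin n → Fin n → ℝ) : (Fin 2 → Fin n) → Fin n → Fin n → ℝ := fun I l k =>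
  (if k = I 0 then h l (I 1) else 0) - (if k = I 1 then h l (I 0) else 0)

/-- `ω` has constant Riemannian curvature `c` on `U`:
`ρ^k_{l,ij} = c (δ^k_i ω_lj - δ^k_j ω_li)`. -/
def HasConstantCurvature (U : Set (Fin n → ℝ)) (ω : (Fin n → ℝ) → Fin n → Fin n → ℝ)
    (c : ℝ) : Prop :=
  ∀ x ∈ U, curvature ω x = c • spaceForm (ω x)

/-! ### The bundles and the operators -/

/-- The tangent bundle `T`. -/
def tangent (n : ℕ) : (Fin n → ℝ) → Submodule ℝ (Fin n → ℝ) := fun _ => ⊤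

/-- The bundle `F_0 = S_2 T*` of symmetric covariant 2-tensors. -/
def symTensors (n : ℕ) : (Fin n → ℝ) → Submodule ℝ (Fin n → Fin n → ℝ) := fun _ =>
  { carrier := {h | ∀ i j, h i j = h j i}
    add_mem' := fun {a b} ha hb i j => by simp only [Pi.add_apply, ha i j, hb i j]
    zero_mem' := fun _ _ => rfl
    smul_mem' := fun t a ha i j => by simp only [Pi.smul_apply, ha i j] }

/-- The symbol `g_1` of the Killing system at a point where the metric is `w`: the
`(ξ^k_i) ∈ T* ⊗ T` (stored as `ξ i k`) with `w_rj ξ^r_i + w_ir ξ^r_j = 0`. -/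
def killingSymbol (w : Fin n → Fin n → ℝ) : Submodule ℝ (Fin n → Fin n → ℝ) where
  carrier := {ξ | ∀ i j, ∑ r, (w r j * ξ i r + w i r * ξ j r) = 0}
  add_mem' := by
    intro a b ha hb i j
    have := congrArg₂ (· + ·) (ha i j) (hb i j)
    simp only [← Finset.sum_add_distrib, add_zero] at this
    rw [← this]
    refine Finset.sum_congr rfl fun r _ => ?_
    simp only [Pi.add_apply]
    ring
  zero_mem' := fun i j => by simp
  smul_mem' := by
    intro t a ha i j
    have := congrArg (t * ·) (ha i j)
    simp only [Finset.mul_sum, mul_zero] at this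
    rw [← this]
    refine Finset.sum_congr rfl fun r _ => ?_
    simp only [Pi.smul_apply, smul_eq_mul]
    ring

/-- The bundle with fibres `Z^s(g_1)`, a subbundle of `∧^s T* ⊗ T* ⊗ T`. -/
def cocycleBundle (ω : (Fin n → ℝ) → Fin n → Fin n → ℝ) (s : ℕ) :
    (Fin n → ℝ) → Submodule ℝ ((Fin s → Fin n) → Fin n → Fin n → ℝ) :=
  fun x => cocycles s (killingSymbol (ω x))

/-- The Killing operator, that is the Lie derivative of the metric:
`Ω_ij = ω_rj ∂_i ξ^r + ω_ir ∂_j ξ^r + ξ^r ∂_r ω_ij`. -/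
def killing (ω : (Fin n → ℝ) → Fin n → Fin n → ℝ) (ξ : (Fin n → ℝ) → Fin n → ℝ) :
    (Fin n → ℝ) → Fin n → Fin n → ℝ := fun x i j =>
  ∑ r, (ω x r j * pd i (fun y => ξ y r) x + ω x i r * pd j (fun y => ξ y r) x
    + ξ x r * pd r (fun y => ω y i j) x)

/-- The variation `Γ^k_ij` of the Christoffel symbols `γ^k_ij` under a variation `Ω` of `ω`,
obtained from the linearization of `2 ω_rs γ^s_ij = ∂_i ω_rj + ∂_j ω_ri - ∂_r ω_ij`. -/
def varChristoffel (ω Ω : (Fin n → ℝ) → Fin n → Fin n → ℝ) (k i j : Fin n)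
    (x : Fin n → ℝ) : ℝ :=
  ∑ r, inv (ω x) k r * ((1 / 2) * firstKind Ω r i j x - ∑ s, Ω x r s * christoffel ω s i j x)

/-- The Riemann operator: the linearization at `ω`, in the direction `Ω`, of the left-hand side
`ρ^k_{l,ij} - c (δ^k_i ω_lj - δ^k_j ω_li)` of the constant curvature equation. -/
def riemann (c : ℝ) (ω Ω : (Fin n → ℝ) → Fin n → Fin n → ℝ) :
    (Fin n → ℝ) → (Fin 2 → Fin n) → Fin n → Fin n → ℝ := fun x I l k =>
  pd (I 0) (varChristoffel ω Ω k l (I 1)) x - pd (I 1) (varChristoffel ω Ω k l (I 0)) x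
    + ∑ r, (varChristoffel ω Ω r l (I 1) x * christoffel ω k r (I 0) x
      + christoffel ω r l (I 1) x * varChristoffel ω Ω k r (I 0) x
      - varChristoffel ω Ω r l (I 0) x * christoffel ω k r (I 1) x
      - christoffel ω r l (I 0) x * varChristoffel ω Ω k r (I 1) x)
    - c * spaceForm (Ω x) I l k

/-- The covariant derivative `∇_p R^k_{l,ij}` for the Levi-Civita connection of `ω`. -/
def covDeriv (ω : (Fin n → ℝ) → Fin n → Fin n → ℝ)
    (R : (Fin n → ℝ) → (Fin 2 → Fin n) → Fin n → Fin n → ℝ)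
    (p i j l k : Fin n) (x : Fin n → ℝ) : ℝ :=
  pd p (fun y => R y ![i, j] l k) x
    + ∑ s, (christoffel ω k p s x * R x ![i, j] l s
      - christoffel ω s p l x * R x ![i, j] s k
      - christoffel ω s p i x * R x ![s, j] l k
      - christoffel ω s p j x * R x ![i, s] l k)

/-- The Bianchi operator
`R^k_{l,ij} ↦ ∇_p R^k_{l,ij} + ∇_i R^k_{l,jp} + ∇_j R^k_{l,pi}`, with `(p, i, j)` stored as
`I 0, I 1, I 2`. -/
def bianchi (ω : (Fin n → ℝ) → Fin n → Fin n → ℝ)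
    (R : (Fin n → ℝ) → (Fin 2 → Fin n) → Fin n → Fin n → ℝ) :
    (Fin n → ℝ) → (Fin 3 → Fin n) → Fin n → Fin n → ℝ := fun x I l k =>
  covDeriv ω R (I 0) (I 1) (I 2) l k x + covDeriv ω R (I 1) (I 2) (I 0) l k x
    + covDeriv ω R (I 2) (I 0) (I 1) l k x

end Metric

end KillingSeq

end

open KillingSeq

/-! Lower every upper index with the metric and work in the algebra of smooth functions on `U` with
its commuting derivations. Killing becomes `∇_i ξ_j + ∇_j ξ_i`; twice Riemann becomes `riem2`, a
combination of second covariant derivatives plus zero-order terms in `c`; Bianchi becomes a cyclic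
sum of `∇R`. In constant curvature the commutator of two covariant derivatives is algebraic, with
coefficients `c g`, and `∇g = 0`. Both composites therefore vanish by commuting indices
(`riem2_kil`, `bia_riem2`).

Exactness on jets is proved by filtering the algebra by order of vanishing at a point (`van`).
Modulo higher order each operator equals its flat, constant coefficient principal part, and the
question becomes one about homogeneous polynomials. There contraction with the coordinates, together
with Euler's relation, gives explicit solutions: `killing_succ` recovers a vector field from a
deformation of zero flat curvature, and `riemann_step` recovers a deformation from a curvature
tensor satisfying the flat Bianchi identity. The correct solution is then built degree by degree
(`killing_exact`, `riemann_exact`): since the composites vanish exactly, subtracting what has been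
reached does not disturb the compatibility condition on the remainder. In the lowest degrees no
condition is needed, which gives the absence of low order compatibility conditions and the
surjectivity of the first two symbols; for Bianchi, `bianchiLift` provides an explicit section of
the symbol up to a factor.

For the dimensions, lowering identifies `g_1` with the antisymmetric matrices. A tensor symmetric in
two indices and antisymmetric in an overlapping pair is zero, so `g_2 = 0` and there are no
coboundaries. For `s = 2, 3` the map `δ` from `∧^s T* ⊗ g_1` onto `∧^(s+1) T* ⊗ T` has an explicit
right inverse, so rank-nullity gives `dim Z^s = C(n,s) C(n,2) - n C(n,s+1)`. -/

noncomputable section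
namespace KillingSeq

/-! ### Covariant calculus over a differential ring; vanishing of the two composites. -/

section DiffRing

/-- A commutative `ℝ`-algebra with commuting derivations `∂_i`, a metric `g_ij` with inverse
`g^ij`, and its symmetric metric connection `γ^k_ij`, of constant curvature `c`. -/
structure ConstCurv (n : ℕ) (A : Type*) [CommRing A] [Algebra ℝ A] where
  d : Fin n → Derivation ℝ A A
  d_comm : ∀ i j a, d i (d j a) = d j (d i a)
  g : Fin n → Fin n → A
  g_symm : ∀ i j, g i j = g j i
  gi : Fin n → Fin n → A
  g_gi : ∀ i j, ∑ r, g i r * gi r j = if i = j then 1 else 0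
  gi_g : ∀ i j, ∑ r, gi i r * g r j = if i = j then 1 else 0
  γ : Fin n → Fin n → Fin n → A
  γ_symm : ∀ k i j, γ k i j = γ k j i
  d_g : ∀ i j k, d i (g j k) = ∑ s, γ s i j * g s k + ∑ s, γ s i k * g j s
  c : A
  d_c : ∀ i, d i c = 0
  curv : ∀ k l i j, d i (γ k l j) - d j (γ k l i)
    + ∑ r, (γ r l j * γ k r i - γ r l i * γ k r j)
      = c * ((if k = i then g l j else 0) - (if k = j then g l i else 0))

variable {n : ℕ} {A : Type*} [CommRing A] [Algebra ℝ A]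

/-- Additive operators `D_p` on an `A`-module that satisfy the Leibniz rule. -/
structure IsConn {M : Type*} [AddCommGroup M] [Module A M] (d : Fin n → Derivation ℝ A A)
    (D : Fin n → M → M) : Prop where
  add : ∀ p a b, D p (a + b) = D p a + D p b
  leibniz : ∀ p (a : A) m, D p (a • m) = d p a • m + a • D p m

namespace IsConn
variable {M : Type*} [AddCommGroup M] [Module A M] {d : Fin n → Derivation ℝ A A}
  {D : Fin n → M → M}

theorem zero (h : IsConn d D) (p : Fin n) : D p 0 = 0 := by
  have := h.add p 0 0
  simpa using this

theorem neg (h : IsConn d D) (p : Fin n) (a : M) : D p (-a) = -D p a := by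
  have := h.add p a (-a)
  rw [add_neg_cancel, h.zero] at this
  exact (neg_eq_of_add_eq_zero_right this.symm).symm

theorem sub (h : IsConn d D) (p : Fin n) (a b : M) : D p (a - b) = D p a - D p b := by
  rw [sub_eq_add_neg, h.add, h.neg, sub_eq_add_neg]

theorem sum (h : IsConn d D) {ι : Type*} (p : Fin n) (s : Finset ι) (f : ι → M) :
    D p (∑ i ∈ s, f i) = ∑ i ∈ s, D p (f i) :=
  map_sum (⟨⟨D p, h.zero p⟩, h.add p⟩ : M →+ M) f s

end IsConn

namespace ConstCurv
variable (S : ConstCurv n A)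

/-- The covariant derivative on covariant tensors with one more slot. -/
def lift {M : Type*} [AddCommGroup M] [Module A M] (D : Fin n → M → M) (p : Fin n)
    (T : Fin n → M) : Fin n → M :=
  fun k => D p (T k) - ∑ s, S.γ s p k • T s

theorem isConn_d : IsConn S.d (fun p a => S.d p a) where
  add p a b := by simp
  leibniz p a b := by simp [mul_comm, add_comm]

section lift
variable {M : Type*} [AddCommGroup M] [Module A M] {D : Fin n → M → M}

theorem isConn_lift (h : IsConn S.d D) : IsConn S.d (S.lift D) where
  add p a b := by
    funext k
    simp only [lift, Pi.add_apply, h.add, smul_add, Finset.sum_add_distrib]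
    abel
  leibniz p a T := by
    funext k
    simp only [lift, Pi.add_apply, Pi.smul_apply, h.leibniz, smul_sub, Finset.smul_sum,
      smul_comm a]
    abel

/-- The Ricci identity, one slot at a time. -/
theorem lift_comm (h : IsConn S.d D) (p q : Fin n) (T : Fin n → M) (k : Fin n) :
    S.lift D p (S.lift D q T) k - S.lift D q (S.lift D p T) k
      = D p (D q (T k)) - D q (D p (T k)) - (S.c * S.g k q) • T p + (S.c * S.g k p) • T q := by
  -- The constant curvature equation contracted with `T`. All the later commutation rules are
  -- deduced from this use of it.
  have key : ∑ s, (S.d p (S.γ s k q) - S.d q (S.γ s k p)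
      + ∑ r, (S.γ r k q * S.γ s r p - S.γ r k p * S.γ s r q)) • T s
      = (S.c * S.g k q) • T p - (S.c * S.g k p) • T q := by
    simp only [S.curv]
    simp only [mul_sub, sub_smul, Finset.sum_sub_distrib, mul_ite, mul_zero, ite_smul,
      zero_smul, Finset.sum_ite_eq', Finset.mem_univ, if_true]
  have e1 : ∀ p q : Fin n, ∑ s, ∑ r, (S.γ r k q * S.γ s r p) • T s
      = ∑ s, S.γ s q k • ∑ r, S.γ r p s • T r := by
    intro p q
    rw [Finset.sum_comm]
    refine Finset.sum_congr rfl fun s _ => ?_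
    rw [Finset.smul_sum]
    refine Finset.sum_congr rfl fun r _ => ?_
    rw [smul_smul, S.γ_symm s k q, S.γ_symm r s p]
  simp only [add_smul, sub_smul, Finset.sum_add_distrib, Finset.sum_sub_distrib, Finset.sum_smul,
    e1] at key
  simp only [lift, h.sub, h.sum, h.leibniz, smul_sub, Finset.sum_add_distrib,
    Finset.sum_sub_distrib]
  simp only [S.γ_symm _ k] at key
  rw [sub_add, ← key]
  abel

/-- The antisymmetrised second covariant derivative is the commutator. -/
theorem hess_comm (p q : Fin n) (T : M) :
    S.lift D p (fun r => D r T) q - S.lift D q (fun r => D r T) p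
      = D p (D q T) - D q (D p T) := by
  simp only [lift, S.γ_symm _ p q]
  abel

end lift

/-- `∇_p` on covectors. -/
def nab1 := S.lift (fun p a => S.d p a)
/-- `∇_p` on covariant tensors with two slots. -/
def nab2 := S.lift S.nab1
/-- `∇_p` on covariant tensors with three slots. -/
def nab3 := S.lift S.nab2
/-- `∇_p` on covariant tensors with four slots. -/
def nab4 := S.lift S.nab3

theorem isConn1 : IsConn S.d S.nab1 := S.isConn_lift S.isConn_d
theorem isConn2 : IsConn S.d S.nab2 := S.isConn_lift S.isConn1
theorem isConn3 : IsConn S.d S.nab3 := S.isConn_lift S.isConn2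

theorem nab1_apply (p : Fin n) (T : Fin n → A) (k : Fin n) :
    S.nab1 p T k = S.d p (T k) - ∑ s, S.γ s p k * T s := rfl

theorem nab2_apply (p : Fin n) (T : Fin n → Fin n → A) (k l : Fin n) :
    S.nab2 p T k l = S.d p (T k l) - ∑ s, S.γ s p k * T s l - ∑ s, S.γ s p l * T k s := by
  simp only [nab2, lift, Pi.sub_apply, nab1_apply, Finset.sum_apply, Pi.smul_apply, smul_eq_mul]
  abel

theorem nab3_apply (p : Fin n) (T : Fin n → Fin n → Fin n → A) (k l i : Fin n) :
    S.nab3 p T k l i = S.d p (T k l i) - ∑ s, S.γ s p k * T s l i - ∑ s, S.γ s p l * T k s i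
      - ∑ s, S.γ s p i * T k l s := by
  simp only [nab3, lift, Pi.sub_apply, nab2_apply, Finset.sum_apply, Pi.smul_apply, smul_eq_mul]
  abel

theorem nab4_apply (p : Fin n) (T : Fin n → Fin n → Fin n → Fin n → A) (k l i j : Fin n) :
    S.nab4 p T k l i j = S.d p (T k l i j) - ∑ s, S.γ s p k * T s l i j
      - ∑ s, S.γ s p l * T k s i j - ∑ s, S.γ s p i * T k l s j - ∑ s, S.γ s p j * T k l i s := by
  simp only [nab4, lift, Pi.sub_apply, nab3_apply, Finset.sum_apply, Pi.smul_apply, smul_eq_mul]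
  abel

theorem nab2_g (p k l : Fin n) : S.nab2 p S.g k l = 0 := by
  rw [nab2_apply, d_g]
  abel

/-- The second covariant derivative `∇_i ∇_j ξ_k` of a covector. -/
def hess1 (ξ : Fin n → A) (i j k : Fin n) : A := S.nab2 i (fun r => S.nab1 r ξ) j k
/-- The second covariant derivative `∇_i ∇_l Ω_kj`. -/
def hess2 (Ω : Fin n → Fin n → A) (i l k j : Fin n) : A := S.nab3 i (fun r => S.nab2 r Ω) l k j
/-- The third covariant derivative of a covector. -/
def third1 (ξ : Fin n → A) (i l k j : Fin n) : A := S.nab3 i (S.hess1 ξ) l k j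
/-- The third covariant derivative of a tensor with two slots. -/
def third2 (Ω : Fin n → Fin n → A) (p i l k j : Fin n) : A := S.nab4 p (S.hess2 Ω) i l k j

theorem hess1_comm (ξ : Fin n → A) (i j k : Fin n) :
    S.hess1 ξ i j k - S.hess1 ξ j i k = - S.c * S.g k j * ξ i + S.c * S.g k i * ξ j := by
  have h1 := congrFun (S.hess_comm (D := S.nab1) i j ξ) k
  have h2 := S.lift_comm S.isConn_d i j ξ k
  simp only [Pi.sub_apply, smul_eq_mul, S.d_comm i j, sub_self] at h1 h2
  rw [hess1, hess1, nab2, h1, nab1, h2]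
  ring

/-- Here the derivative index `j` is a parameter and receives no Christoffel term; by `hess_comm`
this makes no difference after antisymmetrisation. Each further tensor slot adds one more pair of
terms in `c`. -/
theorem nab1_comm (ξ : Fin n → A) (i j k : Fin n) :
    S.nab1 i (S.nab1 j ξ) k - S.nab1 j (S.nab1 i ξ) k
      = - S.c * S.g k j * ξ i + S.c * S.g k i * ξ j := by
  have h2 := S.lift_comm S.isConn_d i j ξ k
  simp only [smul_eq_mul, S.d_comm i j, sub_self] at h2
  rw [nab1, h2]
  ring

theorem nab2_comm (Ω : Fin n → Fin n → A) (i j k l : Fin n) :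
    S.nab2 i (S.nab2 j Ω) k l - S.nab2 j (S.nab2 i Ω) k l
      = - S.c * S.g k j * Ω i l + S.c * S.g k i * Ω j l
        - S.c * S.g l j * Ω k i + S.c * S.g l i * Ω k j := by
  have h2 := congrFun (S.lift_comm S.isConn1 i j Ω k) l
  have h1 := S.nab1_comm (Ω k) i j l
  simp only [smul_eq_mul, Pi.sub_apply, Pi.add_apply, Pi.smul_apply] at h2
  rw [nab2, h2]
  linear_combination h1

theorem nab3_comm (Ω : Fin n → Fin n → Fin n → A) (i j k l q : Fin n) :
    S.nab3 i (S.nab3 j Ω) k l q - S.nab3 j (S.nab3 i Ω) k l q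
      = - S.c * S.g k j * Ω i l q + S.c * S.g k i * Ω j l q
        - S.c * S.g l j * Ω k i q + S.c * S.g l i * Ω k j q
        - S.c * S.g q j * Ω k l i + S.c * S.g q i * Ω k l j := by
  have h2 := congrFun (congrFun (S.lift_comm S.isConn2 i j Ω k) l) q
  have h1 := S.nab2_comm (Ω k) i j l q
  simp only [smul_eq_mul, Pi.sub_apply, Pi.add_apply, Pi.smul_apply] at h2
  rw [nab3, h2]
  linear_combination h1

theorem hess2_comm (Ω : Fin n → Fin n → A) (i j k l : Fin n) :
    S.hess2 Ω i j k l - S.hess2 Ω j i k l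
      = - S.c * S.g k j * Ω i l + S.c * S.g k i * Ω j l
        - S.c * S.g l j * Ω k i + S.c * S.g l i * Ω k j := by
  have h1 := congrFun (congrFun (S.hess_comm (D := S.nab2) i j Ω) k) l
  simp only [Pi.sub_apply] at h1
  rw [hess2, hess2, nab3, h1, nab2_comm]

theorem third1_comm (ξ : Fin n → A) (i j k l : Fin n) :
    S.third1 ξ i j k l - S.third1 ξ j i k l
      = - S.c * S.g k j * S.nab1 i ξ l + S.c * S.g k i * S.nab1 j ξ l
        - S.c * S.g l j * S.nab1 k ξ i + S.c * S.g l i * S.nab1 k ξ j :=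
  S.hess2_comm (fun r => S.nab1 r ξ) i j k l

theorem third2_comm (Ω : Fin n → Fin n → A) (p i l k j : Fin n) :
    S.third2 Ω p i l k j - S.third2 Ω i p l k j
      = - S.c * S.g l i * S.nab2 p Ω k j + S.c * S.g l p * S.nab2 i Ω k j
        - S.c * S.g k i * S.nab2 l Ω p j + S.c * S.g k p * S.nab2 l Ω i j
        - S.c * S.g j i * S.nab2 l Ω k p + S.c * S.g j p * S.nab2 l Ω k i := by
  have h1 := congrFun (congrFun (congrFun
    (S.hess_comm (D := S.nab3) p i (fun r => S.nab2 r Ω)) l) k) j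
  simp only [Pi.sub_apply] at h1
  exact h1.trans (S.nab3_comm _ p i l k j)

/-- The Leibniz rule for a tensor product. One version is needed for each arrangement of the slots
among the factors. -/
theorem nab3_mul (p : Fin n) (F : Fin n → A) (G : Fin n → Fin n → A) (k l i : Fin n) :
    S.nab3 p (fun k l i => F k * G l i) k l i
      = S.nab1 p F k * G l i + F k * S.nab2 p G l i := by
  simp only [nab3_apply, nab2_apply, nab1_apply, Derivation.leibniz, smul_eq_mul, sub_mul,
    mul_sub, Finset.sum_mul, Finset.mul_sum, mul_left_comm _ (F k), mul_assoc]
  ring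

theorem nab4_mul (p : Fin n) (F G : Fin n → Fin n → A) (k l i j : Fin n) :
    S.nab4 p (fun k l i j => F k i * G l j) k l i j
      = S.nab2 p F k i * G l j + F k i * S.nab2 p G l j := by
  simp only [nab4_apply, nab2_apply, Derivation.leibniz, smul_eq_mul, sub_mul,
    mul_sub, Finset.sum_mul, Finset.mul_sum, mul_left_comm _ (F k i), mul_assoc]
  ring

theorem nab4_mul' (p : Fin n) (F G : Fin n → Fin n → A) (k l i j : Fin n) :
    S.nab4 p (fun k l i j => F k j * G l i) k l i j
      = S.nab2 p F k j * G l i + F k j * S.nab2 p G l i := by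
  simp only [nab4_apply, nab2_apply, Derivation.leibniz, smul_eq_mul, sub_mul,
    mul_sub, Finset.sum_mul, Finset.mul_sum, mul_left_comm _ (F k j), mul_assoc]
  ring

/-- This is `∇_i` applied to `hess1_comm`: the coefficients `c g` pass through because `c` is
constant and `∇g = 0`. -/
theorem third1_comm' (ξ : Fin n → A) (i l k j : Fin n) :
    S.third1 ξ i l k j - S.third1 ξ i k l j
      = - S.c * S.g j k * S.nab1 i ξ l + S.c * S.g j l * S.nab1 i ξ k := by
  have h1 : (fun l k j => S.hess1 ξ l k j - S.hess1 ξ k l j)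
      = fun l k j => - S.c * S.g j k * ξ l + S.c * S.g j l * ξ k := by
    funext l k j
    exact S.hess1_comm ξ l k j
  have h2 : S.third1 ξ i l k j - S.third1 ξ i k l j
      = S.nab3 i (fun l k j => S.hess1 ξ l k j - S.hess1 ξ k l j) l k j := by
    simp only [third1, nab3_apply, map_sub, mul_sub, Finset.sum_sub_distrib]
    abel
  rw [h2, h1]
  have h3 : (fun l k j => - S.c * S.g j k * ξ l + S.c * S.g j l * ξ k)
      = fun l k j => S.c * (ξ k * S.g l j) - S.c * (ξ l * S.g k j) := by
    funext l k j
    rw [S.g_symm j k, S.g_symm j l]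
    ring
  have e1 := S.nab3_mul i ξ S.g l k j
  have e2 := S.nab3_mul i ξ S.g k l j
  have h4 : S.nab3 i (fun l k j => S.c * (ξ k * S.g l j) - S.c * (ξ l * S.g k j)) l k j
      = S.c * S.nab3 i (fun k l j => ξ k * S.g l j) k l j
        - S.c * S.nab3 i (fun l k j => ξ l * S.g k j) l k j := by
    simp only [nab3_apply, map_sub, Derivation.leibniz _ S.c,
      S.d_c, mul_sub, Finset.sum_sub_distrib, smul_eq_mul, mul_zero, add_zero,
      mul_left_comm _ S.c, ← Finset.mul_sum]
    ring
  rw [h3, h4, e1, e2, nab2_g, nab2_g, S.g_symm j k, S.g_symm j l]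
  ring

/-- Twice the Riemann operator, with all indices lowered. -/
def riem2 (Ω : Fin n → Fin n → A) (k l i j : Fin n) : A :=
  S.hess2 Ω i l k j - S.hess2 Ω i k l j - S.hess2 Ω j l k i + S.hess2 Ω j k l i
    - S.c * (S.g k i * Ω l j - S.g k j * Ω l i - Ω k j * S.g l i + Ω k i * S.g l j)

/-- The Killing operator, with all indices lowered. -/
def kil (ξ : Fin n → A) (i j : Fin n) : A := S.nab1 i ξ j + S.nab1 j ξ i

/-- The Bianchi operator, with all indices lowered. -/
def bia (R : Fin n → Fin n → Fin n → Fin n → A) (k l p i j : Fin n) : A :=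
  S.nab4 p R k l i j + S.nab4 i R k l j p + S.nab4 j R k l p i

theorem hess2_kil (ξ : Fin n → A) (i l k j : Fin n) :
    S.hess2 (S.kil ξ) i l k j = S.third1 ξ i l k j + S.third1 ξ i l j k := by
  have : ∀ r k j, S.nab2 r (S.kil ξ) k j = S.hess1 ξ r k j + S.hess1 ξ r j k := by
    intro r k j
    simp only [hess1, nab2_apply, kil, map_add, mul_add, Finset.sum_add_distrib]
    abel
  simp only [hess2, third1, nab3_apply, this, map_add, mul_add, Finset.sum_add_distrib]
  abel

/-- The eight third derivatives of `ξ` cancel once their indices are commuted, and the curvature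
terms so produced are exactly the zero-order terms of `riem2`. -/
theorem riem2_kil (ξ : Fin n → A) (k l i j : Fin n) : S.riem2 (S.kil ξ) k l i j = 0 := by
  simp only [riem2, hess2_kil, kil]
  -- As a simp rule, `g_symm` puts each pair of indices of the metric in a fixed order before `ring`
  -- runs.
  linear_combination (norm := (simp only [S.g_symm]; ring)) S.third1_comm' ξ i l k j - S.third1_comm' ξ j l k i + S.third1_comm' ξ i l j k
    - S.third1_comm' ξ i k j l
    - S.third1_comm' ξ j l i k + S.third1_comm' ξ j k i l
    + S.third1_comm ξ i j l k - S.third1_comm ξ i j k l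

theorem hess2_symm {Ω : Fin n → Fin n → A} (h : ∀ i j, Ω i j = Ω j i) (i l k j : Fin n) :
    S.hess2 Ω i l k j = S.hess2 Ω i l j k := by
  have : ∀ r k j, S.nab2 r Ω k j = S.nab2 r Ω j k := by
    intro r k j
    simp only [nab2_apply, h k, h _ j]
    abel
  simp only [hess2, nab3_apply, this _ k, this _ _ j]
  abel

theorem riem2_cyc {Ω : Fin n → Fin n → A} (h : ∀ i j, Ω i j = Ω j i) (k l i j : Fin n) :
    S.riem2 Ω k l i j + S.riem2 Ω k i j l + S.riem2 Ω k j l i = 0 := by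
  simp only [riem2]
  linear_combination S.hess2_comm Ω i l k j + S.hess2_comm Ω j i k l + S.hess2_comm Ω l j k i
    - S.hess2_symm h i k l j - S.hess2_symm h j k i l - S.hess2_symm h l k j i

/-- Since `∇g = 0` and `c` is constant, `∇_p` only reaches `Ω` in the zero-order terms. -/
theorem nab4_riem2 (Ω : Fin n → Fin n → A) (p k l i j : Fin n) :
    S.nab4 p (S.riem2 Ω) k l i j
      = S.third2 Ω p i l k j - S.third2 Ω p i k l j - S.third2 Ω p j l k i + S.third2 Ω p j k l i
        - S.c * (S.g k i * S.nab2 p Ω l j - S.g k j * S.nab2 p Ω l i - S.nab2 p Ω k j * S.g l i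
          + S.nab2 p Ω k i * S.g l j) := by
  have e1 := S.nab4_mul p S.g Ω k l i j
  have e2 := S.nab4_mul' p S.g Ω k l i j
  have e3 := S.nab4_mul' p Ω S.g k l i j
  have e4 := S.nab4_mul p Ω S.g k l i j
  rw [nab2_g] at e1 e2 e3 e4
  simp only [nab4_apply] at e1 e2 e3 e4
  simp only [third2, nab4_apply, riem2, map_sub, map_add, mul_add, mul_sub,
    Finset.sum_add_distrib, Finset.sum_sub_distrib, Derivation.leibniz _ S.c, S.d_c, smul_eq_mul,
    mul_zero, add_zero, mul_left_comm _ S.c, ← Finset.mul_sum]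
  linear_combination -S.c * e1 + S.c * e2 + S.c * e3 - S.c * e4

/-- The twelve third derivatives of `Ω` form six commutators in their first two indices. The terms
`c g ∇Ω` that these leave cancel the derivatives of the zero-order terms. -/
theorem bia_riem2 {Ω : Fin n → Fin n → A} (h : ∀ i j, Ω i j = Ω j i) (k l p i j : Fin n) :
    S.bia (S.riem2 Ω) k l p i j = 0 := by
  have hs : ∀ r k j, S.nab2 r Ω k j = S.nab2 r Ω j k := by
    intro r k j
    simp only [nab2_apply, h k, h _ j]
    abel
  simp only [bia, nab4_riem2]
  linear_combination (norm := (simp only [S.g_symm, hs]; ring)) S.third2_comm Ω p i l k j 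
    + S.third2_comm Ω i j l k p + S.third2_comm Ω j p l k i - S.third2_comm Ω p i k l j - S.third2_comm Ω i j k l p
    - S.third2_comm Ω j p k l i

end ConstCurv
end DiffRing

/-! ### Christoffel symbols, lowering of indices, and the operators in mixed components. -/

section DiffRing
variable {n : ℕ} {A : Type*} [CommRing A] [Algebra ℝ A]

/-- `1/2` in an `ℝ`-algebra. -/
def half (A : Type*) [CommRing A] [Algebra ℝ A] : A := algebraMap ℝ A (1 / 2)

theorem two_mul_half : (2 : A) * half A = 1 := by
  rw [half, ← map_ofNat (algebraMap ℝ A) 2, ← map_mul]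
  norm_num

theorem derivation_half (D : Derivation ℝ A A) : D (half A) = 0 := D.map_algebraMap _

theorem eq_of_two_mul {a b : A} (h : 2 * a = 2 * b) : a = b := by
  linear_combination half A * h + (b - a) * two_mul_half (A := A)

/-- `∂_i h_rj + ∂_j h_ri - ∂_r h_ij` -/
def fk (d : Fin n → Derivation ℝ A A) (h : Fin n → Fin n → A) (r i j : Fin n) : A :=
  d i (h r j) + d j (h r i) - d r (h i j)

/-- Lowering an index. -/
def low (g : Fin n → Fin n → A) (X : Fin n → A) (a : Fin n) : A := ∑ k, g a k * X k

omit [Algebra ℝ A] in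
theorem low_raise {g gi : Fin n → Fin n → A}
    (h : ∀ i j, ∑ r, g i r * gi r j = if i = j then 1 else 0) (X : Fin n → A) :
    low g (low gi X) = X := by
  funext a
  have : ∀ k, g a k * low gi X k = ∑ r, g a k * gi k r * X r := fun k => by
    rw [low, Finset.mul_sum]
    exact Finset.sum_congr rfl fun r _ => by ring
  simp only [low] at this
  simp only [low, this]
  rw [Finset.sum_comm]
  simp only [← Finset.sum_mul, h, ite_mul, one_mul, zero_mul, Finset.sum_ite_eq, Finset.mem_univ,
    if_true]

/-- The Christoffel symbols. -/
def chr (d : Fin n → Derivation ℝ A A) (g gi : Fin n → Fin n → A) (k i j : Fin n) : A :=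
  half A * ∑ r, gi k r * fk d g r i j

theorem chr_symm {d : Fin n → Derivation ℝ A A} {g gi : Fin n → Fin n → A}
    (hg : ∀ i j, g i j = g j i) (k i j : Fin n) : chr d g gi k i j = chr d g gi k j i := by
  simp only [chr, fk]
  congr 1
  refine Finset.sum_congr rfl fun r _ => ?_
  rw [hg i j]
  ring

theorem d_metric {d : Fin n → Derivation ℝ A A} {g gi : Fin n → Fin n → A}
    (hg : ∀ i j, g i j = g j i)
    (h : ∀ i j, ∑ r, g i r * gi r j = if i = j then 1 else 0) (i j k : Fin n) :
    d i (g j k) = ∑ s, chr d g gi s i j * g s k + ∑ s, chr d g gi s i k * g j s := by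
  have key : ∀ a i j, ∑ s, g a s * chr d g gi s i j = half A * fk d g a i j := by
    intro a i j
    have := congrFun (low_raise h (fun r => fk d g r i j)) a
    rw [← this, low, Finset.mul_sum]
    refine Finset.sum_congr rfl fun s _ => ?_
    rw [chr, low]
    ring
  have e1 : ∑ s, chr d g gi s i j * g s k = half A * fk d g k i j := by
    rw [← key]
    exact Finset.sum_congr rfl fun s _ => by rw [hg s k, mul_comm]
  have e2 : ∑ s, chr d g gi s i k * g j s = half A * fk d g j i k := by
    rw [← key]
    exact Finset.sum_congr rfl fun s _ => by rw [mul_comm]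
  rw [e1, e2, fk, fk, hg k j, hg k i, hg j i]
  linear_combination -d i (g j k) * two_mul_half (A := A)

namespace ConstCurv
variable (S : ConstCurv n A)

/-- Lowering commutes with covariant differentiation because the connection is metric. -/
theorem low_nab (i : Fin n) (X : Fin n → A) (a : Fin n) :
    low S.g (fun k => S.d i (X k) + ∑ s, S.γ k i s * X s) a = S.nab1 i (low S.g X) a := by
  have e1 : ∑ k, (∑ s, S.γ s i a * S.g s k) * X k = ∑ s, S.γ s i a * ∑ k, S.g s k * X k := by
    simp only [Finset.sum_mul, Finset.mul_sum]
    rw [Finset.sum_comm]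
    exact Finset.sum_congr rfl fun _ _ => Finset.sum_congr rfl fun _ _ => by ring
  have e2 : ∑ k, (∑ s, S.γ s i k * S.g a s) * X k = ∑ k, S.g a k * ∑ s, S.γ k i s * X s := by
    simp only [Finset.sum_mul, Finset.mul_sum]
    rw [Finset.sum_comm]
    exact Finset.sum_congr rfl fun _ _ => Finset.sum_congr rfl fun _ _ => by ring
  simp only [low, nab1_apply, map_sum, Derivation.leibniz, smul_eq_mul, S.d_g, mul_add,
    Finset.sum_add_distrib, mul_comm (X _), add_mul, e1, e2]
  ring

/-- Koszul's argument: in the alternating sum of three instances of `d_g`, the symmetry of `γ`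
cancels all but one Christoffel term, which appears twice. -/
theorem low_γ (a i j : Fin n) : 2 * ∑ s, S.g a s * S.γ s i j = fk S.d S.g a i j := by
  have e1 : ∀ a i j, ∑ s, S.γ s i j * S.g a s = ∑ s, S.g a s * S.γ s i j := fun a i j =>
    Finset.sum_congr rfl fun s _ => by ring
  have e2 : ∀ a i j, ∑ s, S.γ s i j * S.g s a = ∑ s, S.g a s * S.γ s i j := fun a i j =>
    Finset.sum_congr rfl fun s _ => by rw [S.g_symm s a]; ring
  simp only [fk, S.d_g, e1, e2]
  simp only [S.γ_symm _ j i, S.γ_symm _ i a, S.γ_symm _ j a]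
  ring

/-- In the Lie derivative, `low_γ` trades the derivatives of the metric for the two Christoffel
terms of `∇_i ξ_j + ∇_j ξ_i`. -/
theorem kil_low (ξ : Fin n → A) (i j : Fin n) :
    ∑ r, (S.g r j * S.d i (ξ r) + S.g i r * S.d j (ξ r) + ξ r * S.d r (S.g i j))
      = S.kil (low S.g ξ) i j := by
  have e : ∑ s, S.γ s i j * ∑ r, S.g s r * ξ r = ∑ r, (∑ s, S.g r s * S.γ s i j) * ξ r := by
    simp only [Finset.sum_mul, Finset.mul_sum]
    rw [Finset.sum_comm]
    exact Finset.sum_congr rfl fun r _ => Finset.sum_congr rfl fun s _ => by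
      rw [S.g_symm s r]; ring
  simp only [kil, nab1_apply, low, S.γ_symm _ j i, e]
  simp only [map_sum, Derivation.leibniz, smul_eq_mul]
  have h : ∀ r, (∑ s, S.g r s * S.γ s i j) * ξ r + (∑ s, S.g r s * S.γ s i j) * ξ r
      = (S.d i (S.g r j) + S.d j (S.g r i) - S.d r (S.g i j)) * ξ r := fun r => by
    have := S.low_γ r i j
    rw [fk] at this
    linear_combination ξ r * this
  have h' := Finset.sum_congr (s₁ := Finset.univ) rfl fun r _ => h r
  rw [Finset.sum_add_distrib] at h'
  have h2 : ∑ r, (S.g r j * S.d i (ξ r) + S.g i r * S.d j (ξ r) + ξ r * S.d r (S.g i j))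
    = ∑ r, (S.g j r * S.d i (ξ r) + ξ r * S.d i (S.g j r))
      + ∑ r, (S.g i r * S.d j (ξ r) + ξ r * S.d j (S.g i r))
      - ∑ r, (S.d i (S.g r j) + S.d j (S.g r i) - S.d r (S.g i j)) * ξ r := by
    rw [← Finset.sum_add_distrib, ← Finset.sum_sub_distrib]
    refine Finset.sum_congr rfl fun r _ => ?_
    rw [S.g_symm j r, S.g_symm r i]
    ring
  rw [h2]
  linear_combination h'

/-- The variation of the Christoffel symbols. -/
def varChr (Ω : Fin n → Fin n → A) (k i j : Fin n) : A :=
  ∑ r, S.gi k r * (half A * fk S.d Ω r i j - ∑ s, Ω r s * S.γ s i j)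

/-- The variation of the Christoffel symbols, lowered. -/
def varLow (Ω : Fin n → Fin n → A) (a i j : Fin n) : A := ∑ k, S.g a k * S.varChr Ω k i j

/-- The variation of a connection is a tensor: the terms in `Ω γ` are just those that turn partial
into covariant derivatives in the Christoffel formula. -/
theorem varLow_eq {Ω : Fin n → Fin n → A} (h : ∀ i j, Ω i j = Ω j i) (a i j : Fin n) :
    2 * S.varLow Ω a i j = S.nab2 i Ω a j + S.nab2 j Ω a i - S.nab2 a Ω i j := by
  have e : S.varLow Ω a i j = half A * fk S.d Ω a i j - ∑ s, Ω a s * S.γ s i j :=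
    congrFun (low_raise S.g_gi (fun r => half A * fk S.d Ω r i j - ∑ s, Ω r s * S.γ s i j)) a
  simp only [mul_comm (Ω _ _)] at e
  rw [e]
  simp only [nab2_apply, fk]
  simp only [h i, S.γ_symm _ j i, S.γ_symm _ i a, S.γ_symm _ j a]
  linear_combination (S.d i (Ω a j) + S.d j (Ω a i) - S.d a (Ω j i)) * two_mul_half (A := A)

/-- The Riemann operator, in mixed components. -/
def riem (Ω : Fin n → Fin n → A) (k l i j : Fin n) : A :=
  S.d i (S.varChr Ω k l j) - S.d j (S.varChr Ω k l i)
    + ∑ r, (S.varChr Ω r l j * S.γ k r i + S.γ r l j * S.varChr Ω k r i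
      - S.varChr Ω r l i * S.γ k r j - S.γ r l i * S.varChr Ω k r j)
    - S.c * ((if k = i then Ω l j else 0) - (if k = j then Ω l i else 0))

/-- Palatini's formula: the variation of the curvature is `∇_i Γ_j - ∇_j Γ_i`, and `varLow_eq`
expresses `Γ` through `∇Ω`. -/
theorem low_riem {Ω : Fin n → Fin n → A} (h : ∀ i j, Ω i j = Ω j i) (a l i j : Fin n) :
    2 * low S.g (fun k => S.riem Ω k l i j) a = S.riem2 Ω a l i j := by
  have e1 := S.low_nab i (fun k => S.varChr Ω k l j) a
  have e2 := S.low_nab j (fun k => S.varChr Ω k l i) a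
  have e3 : ∀ i j, ∑ k, S.g a k * ∑ r, S.γ r l j * S.varChr Ω k r i
      = ∑ r, S.γ r l j * S.varLow Ω a r i := by
    intro i j
    simp only [varLow, Finset.mul_sum]
    rw [Finset.sum_comm]
    exact Finset.sum_congr rfl fun r _ => Finset.sum_congr rfl fun s _ => by ring
  have e4 : low S.g (fun k => S.riem Ω k l i j) a
      = S.nab1 i (fun a => S.varLow Ω a l j) a - S.nab1 j (fun a => S.varLow Ω a l i) a
        + ∑ r, S.γ r l j * S.varLow Ω a r i - ∑ r, S.γ r l i * S.varLow Ω a r j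
        - S.c * (S.g a i * Ω l j - S.g a j * Ω l i) := by
    have f1 : (fun a => S.varLow Ω a l j) = low S.g (fun k => S.varChr Ω k l j) := rfl
    have f2 : (fun a => S.varLow Ω a l i) = low S.g (fun k => S.varChr Ω k l i) := rfl
    rw [f1, f2, ← e1, ← e2, ← e3, ← e3]
    have f3 : S.g a i * Ω l j - S.g a j * Ω l i
        = ∑ k, S.g a k * ((if k = i then Ω l j else 0) - (if k = j then Ω l i else 0)) := by
      simp [mul_sub, Finset.sum_sub_distrib]
    rw [f3]
    simp only [low, ← Finset.sum_add_distrib, ← Finset.sum_sub_distrib, Finset.mul_sum,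
      riem, S.γ_symm _ i, S.γ_symm _ j]
    refine Finset.sum_congr rfl fun k _ => ?_
    simp only [mul_add, mul_sub, Finset.sum_add_distrib, Finset.sum_sub_distrib, Finset.mul_sum,
      mul_comm (S.varChr Ω _ _ _)]
    ring
  have e5 : ∀ i j, 2 * S.nab3 i (S.varLow Ω) a l j
      = S.hess2 Ω i l a j + S.hess2 Ω i j a l - S.hess2 Ω i a l j := by
    intro i j
    have : 2 * S.nab3 i (S.varLow Ω) a l j
        = S.nab3 i (fun a l j => 2 * S.varLow Ω a l j) a l j := by
      simp only [two_mul, nab3_apply, map_add, mul_add, Finset.sum_add_distrib]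
      abel
    rw [this]
    simp only [S.varLow_eq h, hess2, nab3_apply, map_add, map_sub, mul_add, mul_sub,
      Finset.sum_add_distrib, Finset.sum_sub_distrib]
    abel
  have e6 := e5 i j
  have e7 := e5 j i
  rw [nab3_apply] at e6 e7
  rw [e4, nab1_apply, nab1_apply, riem2]
  -- Palatini's formula also contains the commutator of `∇_i` and `∇_j` on `Ω`. Replacing it by its
  -- zero-order value gives `riem2` a form visibly antisymmetric in its first two indices.
  have e8 := S.hess2_comm Ω i j a l
  simp only [S.γ_symm _ l, S.γ_symm _ j i, h l] at e6 e7 e8 ⊢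
  linear_combination e6 - e7 + e8

/-- The covariant derivative `∇_p R^k_{l,ij}`, with `R i j l k = R^k_{l,ij}`. -/
def covD (R : Fin n → Fin n → Fin n → Fin n → A) (p i j l k : Fin n) : A :=
  S.d p (R i j l k) + ∑ s, (S.γ k p s * R i j l s - S.γ s p l * R i j s k
    - S.γ s p i * R s j l k - S.γ s p j * R i s l k)

theorem low_covD (R : Fin n → Fin n → Fin n → Fin n → A) (p i j l a : Fin n) :
    low S.g (fun k => S.covD R p i j l k) a
      = S.nab4 p (fun a l i j => low S.g (R i j l) a) a l i j := by
  have e1 := S.low_nab p (fun k => R i j l k) a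
  have e3 : ∀ (l : Fin n) (Q : Fin n → Fin n → A), ∑ k, S.g a k * ∑ s, S.γ s p l * Q s k
      = ∑ s, S.γ s p l * low S.g (Q s) a := by
    intro l Q
    simp only [low, Finset.mul_sum]
    rw [Finset.sum_comm]
    exact Finset.sum_congr rfl fun r _ => Finset.sum_congr rfl fun s _ => by ring
  have f1 := e3 l (fun s k => R i j s k)
  have f2 := e3 i (fun s k => R s j l k)
  have f3 := e3 j (fun s k => R i s l k)
  have e4 := S.nab1_apply p (low S.g (R i j l)) a
  rw [nab4_apply, ← f1, ← f2, ← f3]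
  rw [e4] at e1
  rw [← e1]
  simp only [low, covD, Finset.sum_sub_distrib, mul_add, mul_sub, Finset.sum_add_distrib]
  ring

end ConstCurv
end DiffRing

/-! ### Order of vanishing at a point; solving the flat Killing equation degree by degree. -/

section Filtration
variable {n : ℕ} {A : Type*} [CommRing A] [Algebra ℝ A]

/-- The elements all of whose derivatives of order less than `m` vanish at a point. -/
def van (d : Fin n → Derivation ℝ A A) (ev : A →ₐ[ℝ] ℝ) : ℕ → Ideal A
  | 0 => ⊤
  | m + 1 =>
    -- The middle condition follows from the others (`mem_van_succ`). Carrying it makes the set an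
    -- ideal at once, since the Leibniz rule produces a multiple of the undifferentiated `a`.
    { carrier := {a | ev a = 0 ∧ a ∈ van d ev m ∧ ∀ i, d i a ∈ van d ev m}
      add_mem' := fun {a b} ha hb => ⟨by rw [map_add, ha.1, hb.1, add_zero],
        add_mem ha.2.1 hb.2.1, fun i => by
          rw [map_add]
          exact add_mem (ha.2.2 i) (hb.2.2 i)⟩
      zero_mem' := ⟨map_zero _, zero_mem _, fun i => by
        rw [map_zero]
        exact zero_mem _⟩
      smul_mem' := fun b a ha => ⟨by rw [smul_eq_mul, map_mul, ha.1, mul_zero],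
        Ideal.mul_mem_left _ b ha.2.1, fun i => by
          rw [smul_eq_mul, Derivation.leibniz]
          exact add_mem (Ideal.mul_mem_left _ _ (ha.2.2 i)) (Ideal.mul_mem_right _ _ ha.2.1)⟩ }

variable {d : Fin n → Derivation ℝ A A} {ev : A →ₐ[ℝ] ℝ}

theorem mem_van_zero (a : A) : a ∈ van d ev 0 := Submodule.mem_top

theorem van_succ_le (m : ℕ) : van d ev (m + 1) ≤ van d ev m := fun _ ha => ha.2.1

theorem van_anti : Antitone (van d ev) := antitone_nat_of_succ_le van_succ_le

theorem d_mem_van {m : ℕ} {a : A} (h : a ∈ van d ev (m + 1)) (i : Fin n) :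
    d i a ∈ van d ev m := h.2.2 i

theorem ev_eq_zero {m : ℕ} {a : A} (h : a ∈ van d ev (m + 1)) : ev a = 0 := h.1

theorem mem_van_one {a : A} (h : ev a = 0) : a ∈ van d ev 1 :=
  ⟨h, mem_van_zero _, fun _ => mem_van_zero _⟩

theorem mem_van_succ {m : ℕ} {a : A} (h : ev a = 0) (h' : ∀ i, d i a ∈ van d ev m) :
    a ∈ van d ev (m + 1) := by
  induction m with
  | zero => exact mem_van_one h
  | succ m ih => exact ⟨h, ih fun i => van_succ_le _ (h' i), h'⟩

theorem mem_van_succ_iff {m : ℕ} {a : A} :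
    a ∈ van d ev (m + 1) ↔ ev a = 0 ∧ ∀ i, d i a ∈ van d ev m :=
  ⟨fun h => ⟨h.1, h.2.2⟩, fun h => mem_van_succ h.1 h.2⟩

theorem smul_mem_van {m : ℕ} {a : A} (h : a ∈ van d ev m) (r : ℝ) : r • a ∈ van d ev m := by
  rw [Algebra.smul_def]
  exact Ideal.mul_mem_left _ _ h

/-- Coordinates centred at the point `ev`. -/
structure Coord (d : Fin n → Derivation ℝ A A) (ev : A →ₐ[ℝ] ℝ) (t : Fin n → A) : Prop where
  d_t : ∀ i k, d i (t k) = if i = k then 1 else 0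
  ev_t : ∀ k, ev (t k) = 0
  comm : ∀ i j a, d i (d j a) = d j (d i a)

namespace Coord
variable {t : Fin n → A} (C : Coord d ev t)
include C

theorem t_mul {m : ℕ} {a : A} (h : a ∈ van d ev m) (k : Fin n) : t k * a ∈ van d ev (m + 1) := by
  induction m generalizing a with
  | zero => exact mem_van_one (by rw [map_mul, C.ev_t, zero_mul])
  | succ m ih =>
    refine mem_van_succ (by rw [map_mul, C.ev_t, zero_mul]) fun i => ?_
    rw [Derivation.leibniz, C.d_t]
    refine add_mem (ih (d_mem_van h i)) ?_
    exact Ideal.mul_mem_right _ _ h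

theorem sum_t_mul {m : ℕ} {X : Fin n → A} (h : ∀ k, X k ∈ van d ev m) :
    ∑ k, t k * X k ∈ van d ev (m + 1) :=
  sum_mem fun k _ => C.t_mul (h k) k

theorem d_sum (p : Fin n) (X : Fin n → A) :
    d p (∑ k, t k * X k) = X p + ∑ k, t k * d p (X k) := by
  simp only [map_sum, Derivation.leibniz, C.d_t, smul_eq_mul, Finset.sum_add_distrib, mul_ite,
    mul_one, mul_zero, Finset.sum_ite_eq, Finset.mem_univ, if_true]
  ring

/-- Euler's relation for the leading part of `a`, which is homogeneous of degree `m`.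
Differentiating lowers `m` by one, whence the induction. -/
theorem euler {m : ℕ} {a : A} (h : a ∈ van d ev m) :
    ∑ k, t k * d k a - m * a ∈ van d ev (m + 1) := by
  induction m generalizing a with
  | zero =>
    refine mem_van_one ?_
    simp [map_sum, C.ev_t]
  | succ m ih =>
    refine mem_van_succ ?_ fun i => ?_
    · simp [map_sum, C.ev_t, ev_eq_zero h]
    · have := ih (d_mem_van h i)
      have e : d i (∑ k, t k * d k a - (m + 1 : ℕ) * a)
          = ∑ k, t k * d k (d i a) - m * d i a := by
        rw [map_sub, C.d_sum, Derivation.leibniz, Derivation.map_natCast]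
        simp only [C.comm i, smul_eq_mul, mul_zero, add_zero]
        push_cast
        ring
      rwa [e]

/-- Two coordinates gain two orders and the derivative loses at most one. When `m = 0` there is
nothing to lose, hence the separate case. -/
theorem t_t_d {m : ℕ} {a : A} (h : a ∈ van d ev m) (i k l : Fin n) :
    t k * (t l * d i a) ∈ van d ev (m + 1) := by
  cases m with
  | zero => exact van_succ_le _ (C.t_mul (C.t_mul (mem_van_zero _) _) _)
  | succ m => exact C.t_mul (C.t_mul (d_mem_van h i) _) _

/-- The Euler relation for a derivative, multiplied by a coordinate. -/
theorem t_euler_d {m : ℕ} {a : A} (h : a ∈ van d ev m) (i b : Fin n) :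
    t b * (∑ k, t k * d k (d i a)) - (m - 1) * (t b * d i a) ∈ van d ev (m + 1) := by
  -- Differentiating the relation for `a`, rather than using that for `d i a`, keeps the case `m =
  -- 0`: the coefficient `m - 1` is taken in `A` and is then `-1`.
  have := C.t_mul (d_mem_van (C.euler h) i) b
  rw [map_sub, C.d_sum, Derivation.leibniz, Derivation.map_natCast] at this
  simp only [C.comm i, smul_eq_mul, mul_zero, add_zero] at this
  convert this using 1
  ring

/-- The principal part of twice the Riemann operator. -/
def _root_.KillingSeq.flat (d : Fin n → Derivation ℝ A A) (h : Fin n → Fin n → A)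
    (k l i j : Fin n) : A :=
  d i (d l (h k j)) - d i (d k (h l j)) - d j (d l (h k i)) + d j (d k (h l i))

/-- A constant symmetric `h` is the flat Killing image of the linear field `(1/2) t^k h_ki`; no
condition on `h` arises. -/
theorem killing_zero {h : Fin n → Fin n → A} (hs : ∀ i j, h i j = h j i) :
    ∃ ξ : Fin n → A, (∀ i, ξ i ∈ van d ev 1) ∧
      ∀ i j, h i j - (d i (ξ j) + d j (ξ i)) ∈ van d ev 1 := by
  refine ⟨fun i => half A * ∑ k, t k * h k i, fun i => Ideal.mul_mem_left _ _
    (C.sum_t_mul fun k => mem_van_zero _), fun i j => ?_⟩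
  have h1 := C.sum_t_mul (m := 0) (X := fun k => d i (h k j)) fun k => mem_van_zero _
  have h2 := C.sum_t_mul (m := 0) (X := fun k => d j (h k i)) fun k => mem_van_zero _
  simp only [Derivation.leibniz, derivation_half, C.d_sum, smul_eq_mul, mul_zero, add_zero]
  have := Ideal.mul_mem_left _ (-half A) (add_mem h1 h2)
  convert this using 1
  rw [hs j i]
  linear_combination -h i j * two_mul_half (A := A)

/-- A polynomial homotopy: `ζ_i = 2(m+1) t^k h_ki - t^k t^l ∂_i h_kl` has flat Killing image
`2(m+1)(m+2) h` to leading order. The error consists of Euler relations and of the flat curvature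
contracted twice with the coordinates. -/
theorem killing_succ {m : ℕ} {h : Fin n → Fin n → A} (hs : ∀ i j, h i j = h j i)
    (hv : ∀ i j, h i j ∈ van d ev (m + 1)) (hf : ∀ k l i j, flat d h k l i j ∈ van d ev m) :
    ∃ ξ : Fin n → A, (∀ i, ξ i ∈ van d ev (m + 2)) ∧
      ∀ i j, h i j - (d i (ξ j) + d j (ξ i)) ∈ van d ev (m + 2) := by
  set ζ : Fin n → A := fun i => (2 * (m + 1)) * ∑ k, t k * h k i
    - ∑ k, t k * ∑ l, t l * d i (h k l) with hζ
  set V := van d ev (m + 2) with hV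
  have hζv : ∀ i, ζ i ∈ V := fun i => sub_mem
    (Ideal.mul_mem_left _ _ (C.sum_t_mul fun k => hv _ _))
    (C.sum_t_mul fun k => C.sum_t_mul fun l => d_mem_van (hv k l) i)
  set P : Fin n → Fin n → A := fun l j => ∑ k, t k * d l (h k j) with hP
  set Q : Fin n → Fin n → A := fun l j => ∑ k, t k * ∑ i, t i * d l (d j (h k i)) with hQ
  have hd : ∀ l j, d l (ζ j) = 2 * (m + 1) * (h j l + P l j) - 2 * P j l - Q l j := by
    intro l j
    have e : (2 * (m + 1) : A) = ((2 * (m + 1) : ℕ) : A) := by push_cast; ring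
    simp only [hζ, map_sub, C.d_sum, Derivation.leibniz, e, Derivation.map_natCast, mul_add,
      Finset.sum_add_distrib, smul_eq_mul, mul_zero, add_zero, hP, hQ, hs l]
    ring
  -- Congruences modulo `V` become equations in the quotient ring, where they can be combined
  -- linearly.
  have hq : ∀ a : A, a ∈ V ↔ Ideal.Quotient.mk V a = 0 := fun a =>
    Ideal.Quotient.eq_zero_iff_mem.symm
  have hmain : ∀ l j, d l (ζ j) + d j (ζ l) - (2 * (m + 1) * (m + 2)) * h l j ∈ V := by
    intro l j
    -- The hypothesis on the curvature enters here: two coordinates raise its order from `m` to `m +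
    -- 2`.
    have f1 : ∑ k, t k * ∑ i, t i * flat d h k l i j ∈ V :=
      C.sum_t_mul fun k => C.sum_t_mul fun i => hf k l i j
    have f2 : ∀ l j, ∑ k, (t k * (∑ i, t i * d i (d l (h k j)))
        - ((m + 1 : ℕ) - 1) * (t k * d l (h k j))) ∈ V := fun l j =>
      sum_mem fun k _ => C.t_euler_d (hv k j) l k
    have f3 : ∑ k, (t k * (∑ i, t i * d i (d k (h l j)))
        - ((m + 1 : ℕ) - 1) * (t k * d k (h l j))) ∈ V :=
      sum_mem fun k _ => C.t_euler_d (hv l j) k k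
    have f4 := C.euler (hv l j)
    have f5 := f2 l j
    have f6 := f2 j l
    have e6 : ∑ k, t k * ∑ i, t i * d i (d j (h k l)) = ∑ k, t k * ∑ i, t i * d j (d k (h l i)) := by
      simp only [Finset.mul_sum]
      rw [Finset.sum_comm]
      refine Finset.sum_congr rfl fun k _ => Finset.sum_congr rfl fun i _ => ?_
      rw [hs i l, C.comm j]
      ring
    simp only [flat, mul_add, mul_sub, Finset.sum_add_distrib, Finset.sum_sub_distrib,
      ← Finset.mul_sum, e6] at f1 f3 f5 f6
    have e7 : ∑ k, t k * ∑ i, t i * d j (d l (h k i)) = Q l j := by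
      simp only [hQ, C.comm j]
    have e8 : Q j l = Q l j := e7
    rw [e7] at f1
    rw [hd, hd, e8]
    rw [hq] at f1 f3 f4 f5 f6 ⊢
    simp only [map_add, map_sub, map_mul, map_natCast, map_ofNat, map_one, Nat.cast_add,
      Nat.cast_one] at f1 f3 f4 f5 f6 ⊢
    rw [hs j l]
    linear_combination 2 * f1 - 2 * f5 - 2 * f6 + 2 * f3 + 2 * m * f4
  refine ⟨fun i => ((2 * (m + 1) * (m + 2) : ℝ)⁻¹) • ζ i, fun i => smul_mem_van (hζv i) _,
    fun i j => ?_⟩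
  have := smul_mem_van (hmain i j) (-(2 * (m + 1) * (m + 2) : ℝ)⁻¹)
  convert this using 1
  have e : (2 * (m + 1) * (m + 2) : A) = algebraMap ℝ A (2 * (m + 1) * (m + 2)) := by
    simp only [map_mul, map_add, map_natCast, map_ofNat, map_one]
  rw [e, ← Algebra.smul_def, Derivation.map_smul, Derivation.map_smul, smul_sub, smul_smul,
    neg_mul, inv_mul_cancel₀ (by positivity)]
  module

end Coord
end Filtration

/-! ### Algebraic curvature tensors; solving the flat Riemann equation and lifting the Bianchi
symbol. -/

/-- The algebraic symmetries of a curvature tensor with all indices lowered. -/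
structure IsCurv {n : ℕ} {M : Type*} [AddCommGroup M] (R : Fin n → Fin n → Fin n → Fin n → M) :
    Prop where
  anti : ∀ k l i j, R k l i j + R l k i j = 0
  anti' : ∀ k l i j, R k l i j + R k l j i = 0
  cyc : ∀ k l i j, R k l i j + R k i j l + R k j l i = 0

theorem IsCurv.pair {n : ℕ} {A : Type*} [CommRing A] [Algebra ℝ A]
    {R : Fin n → Fin n → Fin n → Fin n → A} (h : IsCurv R) (k l i j : Fin n) :
    R k l i j - R i j k l = 0 := by
  obtain ⟨R1, R2, R3⟩ := h
  refine eq_of_two_mul ?_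
  linear_combination R1 i k l j + R1 i l j k - R1 j i k l - R1 j k l i - R1 j l i k + R1 l k i j
    - R2 k i j l + R2 l j k i - R3 i k l j + R3 j k l i + R3 k l i j - R3 l k i j

section Filtration
variable {n : ℕ} {A : Type*} [CommRing A] [Algebra ℝ A] {d : Fin n → Derivation ℝ A A}
  {ev : A →ₐ[ℝ] ℝ} {t : Fin n → A}

/-- The quadratic contraction `h_ij = t^a t^b R_aibj` satisfies `flat h = -(m+2)(m+3) R` to leading
order, by the Bianchi identity and Euler's relation. After rescaling, `m = 0` gives the coefficient
`-1/3` of the metric in normal coordinates. -/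
theorem Coord.riemann_step (C : Coord d ev t) {m : ℕ} {R : Fin n → Fin n → Fin n → Fin n → A}
    (hR : IsCurv R) (hv : ∀ k l i j, R k l i j ∈ van d ev m)
    (hb : ∀ k l p i j, d p (R k l i j) + d i (R k l j p) + d j (R k l p i) ∈ van d ev m) :
    ∃ h : Fin n → Fin n → A, (∀ i j, h i j = h j i) ∧ (∀ i j, h i j ∈ van d ev (m + 2)) ∧
      ∀ k l i j, 2 * R k l i j - flat d h k l i j ∈ van d ev (m + 1) := by
  set h : Fin n → Fin n → A := fun i j => ∑ a, t a * ∑ b, t b * R a i b j with hh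
  have R4 := hR.pair
  have hpair : ∀ k l i j, R k l i j = R i j k l := fun k l i j => sub_eq_zero.1 (R4 k l i j)
  have hs : ∀ i j, h i j = h j i := by
    intro i j
    simp only [hh, Finset.mul_sum]
    rw [Finset.sum_comm]
    refine Finset.sum_congr rfl fun a _ => Finset.sum_congr rfl fun b _ => ?_
    rw [hpair b i a j]
    ring
  have hhv : ∀ i j, h i j ∈ van d ev (m + 2) := fun i j =>
    C.sum_t_mul fun a => C.sum_t_mul fun b => hv _ _ _ _
  set V := van d ev (m + 1) with hV
  -- Second derivatives of `h` are sorted by how many of them fall on the two coordinates: two give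
  -- `R`, one gives `W`, none gives `Z`.
  set W : Fin n → Fin n → Fin n → Fin n → A := fun q p i j => ∑ b, t b * d q (R p i b j) with hW
  set Z : Fin n → Fin n → Fin n → Fin n → A :=
    fun q p i j => ∑ a, t a * ∑ b, t b * d q (d p (R a i b j)) with hZ
  have hdd : ∀ q p i j, d q (d p (h i j)) = R p i q j + R q i p j
      + (W q p i j + W p q i j + W q p j i + W p q j i) + Z q p i j := by
    intro q p i j
    have e : ∀ q p, ∑ a, t a * d q (R a i p j) = W q p j i := by
      intro q p
      simp only [hW, hpair _ i p j]
    simp only [hh, C.d_sum, map_add, mul_add, Finset.sum_add_distrib, e]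
    simp only [hW, hZ]
    ring
  have W1 : ∀ q p i j, W q p i j + W q i p j = 0 := by
    intro q p i j
    simp only [hW, ← Finset.sum_add_distrib, ← mul_add, ← map_add, hR.anti, map_zero, mul_zero,
      Finset.sum_const_zero]
  have W2 : ∀ q p i j, W q p i j - W q p j i - W q j i p = 0 := by
    intro q p i j
    have : ∀ b, R p i b j - R p j b i - R j i b p = 0 := fun b => by
      linear_combination hR.cyc p i b j - hR.anti' p j i b - hR.pair p b j i - hR.anti' j i p b
    simp only [hW, ← Finset.sum_sub_distrib, ← mul_sub, ← map_sub, this, map_zero, mul_zero,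
      Finset.sum_const_zero]
  -- The Bianchi hypothesis contracted with one coordinate, its radial derivative being evaluated by
  -- Euler's relation. `Z1` is the differentiated version with two coordinates.
  have W3 : ∀ q p i j, W q p i j + m * R p i j q - W j p i q ∈ V := by
    intro q p i j
    have f1 : ∑ b, t b * (d q (R p i b j) + d b (R p i j q) + d j (R p i q b)) ∈ V :=
      C.sum_t_mul fun b => hb p i q b j
    have f2 := C.euler (hv p i j q)
    have f3 : ∑ b, t b * d j (R p i q b) = - W j p i q := by
      have : ∀ b, R p i q b = - R p i b q := fun b => by linear_combination hR.anti' p i q b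
      simp only [hW, this, map_neg, mul_neg, Finset.sum_neg_distrib]
    have := sub_mem f1 f2
    simp only [mul_add, Finset.sum_add_distrib, f3] at this
    convert this using 1
    ring
  have Z1 : ∀ i l k j, Z i l k j - Z i k l j + (m - 1) * W i k l j ∈ V := by
    intro i l k j
    have f1 : ∑ a, ∑ b, t a * (t b * d i (d l (R b j a k) + d a (R b j k l) + d k (R b j l a)))
        ∈ V := sum_mem fun a _ => sum_mem fun b _ => C.t_t_d (hb b j l a k) _ _ _
    have f2 : ∑ b, (t b * (∑ a, t a * d a (d i (R b j k l)))
        - (m - 1) * (t b * d i (R b j k l))) ∈ V := sum_mem fun b _ => C.t_euler_d (hv b j k l) i b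
    have e1 : ∑ a, ∑ b, t a * (t b * d i (d a (R b j k l)))
        = ∑ b, t b * (∑ a, t a * d a (d i (R b j k l))) := by
      rw [Finset.sum_comm]
      simp only [Finset.mul_sum]
      refine Finset.sum_congr rfl fun a _ => Finset.sum_congr rfl fun b _ => ?_
      rw [C.comm i]
      ring
    have e2 : ∑ b, t b * d i (R b j k l) = W i k l j := by
      simp only [hW, hpair _ j k l]
    have e3 : ∑ a, ∑ b, t a * (t b * d i (d l (R b j a k))) = Z i l k j := by
      simp only [hZ, Finset.mul_sum, hpair _ k _ j]
    have e4 : ∑ a, ∑ b, t a * (t b * d i (d k (R b j l a))) = - Z i k l j := by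
      have : ∀ a b, R b j l a = - R a l b j := fun a b => by
        linear_combination hR.pair b j l a + hR.anti l a b j
      simp only [hZ, Finset.mul_sum, this, map_neg, mul_neg, Finset.sum_neg_distrib]
    simp only [map_add, mul_add, Finset.sum_add_distrib, e1, e3, e4] at f1
    simp only [Finset.sum_sub_distrib, ← Finset.mul_sum _ _ (_ - _), e2] at f2
    have := sub_mem f1 f2
    convert this using 1
    ring
  have hmain : ∀ k l i j, flat d h k l i j + ((m + 2) * (m + 3)) * R k l i j ∈ V := by
    intro k l i j
    obtain ⟨R1, R2, R3⟩ := hR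
    have g1 := W3 j k l i
    have g2 := W3 l i j k
    have g3 := Z1 i l k j
    have g4 := Z1 j l k i
    have g5 := W3 i k l j
    have := add_mem (add_mem (Ideal.mul_mem_left _ 3 g1) (Ideal.mul_mem_left _ 3 g2))
      (sub_mem (sub_mem g3 g4) (Ideal.mul_mem_left _ (m - 1 : A) g5))
    convert this using 1
    simp only [flat, hdd]
    linear_combination R1 j l k i + R1 k l j i - R1 l i k j + 5 * R1 l k i j - 3 * R2 l k j i
      + R3 l j i k - R3 l j k i + R4 l i j k - R4 l j i k
      + 2 * W1 i l k j - 2 * W1 j k l i - 2 * W1 l j i k + W2 i l j k - W2 j l i k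
      - 2 * W2 k i l j - W2 k j l i - W2 l j k i - 3 * m * R4 i j k l + m * (m - 1) * R2 k l i j
  have hc : (((m + 2) * (m + 3) : ℕ) : ℝ) ≠ 0 := by positivity
  refine ⟨fun i j => (-2 * (((m + 2) * (m + 3) : ℕ) : ℝ)⁻¹) • h i j, fun i j => by simp only [hs i j],
    fun i j => smul_mem_van (hhv i j) _, fun k l i j => ?_⟩
  have := smul_mem_van (hmain k l i j) (2 * (((m + 2) * (m + 3) : ℕ) : ℝ)⁻¹)
  convert this using 1
  have e : ((m + 2) * (m + 3) : A) = algebraMap ℝ A (((m + 2) * (m + 3) : ℕ) : ℝ) := by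
    rw [map_natCast]
    push_cast
    ring
  rw [e, ← Algebra.smul_def, smul_add, smul_smul, mul_assoc, inv_mul_cancel₀ hc]
  simp only [flat, Derivation.map_smul, mul_one, two_mul, two_smul]
  module

/-- A section of `T* ⊗ F_1 → F_2`. -/
def bianchiLift (b : Fin n → Fin n → Fin n → Fin n → Fin n → ℝ) (p k l i j : Fin n) : ℝ :=
  b k l p i j + b i j p k l
    - 1 / 3 * (b k l p i j + b i j p k l + b k i p j l + b j l p k i + b k j p l i + b l i p k j)

/-- `bianchiLift` symmetrises `b` under exchange of the two index pairs and subtracts a third of the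
cyclic sum over `l, i, j`. The cyclic identity is thereby built in; the antisymmetries come from
those of `b` and its relation `B4`. -/
theorem isCurv_bianchiLift {b : Fin n → Fin n → Fin n → Fin n → Fin n → ℝ}
    (B1 : ∀ k l p i j, b k l p i j + b l k p i j = 0)
    (B2 : ∀ k l p i j, b k l p i j + b k l i p j = 0)
    (B3 : ∀ k l p i j, b k l p i j + b k l p j i = 0)
    (B4 : ∀ k l p i j, b k l p i j - b k p l i j + b k i l p j - b k j l p i = 0) (p : Fin n) :
    IsCurv (bianchiLift b p) where
  anti k l i j := by
    simp only [bianchiLift]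
    linear_combination
      - 1/3 * B1 j l p k i - 1/3 * B1 k j p l i + 2/3 * B1 l k p i j + 2/3 * B3 i j p l k -
      1/3 * B3 k i p j l - 1/3 * B3 l p i j k - 1/3 * B4 l i p j k - 1/3 * B4 l i p k j
  anti' k l i j := by
    simp only [bianchiLift]
    linear_combination
      2/3 * B1 i j p k l + 1/3 * B1 l i k p j - 1/3 * B1 l j p k i - 1/3 * B2 i l p k j - 1/3
      * B2 l i k p j - 1/3 * B3 k i p j l - 1/3 * B3 k j p l i + 2/3 * B3 k l p i j
  cyc k l i j := by
    simp only [bianchiLift]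
    ring

/-- A quarter of `bianchiLift` is thus a right inverse of the Bianchi symbol. -/
theorem bianchiLift_cyc {b : Fin n → Fin n → Fin n → Fin n → Fin n → ℝ}
    (B1 : ∀ k l p i j, b k l p i j + b l k p i j = 0)
    (B2 : ∀ k l p i j, b k l p i j + b k l i p j = 0)
    (B3 : ∀ k l p i j, b k l p i j + b k l p j i = 0)
    (B4 : ∀ k l p i j, b k l p i j - b k p l i j + b k i l p j - b k j l p i = 0)
    (k l p i j : Fin n) :
    bianchiLift b p k l i j + bianchiLift b i k l j p + bianchiLift b j k l p i
      = 4 * b k l p i j := by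
  simp only [bianchiLift]
  linear_combination
    1/3 * B1 i k p j l + 1/3 * B1 i l j p k + 1/3 * B1 i l k j p + 1/3 * B1 j i p k l - 1/3
    * B1 j k p i l - 2/3 * B1 j l p k i + 1/3 * B1 j p l i k - B1 k l p i j + 1/3 * B1 p i j
    k l + 1/3 * B1 p k j i l - 1/3 * B1 p l j i k + 1/3 * B1 p l k i j - 1/3 * B2 i k p j l
    - 1/3 * B2 i l k j p - 1/3 * B2 j p l i k + 1/3 * B2 k i j l p - 1/3 * B2 k i l p j -
    1/3 * B2 k j i p l - 1/3 * B2 l i j p k + 1/3 * B2 l k p i j - 1/3 * B2 p j i l k - 1/3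
    * B2 p l i k j + 1/3 * B3 j l p i k + 1/3 * B3 j p i l k - 2/3 * B3 k i p j l - 4/3 * B3
    k j l i p - 1/3 * B3 k j p l i + 5/3 * B3 k l i j p + 2/3 * B3 k l j i p - 4/3 * B3 k l
    p i j - 1/3 * B3 l i k j p - 1/3 * B3 l i p k j + 2/3 * B3 l k p j i + 1/3 * B3 p j i k
    l + 1/3 * B4 i j p k l + 1/3 * B4 j p i k l + B4 k i l j p + 5/3 * B4 k i l p j + 2/3 *
    B4 k j i l p - 4/3 * B4 k l j i p + 4/3 * B4 k l p j i - B4 k p i l j - 1/3 * B4 l j i k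
    p - 1/3 * B4 l j k i p - 1/3 * B4 l k i p j - 2/3 * B4 l p j k i - 1/3 * B4 p j i k l

end Filtration

/-! ### Reduction to principal parts, and exactness by successive approximation. -/

namespace ConstCurv
variable {n : ℕ} {A : Type*} [CommRing A] [Algebra ℝ A] (S : ConstCurv n A)
  {ev : A →ₐ[ℝ] ℝ} {t : Fin n → A}

theorem kil_add (ξ η : Fin n → A) (i j : Fin n) :
    S.kil (fun k => ξ k + η k) i j = S.kil ξ i j + S.kil η i j := by
  simp only [kil, nab1_apply, map_add, mul_add, Finset.sum_add_distrib]
  abel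

theorem kil_smul (r : ℝ) (ξ : Fin n → A) (i j : Fin n) :
    S.kil (fun k => r • ξ k) i j = r • S.kil ξ i j := by
  simp only [kil, nab1_apply, Derivation.map_smul, mul_smul_comm, ← Finset.smul_sum, smul_add,
    smul_sub]

theorem hess2_add (Ω Θ : Fin n → Fin n → A) (i l k j : Fin n) :
    S.hess2 (fun k l => Ω k l + Θ k l) i l k j = S.hess2 Ω i l k j + S.hess2 Θ i l k j := by
  have : (fun r => S.nab2 r (fun k l => Ω k l + Θ k l))
      = (fun r => S.nab2 r Ω) + fun r => S.nab2 r Θ :=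
    funext fun r => S.isConn2.add r Ω Θ
  rw [hess2, this, S.isConn3.add]
  rfl

theorem hess2_smul (r : ℝ) (Ω : Fin n → Fin n → A) (i l k j : Fin n) :
    S.hess2 (fun k l => r • Ω k l) i l k j = r • S.hess2 Ω i l k j := by
  simp only [hess2, nab3_apply, nab2_apply, Derivation.map_smul, mul_smul_comm,
    ← Finset.smul_sum, ← smul_sub]

theorem riem2_add (Ω Θ : Fin n → Fin n → A) (k l i j : Fin n) :
    S.riem2 (fun k l => Ω k l + Θ k l) k l i j = S.riem2 Ω k l i j + S.riem2 Θ k l i j := by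
  simp only [riem2, hess2_add]
  ring

theorem riem2_smul (r : ℝ) (Ω : Fin n → Fin n → A) (k l i j : Fin n) :
    S.riem2 (fun k l => r • Ω k l) k l i j = r • S.riem2 Ω k l i j := by
  simp only [riem2, hess2_smul]
  simp only [Algebra.smul_def]
  ring

theorem bia_add (R Q : Fin n → Fin n → Fin n → Fin n → A) (k l p i j : Fin n) :
    S.bia (fun k l i j => R k l i j + Q k l i j) k l p i j
      = S.bia R k l p i j + S.bia Q k l p i j := by
  simp only [bia, nab4_apply, map_add, mul_add, Finset.sum_add_distrib]
  abel

theorem bia_smul (r : ℝ) (R : Fin n → Fin n → Fin n → Fin n → A) (k l p i j : Fin n) :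
    S.bia (fun k l i j => r • R k l i j) k l p i j = r • S.bia R k l p i j := by
  simp only [bia, nab4_apply, Derivation.map_smul, mul_smul_comm, ← Finset.smul_sum, ← smul_sub,
    ← smul_add]

theorem kil_symm (ξ : Fin n → A) (i j : Fin n) : S.kil ξ i j = S.kil ξ j i := add_comm _ _

theorem riem2_isCurv {Ω : Fin n → Fin n → A} (h : ∀ i j, Ω i j = Ω j i) :
    IsCurv (S.riem2 Ω) where
  anti k l i j := by
    simp only [riem2]
    ring
  anti' k l i j := by
    simp only [riem2]
    rw [S.g_symm l i, S.g_symm l j, h k j, h k i]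
    ring
  cyc := S.riem2_cyc h

/-! Principal parts -/

theorem sum_mem_van {m : ℕ} (u X : Fin n → A) (h : ∀ s, X s ∈ van S.d ev m) :
    ∑ s, u s * X s ∈ van S.d ev m :=
  sum_mem fun s _ => Ideal.mul_mem_left _ _ (h s)

theorem kil_principal {m : ℕ} {ξ : Fin n → A} (h : ∀ k, ξ k ∈ van S.d ev m) (i j : Fin n) :
    S.kil ξ i j - (S.d i (ξ j) + S.d j (ξ i)) ∈ van S.d ev m := by
  have := neg_mem (add_mem (S.sum_mem_van (fun s => S.γ s i j) ξ h)
    (S.sum_mem_van (fun s => S.γ s j i) ξ h))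
  convert this using 1
  simp only [kil, nab1_apply]
  ring

theorem nab2_principal {m : ℕ} {T : Fin n → Fin n → A} (h : ∀ k l, T k l ∈ van S.d ev m)
    (p k l : Fin n) : S.nab2 p T k l - S.d p (T k l) ∈ van S.d ev m := by
  have := neg_mem (add_mem (S.sum_mem_van (fun s => S.γ s p k) (fun s => T s l) fun s => h _ _)
    (S.sum_mem_van (fun s => S.γ s p l) (fun s => T k s) fun s => h _ _))
  convert this using 1
  simp only [nab2_apply]
  ring

theorem nab3_principal {m : ℕ} {T : Fin n → Fin n → Fin n → A}
    (h : ∀ k l i, T k l i ∈ van S.d ev m) (p k l i : Fin n) :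
    S.nab3 p T k l i - S.d p (T k l i) ∈ van S.d ev m := by
  have := neg_mem (add_mem (add_mem
    (S.sum_mem_van (fun s => S.γ s p k) (fun s => T s l i) fun s => h _ _ _)
    (S.sum_mem_van (fun s => S.γ s p l) (fun s => T k s i) fun s => h _ _ _))
    (S.sum_mem_van (fun s => S.γ s p i) (fun s => T k l s) fun s => h _ _ _))
  convert this using 1
  simp only [nab3_apply]
  ring

theorem nab4_principal {m : ℕ} {T : Fin n → Fin n → Fin n → Fin n → A}
    (h : ∀ k l i j, T k l i j ∈ van S.d ev m) (p k l i j : Fin n) :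
    S.nab4 p T k l i j - S.d p (T k l i j) ∈ van S.d ev m := by
  have := neg_mem (add_mem (add_mem (add_mem
    (S.sum_mem_van (fun s => S.γ s p k) (fun s => T s l i j) fun s => h _ _ _ _)
    (S.sum_mem_van (fun s => S.γ s p l) (fun s => T k s i j) fun s => h _ _ _ _))
    (S.sum_mem_van (fun s => S.γ s p i) (fun s => T k l s j) fun s => h _ _ _ _))
    (S.sum_mem_van (fun s => S.γ s p j) (fun s => T k l i s) fun s => h _ _ _ _))
  convert this using 1
  simp only [nab4_apply]
  ring

theorem hess2_principal {m : ℕ} {Ω : Fin n → Fin n → A}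
    (h : ∀ i j, Ω i j ∈ van S.d ev (m + 1)) (i l k j : Fin n) :
    S.hess2 Ω i l k j - S.d i (S.d l (Ω k j)) ∈ van S.d ev m := by
  have h1 : ∀ l k j, S.nab2 l Ω k j ∈ van S.d ev m := fun l k j =>
    (Submodule.sub_mem_iff_left _ (d_mem_van (h k j) l)).1 (van_succ_le _ (S.nab2_principal h l k j))
  have h2 := S.nab3_principal h1 i l k j
  have h3 := d_mem_van (S.nab2_principal h l k j) i
  have := add_mem h2 h3
  convert this using 1
  rw [map_sub, hess2]
  ring

theorem riem2_principal {m : ℕ} {Ω : Fin n → Fin n → A}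
    (h : ∀ i j, Ω i j ∈ van S.d ev (m + 1)) (k l i j : Fin n) :
    S.riem2 Ω k l i j - flat S.d Ω k l i j ∈ van S.d ev m := by
  have h0 : ∀ i j, Ω i j ∈ van S.d ev m := fun i j => van_succ_le _ (h i j)
  have h1 := sub_mem (add_mem (sub_mem (sub_mem (S.hess2_principal h i l k j)
    (S.hess2_principal h i k l j)) (S.hess2_principal h j l k i)) (S.hess2_principal h j k l i))
    (Ideal.mul_mem_left _ S.c (add_mem (sub_mem (sub_mem
      (Ideal.mul_mem_left _ (S.g k i) (h0 l j)) (Ideal.mul_mem_left _ (S.g k j) (h0 l i)))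
      (Ideal.mul_mem_right (S.g l i) _ (h0 k j))) (Ideal.mul_mem_right (S.g l j) _ (h0 k i))))
  convert h1 using 1
  simp only [riem2, flat]
  ring

theorem bia_principal {m : ℕ} {R : Fin n → Fin n → Fin n → Fin n → A}
    (h : ∀ k l i j, R k l i j ∈ van S.d ev m) (k l p i j : Fin n) :
    S.bia R k l p i j - (S.d p (R k l i j) + S.d i (R k l j p) + S.d j (R k l p i))
      ∈ van S.d ev m := by
  have := add_mem (add_mem (S.nab4_principal h p k l i j) (S.nab4_principal h i k l j p))
    (S.nab4_principal h j k l p i)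
  convert this using 1
  simp only [bia]
  ring

/-- An operator of order one sends elements vanishing to order `m + 1` to elements vanishing to
order `m`. -/
theorem kil_mem_van {m : ℕ} {ξ : Fin n → A} (h : ∀ k, ξ k ∈ van S.d ev (m + 1)) (i j : Fin n) :
    S.kil ξ i j ∈ van S.d ev m :=
  (Submodule.sub_mem_iff_left _ (add_mem (d_mem_van (h j) i) (d_mem_van (h i) j))).1
    (van_succ_le _ (S.kil_principal h i j))

theorem riem2_mem_van {m : ℕ} {Ω : Fin n → Fin n → A} (h : ∀ i j, Ω i j ∈ van S.d ev (m + 2))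
    (k l i j : Fin n) : S.riem2 Ω k l i j ∈ van S.d ev m := by
  have hd : ∀ i l k j, S.d i (S.d l (Ω k j)) ∈ van S.d ev m := fun i l k j =>
    d_mem_van (d_mem_van (h k j) l) i
  exact (Submodule.sub_mem_iff_left _
    (add_mem (sub_mem (sub_mem (hd _ _ _ _) (hd _ _ _ _)) (hd _ _ _ _)) (hd _ _ _ _))).1
    (van_succ_le _ (S.riem2_principal h k l i j))

theorem bia_mem_van {m : ℕ} {R : Fin n → Fin n → Fin n → Fin n → A}
    (h : ∀ k l i j, R k l i j ∈ van S.d ev (m + 1)) (k l p i j : Fin n) :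
    S.bia R k l p i j ∈ van S.d ev m :=
  (Submodule.sub_mem_iff_left _ (add_mem (add_mem (d_mem_van (h _ _ _ _) p)
    (d_mem_van (h _ _ _ _) i)) (d_mem_van (h _ _ _ _) j))).1
    (van_succ_le _ (S.bia_principal h k l p i j))

/-- Formal exactness at `F_0`, by successive approximation. -/
theorem killing_exact (C : Coord S.d ev t) {r : ℕ} {Ω : Fin n → Fin n → A}
    (hs : ∀ i j, Ω i j = Ω j i) (hr : ∀ k l i j, S.riem2 Ω k l i j ∈ van S.d ev r) :
    ∀ m ≤ r + 2, ∃ ξ : Fin n → A, ∀ i j, Ω i j - S.kil ξ i j ∈ van S.d ev m := by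
  intro m
  induction m with
  | zero => exact fun _ => ⟨0, fun i j => mem_van_zero _⟩
  | succ m ih =>
    intro hm
    obtain ⟨ξ, hξ⟩ := ih (by omega)
    set h : Fin n → Fin n → A := fun i j => Ω i j - S.kil ξ i j with hh
    have hhs : ∀ i j, h i j = h j i := fun i j => by
      simp only [hh, hs i j, S.kil_symm ξ i j]
    have step : ∃ ζ : Fin n → A, (∀ i, ζ i ∈ van S.d ev (m + 1)) ∧
        ∀ i j, h i j - (S.d i (ζ j) + S.d j (ζ i)) ∈ van S.d ev (m + 1) := by
      cases m with
      | zero => exact C.killing_zero hhs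
      | succ m =>
        refine C.killing_succ hhs hξ fun k l i j => ?_
        -- The remainder has the same Riemann image as `Ω` because `riem2_kil` holds exactly, not
        -- only to leading order.
        have e : S.riem2 h k l i j = S.riem2 Ω k l i j := by
          have e1 : Ω = fun i j => h i j + S.kil ξ i j := by
            funext i j
            simp only [hh]
            abel
          conv_rhs => rw [e1, riem2_add]
          have e2 : S.riem2 (fun k l => S.kil ξ k l) k l i j = 0 := S.riem2_kil ξ k l i j
          rw [e2, add_zero]
        have h1 := van_anti (show m ≤ r by omega) (hr k l i j)
        rw [← e] at h1
        have := sub_mem h1 (S.riem2_principal hξ k l i j)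
        rwa [sub_sub_cancel] at this
    obtain ⟨ζ, hζ, hζ'⟩ := step
    refine ⟨fun k => ξ k + ζ k, fun i j => ?_⟩
    have := sub_mem (hζ' i j) (S.kil_principal hζ i j)
    convert this using 1
    rw [kil_add]
    simp only [hh]
    ring

/-- Formal exactness at `F_1`, by successive approximation. -/
theorem riemann_exact (C : Coord S.d ev t) {r : ℕ} {R : Fin n → Fin n → Fin n → Fin n → A}
    (hR : IsCurv R) (hr : ∀ k l p i j, S.bia R k l p i j ∈ van S.d ev r) :
    ∀ m ≤ r + 1, ∃ Ω : Fin n → Fin n → A, (∀ i j, Ω i j = Ω j i) ∧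
      ∀ k l i j, 2 * R k l i j - S.riem2 Ω k l i j ∈ van S.d ev m := by
  intro m
  induction m with
  | zero => exact fun _ => ⟨0, fun i j => rfl, fun k l i j => mem_van_zero _⟩
  | succ m ih =>
    intro hm
    obtain ⟨Ω, hs, hΩ⟩ := ih (by omega)
    -- The remainder, written as a sum with a real multiple so that `bia_add` and `bia_smul` apply;
    -- the half offsets the factor two in `riem2`.
    set Q : Fin n → Fin n → Fin n → Fin n → A :=
      fun k l i j => R k l i j + (-(1 / 2) : ℝ) • S.riem2 Ω k l i j with hQ
    have hQe : ∀ k l i j, Q k l i j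
        = (1 / 2 : ℝ) • (2 * R k l i j - S.riem2 Ω k l i j) := fun k l i j => by
      simp only [hQ, two_mul]
      module
    have hQv : ∀ k l i j, Q k l i j ∈ van S.d ev m := fun k l i j => by
      rw [hQe]
      exact smul_mem_van (hΩ k l i j) _
    have hQ2 : ∀ k l i j, 2 * Q k l i j = 2 * R k l i j - S.riem2 Ω k l i j := fun k l i j => by
      simp only [hQ, two_mul]
      module
    have hC := S.riem2_isCurv hs
    have hQc : IsCurv Q := by
      constructor
      · intro k l i j
        rw [hQe, hQe, ← smul_add, show 2 * R k l i j - S.riem2 Ω k l i j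
          + (2 * R l k i j - S.riem2 Ω l k i j) = 0 by
          linear_combination 2 * hR.anti k l i j - hC.anti k l i j, smul_zero]
      · intro k l i j
        rw [hQe, hQe, ← smul_add, show 2 * R k l i j - S.riem2 Ω k l i j
          + (2 * R k l j i - S.riem2 Ω k l j i) = 0 by
          linear_combination 2 * hR.anti' k l i j - hC.anti' k l i j, smul_zero]
      · intro k l i j
        rw [hQe, hQe, hQe, ← smul_add, ← smul_add, show 2 * R k l i j - S.riem2 Ω k l i j
          + (2 * R k i j l - S.riem2 Ω k i j l) + (2 * R k j l i - S.riem2 Ω k j l i) = 0 by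
          linear_combination 2 * hR.cyc k l i j - hC.cyc k l i j, smul_zero]
    have hQb : ∀ k l p i j, S.bia Q k l p i j = S.bia R k l p i j := fun k l p i j => by
      rw [hQ, S.bia_add, S.bia_smul]
      have : S.bia (fun k l i j => S.riem2 Ω k l i j) k l p i j = 0 := S.bia_riem2 hs k l p i j
      rw [this, smul_zero, add_zero]
    obtain ⟨h, hhs, hhv, hh⟩ := C.riemann_step hQc hQv fun k l p i j => by
      have h1 := van_anti (show m ≤ r by omega) (hr k l p i j)
      rw [← hQb] at h1
      have := sub_mem h1 (S.bia_principal hQv k l p i j)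
      rwa [sub_sub_cancel] at this
    refine ⟨fun i j => Ω i j + h i j, fun i j => by simp only [hs i j, hhs i j],
      fun k l i j => ?_⟩
    have := sub_mem (hh k l i j) (S.riem2_principal (m := m + 1) hhv k l i j)
    convert this using 1
    rw [riem2_add, hQ2]
    ring

end ConstCurv

/-! ### The algebra of smooth functions on an open set. -/

section SmoothAlgebra
variable {n : ℕ} {U : Set (Fin n → ℝ)}

/-- The algebra of smooth functions on the open set `U`. -/
def smoothAlg (U : Set (Fin n → ℝ)) : Subalgebra ℝ (U → ℝ) where
  carrier := {f | ∃ F : (Fin n → ℝ) → ℝ, ContDiffOn ℝ ((⊤ : ℕ∞) : WithTop ℕ∞) F U ∧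
    ∀ x : U, F x = f x}
  mul_mem' := by
    rintro f g ⟨F, hF, hf⟩ ⟨G, hG, hg⟩
    exact ⟨fun x => F x * G x, hF.mul hG, fun x => by simp [hf, hg]⟩
  add_mem' := by
    rintro f g ⟨F, hF, hf⟩ ⟨G, hG, hg⟩
    exact ⟨fun x => F x + G x, hF.add hG, fun x => by simp [hf, hg]⟩
  algebraMap_mem' r := ⟨fun _ => r, contDiffOn_const, fun _ => rfl⟩

/-- The function `F` restricts on `U` to the element `a` of the algebra of smooth functions. -/
def Rep (F : (Fin n → ℝ) → ℝ) (a : smoothAlg U) : Prop := ∀ x : U, F x = a.1 x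

/-- The restriction to `U` of a function that is smooth on `U`. -/
def toAlg {F : (Fin n → ℝ) → ℝ} (hF : ContDiffOn ℝ ((⊤ : ℕ∞) : WithTop ℕ∞) F U) : smoothAlg U :=
  ⟨fun x => F x, F, hF, fun _ => rfl⟩

theorem rep_toAlg {F : (Fin n → ℝ) → ℝ} (hF : ContDiffOn ℝ ((⊤ : ℕ∞) : WithTop ℕ∞) F U) :
    Rep F (toAlg hF) := fun _ => rfl

/-- Evaluation at a point. -/
def evalAt (x : U) : smoothAlg U →ₐ[ℝ] ℝ where
  toFun a := a.1 x
  map_one' := rfl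
  map_mul' _ _ := rfl
  map_zero' := rfl
  map_add' _ _ := rfl
  commutes' _ := rfl

theorem alg_ext {a b : smoothAlg U} (h : ∀ x : U, evalAt x a = evalAt x b) : a = b :=
  Subtype.ext (funext h)

namespace Rep
variable {F G : (Fin n → ℝ) → ℝ} {a b : smoothAlg U}

theorem eval (h : Rep F a) {x : Fin n → ℝ} (hx : x ∈ U) : F x = evalAt ⟨x, hx⟩ a := h ⟨x, hx⟩

theorem contDiffOn (h : Rep F a) : ContDiffOn ℝ ((⊤ : ℕ∞) : WithTop ℕ∞) F U := by
  obtain ⟨G, hG, hg⟩ := a.2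
  exact hG.congr fun x hx => (h ⟨x, hx⟩).trans (hg ⟨x, hx⟩).symm

theorem add (hF : Rep F a) (hG : Rep G b) : Rep (fun x => F x + G x) (a + b) := fun x => by
  simp [hF x, hG x]

theorem sub (hF : Rep F a) (hG : Rep G b) : Rep (fun x => F x - G x) (a - b) := fun x => by
  simp [hF x, hG x]

theorem mul (hF : Rep F a) (hG : Rep G b) : Rep (fun x => F x * G x) (a * b) := fun x => by
  simp [hF x, hG x]

theorem const (r : ℝ) : Rep (fun _ => r) (algebraMap ℝ (smoothAlg U) r) := fun _ => rfl

theorem zero : Rep (fun _ => 0) (0 : smoothAlg U) := fun _ => rfl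

theorem smul (r : ℝ) (hF : Rep F a) : Rep (fun x => r * F x) (r • a) := fun x => by
  simp [hF x]

theorem sum {ι : Type*} {s : Finset ι} {F : ι → (Fin n → ℝ) → ℝ} {a : ι → smoothAlg U}
    (h : ∀ i ∈ s, Rep (F i) (a i)) : Rep (fun x => ∑ i ∈ s, F i x) (∑ i ∈ s, a i) := fun x => by
  have : evalAt x (∑ i ∈ s, a i) = ∑ i ∈ s, evalAt x (a i) := map_sum _ _ _
  exact (Finset.sum_congr rfl fun i hi => h i hi x).trans this.symm

theorem ite (p : Prop) [Decidable p] (hF : Rep F a) :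
    Rep (fun x => if p then F x else 0) (if p then a else 0) := by
  split_ifs
  · exact hF
  · exact zero

theorem unique (hF : Rep F a) (hG : Rep F b) : a = b :=
  alg_ext fun x => (hF x).symm.trans (hG x)

end Rep

theorem pd_congr (hU : IsOpen U) {F G : (Fin n → ℝ) → ℝ} (h : ∀ x ∈ U, F x = G x) (i : Fin n)
    {x : Fin n → ℝ} (hx : x ∈ U) : pd i F x = pd i G x := by
  rw [pd, pd, Filter.EventuallyEq.fderiv_eq (Filter.eventually_of_mem (hU.mem_nhds hx) h)]

theorem contDiffOn_pd (hU : IsOpen U) {F : (Fin n → ℝ) → ℝ}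
    (hF : ContDiffOn ℝ ((⊤ : ℕ∞) : WithTop ℕ∞) F U) (i : Fin n) :
    ContDiffOn ℝ ((⊤ : ℕ∞) : WithTop ℕ∞) (pd i F) U :=
  (hF.fderiv_of_isOpen hU (m := ((⊤ : ℕ∞) : WithTop ℕ∞)) (by rfl)).clm_apply contDiffOn_const

theorem smooth_diffAt (hU : IsOpen U) {F : (Fin n → ℝ) → ℝ}
    (hF : ContDiffOn ℝ ((⊤ : ℕ∞) : WithTop ℕ∞) F U) {x : Fin n → ℝ} (hx : x ∈ U) :
    DifferentiableAt ℝ F x :=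
  ((hF x hx).contDiffAt (hU.mem_nhds hx)).differentiableAt (by simp)

theorem pd_comm (hU : IsOpen U) {F : (Fin n → ℝ) → ℝ}
    (hF : ContDiffOn ℝ ((⊤ : ℕ∞) : WithTop ℕ∞) F U) (i j : Fin n) {x : Fin n → ℝ} (hx : x ∈ U) :
    pd i (pd j F) x = pd j (pd i F) x := by
  have h1 : DifferentiableAt ℝ (fderiv ℝ F) x :=
    (((hF.fderiv_of_isOpen hU (m := ((⊤ : ℕ∞) : WithTop ℕ∞)) (by rfl)) x hx).contDiffAt
      (hU.mem_nhds hx)).differentiableAt (by simp)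
  have key : ∀ i j : Fin n, pd i (pd j F) x
      = fderiv ℝ (fderiv ℝ F) x (Pi.single i 1) (Pi.single j 1) := by
    intro i j
    have : pd j F = fun y => (fderiv ℝ F y) (Pi.single j 1) := rfl
    rw [pd, this, fderiv_clm_apply h1 (differentiableAt_const _)]
    simp
  rw [key, key]
  exact (((hF x hx).contDiffAt (hU.mem_nhds hx)).isSymmSndFDerivAt (by
    rw [minSmoothness_of_isRCLikeNormedField]
    exact WithTop.coe_le_coe.2 (le_top (a := (2 : ℕ∞))))).eq _ _

/-- A function that restricts to a given element of the algebra. -/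
def extend (a : smoothAlg U) : (Fin n → ℝ) → ℝ := a.2.choose

theorem rep_extend (a : smoothAlg U) : Rep (extend a) a := a.2.choose_spec.2

theorem smooth_extend (a : smoothAlg U) :
    ContDiffOn ℝ ((⊤ : ℕ∞) : WithTop ℕ∞) (extend a) U := a.2.choose_spec.1

/-- The partial derivatives, as derivations of the algebra of smooth functions. -/
def dAlg (hU : IsOpen U) (i : Fin n) : Derivation ℝ (smoothAlg U) (smoothAlg U) :=
  Derivation.mk'
    -- The chosen representative is immaterial: `U` is open, so by `pd_congr` its derivatives on `U`
    -- depend only on its values there.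
    { toFun := fun a => toAlg (contDiffOn_pd hU (smooth_extend a) i)
      map_add' := fun a b => by
        refine alg_ext fun x => ?_
        have h : pd i (extend (a + b)) x = pd i (fun y => extend a y + extend b y) x :=
          pd_congr hU (fun y hy => (rep_extend (a + b) ⟨y, hy⟩).trans
            (((rep_extend a).add (rep_extend b)) ⟨y, hy⟩).symm) i x.2
        refine h.trans ?_
        rw [pd, fderiv_fun_add (smooth_diffAt hU (smooth_extend a) x.2)
          (smooth_diffAt hU (smooth_extend b) x.2)]
        rfl
      map_smul' := fun r a => by
        refine alg_ext fun x => ?_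
        have h : pd i (extend (r • a)) x = pd i (fun y => r * extend a y) x :=
          pd_congr hU (fun y hy => (rep_extend (r • a) ⟨y, hy⟩).trans
            (((rep_extend a).smul r) ⟨y, hy⟩).symm) i x.2
        refine h.trans ?_
        rw [pd, fderiv_const_mul (smooth_diffAt hU (smooth_extend a) x.2)]
        rfl }
    fun a b => by
      refine alg_ext fun x => ?_
      have h : pd i (extend (a * b)) x = pd i (fun y => extend a y * extend b y) x :=
        pd_congr hU (fun y hy => (rep_extend (a * b) ⟨y, hy⟩).trans
          (((rep_extend a).mul (rep_extend b)) ⟨y, hy⟩).symm) i x.2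
      refine h.trans ?_
      rw [pd, fderiv_fun_mul (smooth_diffAt hU (smooth_extend a) x.2)
        (smooth_diffAt hU (smooth_extend b) x.2), rep_extend a x, rep_extend b x]
      rfl

theorem Rep.pd (hU : IsOpen U) {F : (Fin n → ℝ) → ℝ} {a : smoothAlg U} (h : Rep F a)
    (i : Fin n) : Rep (pd i F) (dAlg hU i a) := fun x =>
  pd_congr hU (fun y hy => (h ⟨y, hy⟩).trans (rep_extend a ⟨y, hy⟩).symm) i x.2

theorem dAlg_comm (hU : IsOpen U) (i j : Fin n) (a : smoothAlg U) :
    dAlg hU i (dAlg hU j a) = dAlg hU j (dAlg hU i a) :=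
  alg_ext fun x => (((rep_extend a).pd hU j).pd hU i x).symm.trans
    ((pd_comm hU (smooth_extend a) i j x.2).trans (((rep_extend a).pd hU i).pd hU j x))

/-- The coordinate `x^k - x_0^k`. -/
def coordAlg (x : U) (k : Fin n) : smoothAlg U :=
  toAlg (F := fun y => y k - x.1 k) ((contDiff_apply ℝ ℝ k).contDiffOn.sub contDiffOn_const)

theorem coord_coordAlg (hU : IsOpen U) (x : U) :
    Coord (dAlg hU) (evalAt x) (coordAlg x) where
  d_t i k := by
    have h := (rep_toAlg (F := fun y : Fin n → ℝ => y k - x.1 k) (U := U)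
      ((contDiff_apply ℝ ℝ k).contDiffOn.sub contDiffOn_const)).pd hU i
    refine h.unique fun y => ?_
    have : HasFDerivAt (fun y : Fin n → ℝ => y k - x.1 k)
        (ContinuousLinearMap.proj (R := ℝ) (φ := fun _ : Fin n => ℝ) k) y.1 :=
      (ContinuousLinearMap.proj (R := ℝ) (φ := fun _ : Fin n => ℝ) k).hasFDerivAt.sub_const _
    rw [KillingSeq.pd, this.fderiv]
    simp only [ContinuousLinearMap.proj_apply, Pi.single_apply, eq_comm (a := k)]
    split_ifs <;> rfl
  ev_t k := sub_self _
  comm := dAlg_comm hU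

end SmoothAlgebra

/-! ### Equality of jets in terms of the order of vanishing. -/

section Jets
variable {n : ℕ} {U : Set (Fin n → ℝ)} {ι : Type*} [Fintype ι]
  {V : Type*} [NormedAddCommGroup V] [NormedSpace ℝ V]

theorem iteratedFDeriv_pi_eq_zero {f : (Fin n → ℝ) → ι → V} {x : Fin n → ℝ}
    (hf : ContDiffAt ℝ ((⊤ : ℕ∞) : WithTop ℕ∞) f x) (m : ℕ) :
    iteratedFDeriv ℝ m f x = 0 ↔ ∀ i, iteratedFDeriv ℝ m (fun y => f y i) x = 0 := by
  have key : ∀ i, iteratedFDeriv ℝ m (fun y => f y i) x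
      = (ContinuousLinearMap.proj (R := ℝ) (φ := fun _ : ι => V) i).compContinuousMultilinearMap
        (iteratedFDeriv ℝ m f x) := fun i =>
    (ContinuousLinearMap.proj (R := ℝ) (φ := fun _ : ι => V) i).iteratedFDeriv_comp_left
      hf (by exact_mod_cast le_top)
  constructor
  · intro h i
    rw [key, h]
    ext
    simp
  · intro h
    ext v i
    have := h i
    rw [key] at this
    exact congrArg (fun q => q v) this

theorem iteratedFDeriv_succ_eq_zero (hU : IsOpen U) {F : (Fin n → ℝ) → ℝ}
    (hF : ContDiffOn ℝ ((⊤ : ℕ∞) : WithTop ℕ∞) F U) {x : Fin n → ℝ} (hx : x ∈ U) (m : ℕ) :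
    iteratedFDeriv ℝ (m + 1) F x = 0 ↔ ∀ i, iteratedFDeriv ℝ m (pd i F) x = 0 := by
  have hd : ContDiffAt ℝ ((⊤ : ℕ∞) : WithTop ℕ∞) (fderiv ℝ F) x :=
    ((hF.fderiv_of_isOpen hU (m := ((⊤ : ℕ∞) : WithTop ℕ∞)) (by rfl)) x hx).contDiffAt
      (hU.mem_nhds hx)
  have key : ∀ i, iteratedFDeriv ℝ m (pd i F) x
      = (ContinuousLinearMap.apply ℝ ℝ
        (Pi.single i 1 : Fin n → ℝ)).compContinuousMultilinearMap
        (iteratedFDeriv ℝ m (fderiv ℝ F) x) := fun i =>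
    (ContinuousLinearMap.apply ℝ ℝ (Pi.single i 1 : Fin n → ℝ)).iteratedFDeriv_comp_left
      hd (by exact_mod_cast le_top)
  have h0 : iteratedFDeriv ℝ (m + 1) F x = 0 ↔ iteratedFDeriv ℝ m (fderiv ℝ F) x = 0 := by
    rw [iteratedFDeriv_succ_eq_comp_right, Function.comp_apply]
    exact LinearIsometryEquiv.map_eq_zero_iff _
  rw [h0]
  constructor
  · intro h i
    rw [key, h]
    ext
    simp
  · intro h
    ext v w
    have hw : ∀ i, iteratedFDeriv ℝ m (fderiv ℝ F) x v (Pi.single i 1) = 0 := fun i => by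
      have := h i
      rw [key] at this
      exact congrArg (fun q => q v) this
    rw [← Finset.univ_sum_single w, map_sum]
    refine Finset.sum_eq_zero fun i _ => ?_
    have : (Pi.single i (w i) : Fin n → ℝ) = w i • Pi.single i 1 := by
      rw [← Pi.single_smul, smul_eq_mul, mul_one]
    rw [this, map_smul, hw, smul_zero]

/-- Vanishing of derivatives, in terms of the filtration of the algebra of smooth functions. -/
theorem Rep.mem_van_iff (hU : IsOpen U) {x : Fin n → ℝ} (hx : x ∈ U) (m : ℕ) :
    ∀ {F : (Fin n → ℝ) → ℝ} {a : smoothAlg U}, Rep F a →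
    (a ∈ van (dAlg hU) (evalAt ⟨x, hx⟩) m ↔ ∀ k < m, iteratedFDeriv ℝ k F x = 0) := by
  induction m with
  | zero => exact fun _ => ⟨fun _ k hk => absurd hk (by omega), fun _ => mem_van_zero _⟩
  | succ m ih =>
    intro F a h
    rw [mem_van_succ_iff, ← h.eval hx]
    have h1 : ∀ i, (dAlg hU i a ∈ van (dAlg hU) (evalAt ⟨x, hx⟩) m
        ↔ ∀ k < m, iteratedFDeriv ℝ k (KillingSeq.pd i F) x = 0) := fun i => ih (h.pd hU i)
    simp only [h1]
    constructor
    · rintro ⟨h0, h2⟩ k hk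
      cases k with
      | zero =>
        ext v
        simpa using h0
      | succ k =>
        rw [iteratedFDeriv_succ_eq_zero hU h.contDiffOn hx]
        exact fun i => h2 i k (by omega)
    · intro h2
      refine ⟨?_, fun i k hk =>
        (iteratedFDeriv_succ_eq_zero hU h.contDiffOn hx k).1 (h2 (k + 1) (by omega)) i⟩
      have := congrArg (fun q => q 0) (h2 0 (by omega))
      simpa using this

theorem sameJet_pi {r : ℕ} {x : Fin n → ℝ} {f g : (Fin n → ℝ) → ι → V}
    (hf : ContDiffAt ℝ ((⊤ : ℕ∞) : WithTop ℕ∞) f x)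
    (hg : ContDiffAt ℝ ((⊤ : ℕ∞) : WithTop ℕ∞) g x) :
    SameJet r x f g ↔ ∀ i, SameJet r x (fun y => f y i) (fun y => g y i) := by
  have hle : ∀ m : ℕ, ((m : ℕ∞) : WithTop ℕ∞) ≤ ((⊤ : ℕ∞) : WithTop ℕ∞) := fun m => by
    exact_mod_cast le_top
  have hf' := contDiffAt_pi.1 hf
  have hg' := contDiffAt_pi.1 hg
  have e : ∀ m, iteratedFDeriv ℝ m f x = iteratedFDeriv ℝ m g x
      ↔ ∀ i, iteratedFDeriv ℝ m (fun y => f y i) x = iteratedFDeriv ℝ m (fun y => g y i) x := by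
    intro m
    rw [← sub_eq_zero, ← iteratedFDeriv_sub_apply (hf.of_le (hle m)) (hg.of_le (hle m)),
      iteratedFDeriv_pi_eq_zero (f := f - g) (hf.sub hg)]
    refine forall_congr' fun i => ?_
    rw [← sub_eq_zero (a := iteratedFDeriv ℝ m (fun y => f y i) x),
      ← iteratedFDeriv_sub_apply ((hf' i).of_le (hle m)) ((hg' i).of_le (hle m))]
    rfl
  simp only [SameJet, e]
  exact ⟨fun h i m hm => h m hm i, fun h m hm i => h i m hm⟩

/-- The shift to `r + 1` is due to conventions: a jet of order `r` includes the derivatives of order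
`r`, while `van m` concerns orders strictly below `m`. -/
theorem Rep.sameJet_iff (hU : IsOpen U) {x : Fin n → ℝ} (hx : x ∈ U) (r : ℕ)
    {F G : (Fin n → ℝ) → ℝ} {a b : smoothAlg U} (hF : Rep F a) (hG : Rep G b) :
    SameJet r x F G ↔ a - b ∈ van (dAlg hU) (evalAt ⟨x, hx⟩) (r + 1) := by
  have hle : ∀ m : ℕ, ((m : ℕ∞) : WithTop ℕ∞) ≤ ((⊤ : ℕ∞) : WithTop ℕ∞) := fun m => by
    exact_mod_cast le_top
  have hf := (hF.contDiffOn x hx).contDiffAt (hU.mem_nhds hx)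
  have hg := (hG.contDiffOn x hx).contDiffAt (hU.mem_nhds hx)
  rw [(hF.sub hG).mem_van_iff hU hx]
  have e : ∀ m, iteratedFDeriv ℝ m F x = iteratedFDeriv ℝ m G x
      ↔ iteratedFDeriv ℝ m (fun y => F y - G y) x = 0 := fun m => by
    rw [← sub_eq_zero, ← iteratedFDeriv_sub_apply (hf.of_le (hle m)) (hg.of_le (hle m))]
    rfl
  simp only [SameJet, e, Nat.lt_succ_iff]

end Jets

/-! ### The metric and the operators, read in the algebra of smooth functions. -/

section Geometry
variable {n : ℕ} {U : Set (Fin n → ℝ)} {ω : (Fin n → ℝ) → Fin n → Fin n → ℝ}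

/-- The components of the metric, as elements of the algebra of smooth functions. -/
def gAlg (hω : IsMetric U ω) (i j : Fin n) : smoothAlg U :=
  toAlg (contDiffOn_pi.1 (contDiffOn_pi.1 hω.smooth i) j)

theorem rep_gAlg (hω : IsMetric U ω) (i j : Fin n) : Rep (fun x => ω x i j) (gAlg hω i j) :=
  rep_toAlg _

theorem map_gAlg (hω : IsMetric U ω) (x : U) :
    (evalAt x).mapMatrix (Matrix.of (gAlg hω)) = Matrix.of (ω x) := by
  ext i j
  rfl

/-- The determinant has no zero on `U`, so its reciprocal is smooth there. The inverse metric thus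
exists over the algebra itself. -/
theorem isUnit_det_gAlg (hω : IsMetric U ω) : IsUnit (Matrix.of (gAlg hω)).det := by
  set D := (Matrix.of (gAlg hω)).det with hD
  have h : ∀ x : U, evalAt x D = (Matrix.of (ω x)).det := fun x => by
    rw [hD, AlgHom.map_det, map_gAlg]
  have hne : ∀ x ∈ U, extend D x ≠ 0 := fun x hx => by
    rw [(rep_extend D).eval hx, h ⟨x, hx⟩]
    exact hω.det_ne_zero x hx
  refine IsUnit.of_mul_eq_one (toAlg ((smooth_extend D).inv hne)) (alg_ext fun x => ?_)
  rw [map_mul, map_one, ← (rep_extend D).eval x.2, ← (rep_toAlg ((smooth_extend D).inv hne)).eval x.2]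
  exact mul_inv_cancel₀ (hne x x.2)

/-- The components of the inverse metric. -/
def giAlg (hω : IsMetric U ω) (i j : Fin n) : smoothAlg U := (Matrix.of (gAlg hω))⁻¹ i j

theorem g_giAlg (hω : IsMetric U ω) (i j : Fin n) :
    ∑ r, gAlg hω i r * giAlg hω r j = if i = j then 1 else 0 := by
  have := congrFun (congrFun (Matrix.mul_nonsing_inv _ (isUnit_det_gAlg hω)) i) j
  rwa [Matrix.mul_apply, Matrix.one_apply] at this

theorem gi_gAlg (hω : IsMetric U ω) (i j : Fin n) :
    ∑ r, giAlg hω i r * gAlg hω r j = if i = j then 1 else 0 := by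
  have := congrFun (congrFun (Matrix.nonsing_inv_mul _ (isUnit_det_gAlg hω)) i) j
  rwa [Matrix.mul_apply, Matrix.one_apply] at this

/-- Evaluation at a point is a ring homomorphism, so it takes the inverse matrix over the algebra to
the pointwise inverse. -/
theorem rep_giAlg (hω : IsMetric U ω) (i j : Fin n) :
    Rep (fun x => inv (ω x) i j) (giAlg hω i j) := fun x => by
  have h : (evalAt x).mapMatrix (Matrix.of (gAlg hω))⁻¹ * Matrix.of (ω x) = 1 := by
    rw [← map_gAlg hω x, ← map_mul, Matrix.nonsing_inv_mul _ (isUnit_det_gAlg hω), map_one]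
  change (Matrix.of (ω x))⁻¹ i j = _
  rw [Matrix.inv_eq_left_inv h]
  rfl

theorem gAlg_symm (hω : IsMetric U ω) (i j : Fin n) : gAlg hω i j = gAlg hω j i :=
  alg_ext fun x => hω.symm x x.2 i j

theorem rep_firstKind (hU : IsOpen U) {h : (Fin n → ℝ) → Fin n → Fin n → ℝ}
    {H : Fin n → Fin n → smoothAlg U} (hH : ∀ i j, Rep (fun x => h x i j) (H i j))
    (r i j : Fin n) : Rep (firstKind h r i j) (fk (dAlg hU) H r i j) :=
  (((hH r j).pd hU i).add ((hH r i).pd hU j)).sub ((hH i j).pd hU r)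

theorem rep_half (r : ℝ) (hr : r = 1 / 2) : Rep (fun _ => r) (half (smoothAlg U)) :=
  hr ▸ Rep.const _

theorem rep_christoffel (hU : IsOpen U) (hω : IsMetric U ω) (k i j : Fin n) :
    Rep (christoffel ω k i j) (chr (dAlg hU) (gAlg hω) (giAlg hω) k i j) :=
  (rep_half _ rfl).mul (Rep.sum fun r _ =>
    (rep_giAlg hω k r).mul (rep_firstKind hU (rep_gAlg hω) r i j))

/-- The algebra of smooth functions on `U`, with the geometry of the metric. -/
def geom (hU : IsOpen U) (hω : IsMetric U ω) {c : ℝ} (hc : HasConstantCurvature U ω c) :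
    ConstCurv n (smoothAlg U) where
  d := dAlg hU
  d_comm := dAlg_comm hU
  g := gAlg hω
  g_symm := gAlg_symm hω
  gi := giAlg hω
  g_gi := g_giAlg hω
  gi_g := gi_gAlg hω
  γ := chr (dAlg hU) (gAlg hω) (giAlg hω)
  γ_symm := chr_symm (gAlg_symm hω)
  d_g := d_metric (gAlg_symm hω) (g_giAlg hω)
  c := algebraMap ℝ _ c
  d_c i := Derivation.map_algebraMap _ _
  curv k l i j := by
    have hγ := rep_christoffel hU hω
    have h1 : Rep (fun x => curvature ω x ![i, j] l k) _ :=
      (((hγ k l j).pd hU i).sub ((hγ k l i).pd hU j)).add (Rep.sum (s := Finset.univ)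
        (F := fun r x => christoffel ω r l j x * christoffel ω k r i x
          - christoffel ω r l i x * christoffel ω k r j x) fun r _ =>
        ((hγ r l j).mul (hγ k r i)).sub ((hγ r l i).mul (hγ k r j)))
    have h2 : Rep (fun x => c * ((if k = i then ω x l j else 0) - (if k = j then ω x l i else 0)))
        _ := (Rep.const c).mul (((rep_gAlg hω l j).ite (k = i)).sub
          ((rep_gAlg hω l i).ite (k = j)))
    refine h1.unique fun x => ?_
    rw [← h2 x]
    exact congrFun (congrFun (congrFun (hc x x.2) ![i, j]) l) k

variable (hU : IsOpen U) (hω : IsMetric U ω) {c : ℝ} (hc : HasConstantCurvature U ω c)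
include hU hω hc

theorem rep_killing {ξ : (Fin n → ℝ) → Fin n → ℝ} {X : Fin n → smoothAlg U}
    (h : ∀ k, Rep (fun x => ξ x k) (X k)) (i j : Fin n) :
    Rep (fun x => killing ω ξ x i j) ((geom hU hω hc).kil (low (gAlg hω) X) i j) := by
  have := (geom hU hω hc).kil_low X i j
  refine (show low (gAlg hω) X = low (geom hU hω hc).g X from rfl) ▸ this ▸ Rep.sum fun r _ => ?_
  exact (((rep_gAlg hω r j).mul ((h r).pd hU i)).add
    ((rep_gAlg hω i r).mul ((h r).pd hU j))).add ((h r).mul ((rep_gAlg hω i j).pd hU r))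

theorem rep_varChristoffel {Ω : (Fin n → ℝ) → Fin n → Fin n → ℝ}
    {H : Fin n → Fin n → smoothAlg U} (h : ∀ i j, Rep (fun x => Ω x i j) (H i j))
    (k i j : Fin n) :
    Rep (varChristoffel ω Ω k i j) ((geom hU hω hc).varChr H k i j) :=
  Rep.sum fun r _ => (rep_giAlg hω k r).mul
    (((rep_half _ rfl).mul (rep_firstKind hU h r i j)).sub
      (Rep.sum fun s _ => (h r s).mul (rep_christoffel hU hω s i j)))

theorem rep_riemann {Ω : (Fin n → ℝ) → Fin n → Fin n → ℝ}
    {H : Fin n → Fin n → smoothAlg U} (h : ∀ i j, Rep (fun x => Ω x i j) (H i j))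
    (I : Fin 2 → Fin n) (l k : Fin n) :
    Rep (fun x => riemann c ω Ω x I l k) ((geom hU hω hc).riem H k l (I 0) (I 1)) := by
  have hγ := rep_christoffel hU hω
  have hΓ := rep_varChristoffel hU hω hc h
  refine ((((hΓ k l (I 1)).pd hU (I 0)).sub ((hΓ k l (I 0)).pd hU (I 1))).add
    (Rep.sum fun r _ => ?_)).sub ((Rep.const c).mul (((h l (I 1)).ite _).sub ((h l (I 0)).ite _)))
  exact ((((hΓ r l (I 1)).mul (hγ k r (I 0))).add ((hγ r l (I 1)).mul (hΓ k r (I 0)))).sub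
    ((hΓ r l (I 0)).mul (hγ k r (I 1)))).sub ((hγ r l (I 0)).mul (hΓ k r (I 1)))

theorem rep_covDeriv {R : (Fin n → ℝ) → (Fin 2 → Fin n) → Fin n → Fin n → ℝ}
    {Q : Fin n → Fin n → Fin n → Fin n → smoothAlg U}
    (h : ∀ i j l k, Rep (fun x => R x ![i, j] l k) (Q i j l k)) (p i j l k : Fin n) :
    Rep (covDeriv ω R p i j l k) ((geom hU hω hc).covD Q p i j l k) := by
  have hγ := rep_christoffel hU hω
  exact ((h i j l k).pd hU p).add (Rep.sum fun s _ => ((((hγ k p s).mul (h i j l s)).sub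
    ((hγ s p l).mul (h i j s k))).sub ((hγ s p i).mul (h s j l k))).sub
    ((hγ s p j).mul (h i s l k)))

theorem rep_bianchi {R : (Fin n → ℝ) → (Fin 2 → Fin n) → Fin n → Fin n → ℝ}
    {Q : Fin n → Fin n → Fin n → Fin n → smoothAlg U}
    (h : ∀ i j l k, Rep (fun x => R x ![i, j] l k) (Q i j l k)) (I : Fin 3 → Fin n)
    (l k : Fin n) :
    Rep (fun x => bianchi ω R x I l k)
      ((geom hU hω hc).covD Q (I 0) (I 1) (I 2) l k
        + (geom hU hω hc).covD Q (I 1) (I 2) (I 0) l k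
        + (geom hU hω hc).covD Q (I 2) (I 0) (I 1) l k) :=
  have h := rep_covDeriv hU hω hc h
  ((h (I 0) (I 1) (I 2) l k).add (h (I 1) (I 2) (I 0) l k)).add (h (I 2) (I 0) (I 1) l k)

end Geometry

/-! ### Alternating forms in components, the Spencer map, and dimension counts. -/

section Forms
variable {n : ℕ} {W : Type*} [AddCommGroup W] [Module ℝ W]

/-- Adjacent transpositions generate the symmetric group. -/
theorem mem_formsIn_of_adjacent {s : ℕ} {g : Submodule ℝ W} {ω : (Fin (s + 1) → Fin n) → W}
    (h1 : ∀ I, ω I ∈ g)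
    (h2 : ∀ (a : Fin s) (I), ω (I ∘ Equiv.swap a.castSucc a.succ) = -ω I) :
    ω ∈ formsIn (s + 1) g := by
  refine ⟨h1, fun σ => ?_⟩
  have hσ : σ ∈ Submonoid.closure
      (Set.range fun a : Fin s => Equiv.swap a.castSucc a.succ) := by
    rw [Equiv.Perm.mclosure_swap_castSucc_succ]
    trivial
  induction hσ using Submonoid.closure_induction with
  | mem σ hσ =>
    obtain ⟨a, rfl⟩ := hσ
    intro I
    rw [h2, Equiv.Perm.sign_swap (Fin.castSucc_lt_succ).ne]
    simp
  | one =>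
    intro I
    simp
  | mul σ τ _ _ hσ hτ =>
    intro I
    have : I ∘ (σ * τ : Equiv.Perm _) = (I ∘ σ) ∘ τ := rfl
    rw [this, hτ, hσ, smul_smul, Equiv.Perm.sign_mul]
    push_cast
    rw [mul_comm]

theorem formsIn_swap {s : ℕ} {g : Submodule ℝ W} {ω : (Fin s → Fin n) → W}
    (h : ω ∈ formsIn s g) {a b : Fin s} (hab : a ≠ b) (I : Fin s → Fin n) :
    ω (I ∘ Equiv.swap a b) = -ω I := by
  rw [h.2, Equiv.Perm.sign_swap hab]
  simp

theorem vec2_eq (I : Fin 2 → Fin n) : ![I 0, I 1] = I := by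
  ext i
  fin_cases i <;> rfl

theorem vec3_eq (I : Fin 3 → Fin n) : ![I 0, I 1, I 2] = I := by
  ext i
  fin_cases i <;> rfl

theorem vec4_eq (I : Fin 4 → Fin n) : ![I 0, I 1, I 2, I 3] = I := by
  ext i
  fin_cases i <;> rfl

theorem mem_formsIn_two {g : Submodule ℝ W} {ω : (Fin 2 → Fin n) → W} :
    ω ∈ formsIn 2 g ↔ (∀ i j, ω ![i, j] ∈ g) ∧ ∀ i j, ω ![i, j] + ω ![j, i] = 0 := by
  constructor
  · intro h
    refine ⟨fun i j => h.1 _, fun i j => ?_⟩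
    have := formsIn_swap h (show (0 : Fin 2) ≠ 1 by decide) ![i, j]
    have e : ![i, j] ∘ Equiv.swap (0 : Fin 2) 1 = ![j, i] := by
      ext a
      fin_cases a <;> rfl
    rw [e] at this
    rw [this, add_neg_cancel]
  · rintro ⟨h1, h2⟩
    refine mem_formsIn_of_adjacent (fun I => vec2_eq I ▸ h1 _ _) fun a I => ?_
    fin_cases a
    have e : I ∘ Equiv.swap (Fin.castSucc (0 : Fin 1)) (Fin.succ 0) = ![I 1, I 0] := by
      ext a
      fin_cases a <;> rfl
    have h := h2 (I 1) (I 0)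
    rw [vec2_eq I] at h
    exact (congrArg ω e).trans (eq_neg_of_add_eq_zero_left h)

theorem mem_formsIn_three {g : Submodule ℝ W} {ω : (Fin 3 → Fin n) → W} :
    ω ∈ formsIn 3 g ↔ (∀ p i j, ω ![p, i, j] ∈ g) ∧
      (∀ p i j, ω ![p, i, j] + ω ![i, p, j] = 0) ∧
      ∀ p i j, ω ![p, i, j] + ω ![p, j, i] = 0 := by
  constructor
  · intro h
    refine ⟨fun p i j => h.1 _, fun p i j => ?_, fun p i j => ?_⟩
    · have := formsIn_swap h (show (0 : Fin 3) ≠ 1 by decide) ![p, i, j]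
      have e : ![p, i, j] ∘ Equiv.swap (0 : Fin 3) 1 = ![i, p, j] := by
        ext a
        fin_cases a <;> rfl
      rw [e] at this
      rw [this, add_neg_cancel]
    · have := formsIn_swap h (show (1 : Fin 3) ≠ 2 by decide) ![p, i, j]
      have e : ![p, i, j] ∘ Equiv.swap (1 : Fin 3) 2 = ![p, j, i] := by
        ext a
        fin_cases a <;> rfl
      rw [e] at this
      rw [this, add_neg_cancel]
  · rintro ⟨h1, h2, h3⟩
    refine mem_formsIn_of_adjacent (fun I => vec3_eq I ▸ h1 _ _ _) fun a I => ?_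
    fin_cases a
    · have e : I ∘ Equiv.swap (Fin.castSucc (0 : Fin 2)) (Fin.succ 0) = ![I 1, I 0, I 2] := by
        ext a
        fin_cases a <;> rfl
      have h := h2 (I 1) (I 0) (I 2)
      rw [vec3_eq I] at h
      exact (congrArg ω e).trans (eq_neg_of_add_eq_zero_left h)
    · have e : I ∘ Equiv.swap (Fin.castSucc (1 : Fin 2)) (Fin.succ 1) = ![I 0, I 2, I 1] := by
        ext a
        fin_cases a <;> rfl
      have h := h3 (I 0) (I 2) (I 1)
      rw [vec3_eq I] at h
      exact (congrArg ω e).trans (eq_neg_of_add_eq_zero_left h)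

theorem mem_formsIn_four {g : Submodule ℝ W} {ω : (Fin 4 → Fin n) → W} :
    ω ∈ formsIn 4 g ↔ (∀ l p i j, ω ![l, p, i, j] ∈ g) ∧
      (∀ l p i j, ω ![l, p, i, j] + ω ![p, l, i, j] = 0) ∧
      (∀ l p i j, ω ![l, p, i, j] + ω ![l, i, p, j] = 0) ∧
      ∀ l p i j, ω ![l, p, i, j] + ω ![l, p, j, i] = 0 := by
  constructor
  · intro h
    refine ⟨fun l p i j => h.1 _, fun l p i j => ?_, fun l p i j => ?_, fun l p i j => ?_⟩
    · have := formsIn_swap h (show (0 : Fin 4) ≠ 1 by decide) ![l, p, i, j]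
      have e : ![l, p, i, j] ∘ Equiv.swap (0 : Fin 4) 1 = ![p, l, i, j] := by
        ext a
        fin_cases a <;> rfl
      rw [e] at this
      rw [this, add_neg_cancel]
    · have := formsIn_swap h (show (1 : Fin 4) ≠ 2 by decide) ![l, p, i, j]
      have e : ![l, p, i, j] ∘ Equiv.swap (1 : Fin 4) 2 = ![l, i, p, j] := by
        ext a
        fin_cases a <;> rfl
      rw [e] at this
      rw [this, add_neg_cancel]
    · have := formsIn_swap h (show (2 : Fin 4) ≠ 3 by decide) ![l, p, i, j]
      have e : ![l, p, i, j] ∘ Equiv.swap (2 : Fin 4) 3 = ![l, p, j, i] := by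
        ext a
        fin_cases a <;> rfl
      rw [e] at this
      rw [this, add_neg_cancel]
  · rintro ⟨h1, h2, h3, h4⟩
    refine mem_formsIn_of_adjacent (fun I => vec4_eq I ▸ h1 _ _ _ _) fun a I => ?_
    fin_cases a
    · have e : I ∘ Equiv.swap (Fin.castSucc (0 : Fin 3)) (Fin.succ 0)
          = ![I 1, I 0, I 2, I 3] := by
        ext a
        fin_cases a <;> rfl
      have h := h2 (I 1) (I 0) (I 2) (I 3)
      rw [vec4_eq I] at h
      exact (congrArg ω e).trans (eq_neg_of_add_eq_zero_left h)
    · have e : I ∘ Equiv.swap (Fin.castSucc (1 : Fin 3)) (Fin.succ 1)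
          = ![I 0, I 2, I 1, I 3] := by
        ext a
        fin_cases a <;> rfl
      have h := h3 (I 0) (I 2) (I 1) (I 3)
      rw [vec4_eq I] at h
      exact (congrArg ω e).trans (eq_neg_of_add_eq_zero_left h)
    · have e : I ∘ Equiv.swap (Fin.castSucc (2 : Fin 3)) (Fin.succ 2)
          = ![I 0, I 1, I 3, I 2] := by
        ext a
        fin_cases a <;> rfl
      have h := h4 (I 0) (I 1) (I 3) (I 2)
      rw [vec4_eq I] at h
      exact (congrArg ω e).trans (eq_neg_of_add_eq_zero_left h)

theorem delta_two (ω : (Fin 2 → Fin n) → Fin n → W) (l i j : Fin n) :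
    delta 2 ω ![l, i, j] = ω ![i, j] l - ω ![l, j] i + ω ![l, i] j := by
  have e0 : ![l, i, j] ∘ (0 : Fin 3).succAbove = ![i, j] := by
    ext a
    fin_cases a <;> rfl
  have e1 : ![l, i, j] ∘ (1 : Fin 3).succAbove = ![l, j] := by
    ext a
    fin_cases a <;> rfl
  have e2 : ![l, i, j] ∘ (2 : Fin 3).succAbove = ![l, i] := by
    ext a
    fin_cases a <;> rfl
  change ∑ a : Fin 3, (-1 : ℝ) ^ (a : ℕ) • ω (![l, i, j] ∘ a.succAbove) (![l, i, j] a) = _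
  rw [Fin.sum_univ_three, e0, e1, e2]
  simp [sub_eq_add_neg]

theorem delta_three (ω : (Fin 3 → Fin n) → Fin n → W) (l p i j : Fin n) :
    delta 3 ω ![l, p, i, j]
      = ω ![p, i, j] l - ω ![l, i, j] p + ω ![l, p, j] i - ω ![l, p, i] j := by
  have e0 : ![l, p, i, j] ∘ (0 : Fin 4).succAbove = ![p, i, j] := by
    ext a
    fin_cases a <;> rfl
  have e1 : ![l, p, i, j] ∘ (1 : Fin 4).succAbove = ![l, i, j] := by
    ext a
    fin_cases a <;> rfl
  have e2 : ![l, p, i, j] ∘ (2 : Fin 4).succAbove = ![l, p, j] := by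
    ext a
    fin_cases a <;> rfl
  have e3 : ![l, p, i, j] ∘ (3 : Fin 4).succAbove = ![l, p, i] := by
    ext a
    fin_cases a <;> rfl
  change ∑ a : Fin 4, (-1 : ℝ) ^ (a : ℕ) • ω (![l, p, i, j] ∘ a.succAbove) (![l, p, i, j] a) = _
  rw [Fin.sum_univ_four, e0, e1, e2, e3]
  simp [sub_eq_add_neg, pow_succ]

/-- The alternating map with given values on the basis vectors. -/
def formsToAlt (s : ℕ) (g : Submodule ℝ W) (ω : formsIn (n := n) s g) :
    (Fin n → ℝ) [⋀^Fin s]→ₗ[ℝ] g :=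
  { (∑ I : Fin s → Fin n, ((MultilinearMap.mkPiAlgebra ℝ (Fin s) ℝ).compLinearMap
      fun a => LinearMap.proj (I a)).smulRight (⟨ω.1 I, ω.2.1 I⟩ : g)) with
    map_eq_zero_of_eq' := fun v i j hv hij => by
      simp only [MultilinearMap.toFun_eq_coe, sum_apply,
        MultilinearMap.smulRight_apply, MultilinearMap.compLinearMap_apply,
        MultilinearMap.mkPiAlgebra_apply, LinearMap.proj_apply]
      set F : (Fin s → Fin n) → g := fun I => (∏ a, v a (I a)) • (⟨ω.1 I, ω.2.1 I⟩ : g) with hF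
      have hsw : ∀ a, v (Equiv.swap i j a) = v a := fun a => by
        rcases eq_or_ne a i with rfl | hai
        · rw [Equiv.swap_apply_left, hv]
        rcases eq_or_ne a j with rfl | haj
        · rw [Equiv.swap_apply_right, hv]
        rw [Equiv.swap_apply_of_ne_of_ne hai haj]
      -- Exchanging the two equal arguments keeps the product of coordinates and changes the sign of
      -- the form, so the sum equals its own negative.
      have hneg : ∀ I, F (I ∘ Equiv.swap i j) = -F I := fun I => by
        have h1 : ∏ a, v a ((I ∘ Equiv.swap i j) a) = ∏ a, v a (I a) := by
          rw [← Equiv.prod_comp (Equiv.swap i j) fun a => v a (I a)]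
          simp only [hsw, Function.comp_apply]
        have h2 : (⟨ω.1 (I ∘ Equiv.swap i j), ω.2.1 _⟩ : g) = -⟨ω.1 I, ω.2.1 I⟩ :=
          Subtype.ext (formsIn_swap ω.2 hij I)
        simp only [hF, h1, h2, smul_neg]
      have h3 : ∑ I, F (I ∘ Equiv.swap i j) = ∑ I, F I :=
        Equiv.sum_comp (Equiv.arrowCongr (Equiv.swap i j) (Equiv.refl (Fin n))) F
      simp only [hneg, Finset.sum_neg_distrib] at h3
      have h4 : (2 : ℝ) • ∑ I, F I = 0 := by
        rw [two_smul]
        nth_rewrite 1 [← h3]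
        exact neg_add_cancel _
      exact (smul_eq_zero.1 h4).resolve_left two_ne_zero }

theorem formsToAlt_apply (s : ℕ) (g : Submodule ℝ W) (ω : formsIn (n := n) s g)
    (v : Fin s → Fin n → ℝ) :
    formsToAlt s g ω v = ∑ I, (∏ a, v a (I a)) • (⟨ω.1 I, ω.2.1 I⟩ : g) := by
  change (∑ I : Fin s → Fin n, ((MultilinearMap.mkPiAlgebra ℝ (Fin s) ℝ).compLinearMap
      fun a => LinearMap.proj (I a)).smulRight (⟨ω.1 I, ω.2.1 I⟩ : g)) v = _
  simp only [sum_apply, MultilinearMap.smulRight_apply,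
    MultilinearMap.compLinearMap_apply, MultilinearMap.mkPiAlgebra_apply, LinearMap.proj_apply]

theorem formsToAlt_single (s : ℕ) (g : Submodule ℝ W) (ω : formsIn (n := n) s g)
    (J : Fin s → Fin n) :
    formsToAlt s g ω (fun a => Pi.single (J a) 1) = (⟨ω.1 J, ω.2.1 J⟩ : g) := by
  rw [formsToAlt_apply, Finset.sum_eq_single J]
  · simp
  · intro I _ hI
    obtain ⟨a, ha⟩ := Function.ne_iff.1 hI
    rw [Finset.prod_eq_zero (Finset.mem_univ a) (Pi.single_eq_of_ne ha 1), zero_smul]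
  · intro h
    exact absurd (Finset.mem_univ J) h

/-- Forms in components are alternating maps. -/
def altEquivForms (s : ℕ) (g : Submodule ℝ W) :
    ((Fin n → ℝ) [⋀^Fin s]→ₗ[ℝ] g) ≃ₗ[ℝ] formsIn (n := n) s g where
  toFun f := ⟨fun I => f fun a => Pi.single (I a) 1, fun I => Submodule.coe_mem _, fun σ I => by
    have := f.map_perm (fun a => Pi.single (I a) 1) σ
    refine (congrArg Subtype.val this).trans ?_
    rw [Units.smul_def, Submodule.coe_smul_of_tower, Int.cast_smul_eq_zsmul]⟩
  map_add' _ _ := rfl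
  map_smul' _ _ := rfl
  invFun := formsToAlt s g
  left_inv f := by
    refine AlternatingMap.coe_multilinearMap_injective
      (Module.Basis.ext_multilinear (fun _ => Pi.basisFun ℝ (Fin n)) fun J => ?_)
    simp only [AlternatingMap.coe_multilinearMap, Pi.basisFun_apply]
    exact formsToAlt_single s g _ J
  right_inv ω := Subtype.ext (funext fun I => congrArg Subtype.val (formsToAlt_single s g ω I))

theorem finrank_formsIn (s : ℕ) (g : Submodule ℝ W) [Module.Finite ℝ g] :
    Module.finrank ℝ (formsIn (n := n) s g) = n.choose s * Module.finrank ℝ g := by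
  rw [← (altEquivForms s g).finrank_eq,
    (exteriorPower.alternatingMapLinearEquiv (R := ℝ) (M := Fin n → ℝ) (N := g)).finrank_eq,
    Module.finrank_linearMap, exteriorPower.finrank_eq, Module.finrank_fin_fun]

/-- The antisymmetric matrices. -/
def antisym (n : ℕ) : Submodule ℝ (Fin n → Fin n → ℝ) where
  carrier := {ξ | ∀ i j, ξ i j + ξ j i = 0}
  add_mem' := by
    intro a b ha hb i j
    simp only [Pi.add_apply]
    linear_combination ha i j + hb i j
  zero_mem' := fun i j => by simp
  smul_mem' := by
    intro t a ha i j
    simp only [Pi.smul_apply, smul_eq_mul]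
    linear_combination t * ha i j

theorem finrank_antisym (n : ℕ) : Module.finrank ℝ (antisym n) = n.choose 2 := by
  let e : antisym n ≃ₗ[ℝ] formsIn (n := n) 2 (⊤ : Submodule ℝ ℝ) :=
    { toFun := fun ξ => ⟨fun I => ξ.1 (I 0) (I 1),
        mem_formsIn_two.2 ⟨fun _ _ => trivial, fun i j => ξ.2 i j⟩⟩
      map_add' := fun _ _ => rfl
      map_smul' := fun _ _ => rfl
      invFun := fun ω => ⟨fun i j => ω.1 ![i, j], (mem_formsIn_two.1 ω.2).2⟩
      left_inv := fun _ => rfl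
      right_inv := fun ω => Subtype.ext (funext fun I => by simp only [vec2_eq]) }
  rw [e.finrank_eq, finrank_formsIn, finrank_top, Module.finrank_self, mul_one]

/-- Rank-nullity for antisymmetrisation, with kernel the symmetric and range the antisymmetric
matrices. -/
theorem finrank_symTensors (x : Fin n → ℝ) :
    Module.finrank ℝ (symTensors n x) + n.choose 2 = n * n := by
  let T : (Fin n → Fin n → ℝ) →ₗ[ℝ] (Fin n → Fin n → ℝ) :=
    { toFun := fun h i j => h i j - h j i
      map_add' := fun a b => by
        funext i j
        simp only [Pi.add_apply]
        ring
      map_smul' := fun r a => by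
        funext i j
        simp only [Pi.smul_apply, smul_eq_mul, RingHom.id_apply]
        ring }
  have hk : LinearMap.ker T = symTensors n x := by
    ext h
    rw [LinearMap.mem_ker]
    exact ⟨fun e i j => sub_eq_zero.1 (congrFun (congrFun e i) j),
      fun e => funext fun i => funext fun j => sub_eq_zero.2 (e i j)⟩
  have hr : LinearMap.range T = antisym n := by
    ext h
    constructor
    · rintro ⟨a, rfl⟩ i j
      change a i j - a j i + (a j i - a i j) = 0
      ring
    · intro hh
      refine ⟨(1 / 2 : ℝ) • h, ?_⟩
      funext i j
      change (1 / 2 : ℝ) * h i j - (1 / 2 : ℝ) * h j i = h i j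
      linear_combination -(1 / 2) * hh i j
  have := LinearMap.finrank_range_add_finrank_ker T
  rw [hk, hr, finrank_antisym] at this
  simp only [Module.finrank_pi_fintype, Module.finrank_self, Finset.sum_const, Finset.card_univ,
    Fintype.card_fin, smul_eq_mul, mul_one] at this
  omega

/-- Rank-nullity for a surjective `δ`. -/
theorem finrank_cocycles {s : ℕ} {g : Submodule ℝ (Fin n → Fin n → ℝ)}
    (h1 : ∀ ω ∈ formsIn s g, delta s ω ∈ formsIn (s + 1) (⊤ : Submodule ℝ (Fin n → ℝ)))
    (h2 : ∀ β ∈ formsIn (s + 1) (⊤ : Submodule ℝ (Fin n → ℝ)), ∃ ω ∈ formsIn s g,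
      delta s ω = β) :
    n.choose (s + 1) * n + Module.finrank ℝ (cocycles s g)
      = n.choose s * Module.finrank ℝ g := by
  let T := (delta (n := n) (W := Fin n → ℝ) s).restrict h1
  have hr : LinearMap.range T = ⊤ := by
    rw [LinearMap.range_eq_top]
    rintro ⟨β, hβ⟩
    obtain ⟨ω, hω, e⟩ := h2 β hβ
    exact ⟨⟨ω, hω⟩, Subtype.ext e⟩
  have hk : (LinearMap.ker T).map (formsIn s g).subtype = cocycles s g := by
    ext ω
    constructor
    · rintro ⟨η, hη, rfl⟩
      exact ⟨η.2, congrArg Subtype.val hη⟩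
    · rintro ⟨hω, hω'⟩
      exact ⟨⟨ω, hω⟩, Subtype.ext hω', rfl⟩
  have := LinearMap.finrank_range_add_finrank_ker T
  rw [hr, finrank_top, finrank_formsIn, finrank_formsIn, finrank_top, Module.finrank_fin_fun,
    ← Submodule.finrank_map_subtype_eq, hk] at this
  exact this

theorem delta_two_mem {g : Submodule ℝ (Fin n → W)} (ω : (Fin 2 → Fin n) → Fin n → W)
    (h : ω ∈ formsIn 2 g) : delta 2 ω ∈ formsIn 3 (⊤ : Submodule ℝ W) := by
  have h2 := (mem_formsIn_two.1 h).2
  have h2' : ∀ i j k, ω ![i, j] k = - ω ![j, i] k := fun i j k =>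
    eq_neg_of_add_eq_zero_left (congrFun (h2 i j) k)
  refine mem_formsIn_three.2 ⟨fun _ _ _ => trivial, fun l i j => ?_, fun l i j => ?_⟩
  · rw [delta_two, delta_two, h2' i l]
    abel
  · rw [delta_two, delta_two, h2' j i]
    abel

theorem delta_three_mem {g : Submodule ℝ (Fin n → W)} (ω : (Fin 3 → Fin n) → Fin n → W)
    (h : ω ∈ formsIn 3 g) : delta 3 ω ∈ formsIn 4 (⊤ : Submodule ℝ W) := by
  obtain ⟨-, h2, h3⟩ := mem_formsIn_three.1 h
  have h2' : ∀ p i j k, ω ![p, i, j] k = - ω ![i, p, j] k := fun p i j k =>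
    eq_neg_of_add_eq_zero_left (congrFun (h2 p i j) k)
  have h3' : ∀ p i j k, ω ![p, i, j] k = - ω ![p, j, i] k := fun p i j k =>
    eq_neg_of_add_eq_zero_left (congrFun (h3 p i j) k)
  refine mem_formsIn_four.2 ⟨fun _ _ _ _ => trivial, fun l p i j => ?_, fun l p i j => ?_,
    fun l p i j => ?_⟩
  · rw [delta_three, delta_three, h2' p l j, h2' p l i]
    abel
  · rw [delta_three, delta_three, h2' i p j, h3' l i p]
    abel
  · rw [delta_three, delta_three, h3' p j i, h3' l j i]
    abel

/-- The witness combines the two natural expressions in `β` that are antisymmetric in `k, l` and in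
the form indices. Requiring `δω = β` on coefficients `a, e` gives `3a = 1` and `a + 2e = 0`, hence
`1/3` and `-1/6`. -/
theorem delta_two_surj (β : (Fin 3 → Fin n) → Fin n → ℝ)
    (h : β ∈ formsIn 3 (⊤ : Submodule ℝ (Fin n → ℝ))) :
    ∃ ω ∈ formsIn 2 (antisym n), delta 2 ω = β := by
  obtain ⟨-, h1, h2⟩ := mem_formsIn_three.1 h
  set b : Fin n → Fin n → Fin n → Fin n → ℝ := fun k l i j => β ![l, i, j] k with hb
  have E1 : ∀ k l i j, b k l i j + b k i l j = 0 := fun k l i j => congrFun (h1 l i j) k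
  have E2 : ∀ k l i j, b k l i j + b k l j i = 0 := fun k l i j => congrFun (h2 l i j) k
  refine ⟨fun I l k => 1 / 3 * (b k l (I 0) (I 1) - b l k (I 0) (I 1))
    - 1 / 6 * (b (I 0) k l (I 1) - b (I 1) k l (I 0)), ?_, ?_⟩
  · refine mem_formsIn_two.2 ⟨fun i j l k => ?_, fun i j => funext fun l => funext fun k => ?_⟩
    · simp only [Matrix.cons_val_zero, Matrix.cons_val_one]
      linear_combination -1 / 6 * E1 i l k j + 1 / 6 * E1 j k l i
    · simp only [Matrix.cons_val_zero, Matrix.cons_val_one, Pi.add_apply, Pi.zero_apply]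
      linear_combination 1 / 3 * E2 k l j i - 1 / 3 * E2 l k j i
  · funext I k
    rw [← vec3_eq I, delta_two]
    simp only [Matrix.cons_val_zero, Matrix.cons_val_one, Pi.add_apply, Pi.sub_apply]
    generalize I 0 = l
    generalize I 1 = i
    generalize I 2 = j
    change _ = b k l i j
    linear_combination - 1/3 * E1 k i l j + 1/3 * E1 k j l i + 1/6 * E2 i k l j
      - 1/6 * E2 j k i l - 1/3 * E2 k l j i - 1/6 * E2 l k i j

/-- The same ansatz one degree higher: `4a = 1` and `a + 3e = 0`, hence `1/4` and `-1/12`. -/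
theorem delta_three_surj (β : (Fin 4 → Fin n) → Fin n → ℝ)
    (h : β ∈ formsIn 4 (⊤ : Submodule ℝ (Fin n → ℝ))) :
    ∃ ω ∈ formsIn 3 (antisym n), delta 3 ω = β := by
  obtain ⟨-, h1, h2, h3⟩ := mem_formsIn_four.1 h
  set b : Fin n → Fin n → Fin n → Fin n → Fin n → ℝ := fun k l p i j => β ![l, p, i, j] k with hb
  have E1 : ∀ k l p i j, b k l p i j + b k p l i j = 0 := fun k l p i j =>
    congrFun (h1 l p i j) k
  have E2 : ∀ k l p i j, b k l p i j + b k l i p j = 0 := fun k l p i j =>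
    congrFun (h2 l p i j) k
  have E3 : ∀ k l p i j, b k l p i j + b k l p j i = 0 := fun k l p i j =>
    congrFun (h3 l p i j) k
  refine ⟨fun I l k => 1 / 4 * (b k l (I 0) (I 1) (I 2) - b l k (I 0) (I 1) (I 2))
    - 1 / 12 * (b (I 0) k l (I 1) (I 2) - b (I 1) k l (I 0) (I 2) + b (I 2) k l (I 0) (I 1)),
    ?_, ?_⟩
  · refine mem_formsIn_three.2 ⟨fun p i j l k => ?_,
      fun p i j => funext fun l => funext fun k => ?_,
      fun p i j => funext fun l => funext fun k => ?_⟩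
    · simp only [Matrix.cons_val_zero, Matrix.cons_val_one, Matrix.cons_val]
      linear_combination 1/12 * E1 i l k p j - 1/12 * E1 j l k p i - 1/12 * E1 p k l i j
    · simp only [Matrix.cons_val_zero, Matrix.cons_val_one, Matrix.cons_val, Pi.add_apply,
        Pi.zero_apply]
      linear_combination 1/4 * E2 k l i p j - 1/4 * E2 l k p i j - 1/12 * E3 j k l p i
    · simp only [Matrix.cons_val_zero, Matrix.cons_val_one, Matrix.cons_val, Pi.add_apply,
        Pi.zero_apply]
      linear_combination 1/4 * E3 k l p j i - 1/4 * E3 l k p j i - 1/12 * E3 p k l i j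
  · funext I k
    rw [← vec4_eq I, delta_three]
    simp only [Matrix.cons_val_zero, Matrix.cons_val_one, Matrix.cons_val, Pi.add_apply,
      Pi.sub_apply]
    generalize I 0 = l
    generalize I 1 = p
    generalize I 2 = i
    generalize I 3 = j
    change _ = b k l p i j
    linear_combination - 1/4 * E1 k j l p i + 1/4 * E1 k l i j p + 1/2 * E1 k l i p j
      - 1/4 * E1 k p l i j + 1/12 * E1 l j p k i + 1/12 * E1 l k j p i - 1/12 * E1 l p k i j
      - 1/6 * E2 i k l p j - 1/12 * E2 i k p j l - 1/6 * E2 j k l i p - 1/12 * E2 j k p i l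
      - 1/4 * E2 k l j i p - 1/2 * E2 k l p i j - 1/12 * E2 l j p k i - 1/12 * E2 l k p i j
      - 1/12 * E2 l p j k i + 1/12 * E2 p k l i j - 1/12 * E2 p k l j i + 1/12 * E3 i k j l p
      + 1/12 * E3 i k p l j + 1/12 * E3 j k i p l + 1/6 * E3 j k l p i + 1/12 * E3 j k p l i
      - 1/4 * E3 k i l j p + 1/4 * E3 k l j p i + 1/12 * E3 l p k j i + 1/12 * E3 p k l i j

theorem cast_choose_three (n : ℕ) : (n.choose 3 : ℚ) = n * (n - 1) * (n - 2) / 6 := by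
  induction n with
  | zero => simp
  | succ n ih =>
    rw [Nat.choose_succ_succ, Nat.cast_add, ih, Nat.cast_choose_two]
    push_cast
    ring

theorem cast_choose_four (n : ℕ) :
    (n.choose 4 : ℚ) = n * (n - 1) * (n - 2) * (n - 3) / 24 := by
  induction n with
  | zero => simp
  | succ n ih =>
    rw [Nat.choose_succ_succ, Nat.cast_add, ih, cast_choose_three]
    push_cast
    ring

theorem finrank_cocycles_two_antisym (n : ℕ) :
    (Module.finrank ℝ (cocycles 2 (antisym n)) : ℚ) = n ^ 2 * (n ^ 2 - 1) / 12 := by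
  have := finrank_cocycles delta_two_mem (delta_two_surj (n := n))
  rw [finrank_antisym] at this
  have h := congrArg (Nat.cast (R := ℚ)) this
  push_cast [Nat.cast_choose_two, cast_choose_three] at h
  linear_combination h

theorem finrank_cocycles_three_antisym (n : ℕ) :
    (Module.finrank ℝ (cocycles 3 (antisym n)) : ℚ) = n ^ 2 * (n ^ 2 - 1) * (n - 2) / 24 := by
  have := finrank_cocycles delta_three_mem (delta_three_surj (n := n))
  rw [finrank_antisym] at this
  have h := congrArg (Nat.cast (R := ℚ)) this
  push_cast [Nat.cast_choose_two, cast_choose_three, cast_choose_four] at h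
  linear_combination h

end Forms

/-! ### Symmetries of the values of the Bianchi operator. -/

/-- The algebraic symmetries of the values of the Bianchi operator, with all indices lowered. -/
structure IsBian {n : ℕ} {M : Type*} [AddCommGroup M]
    (b : Fin n → Fin n → Fin n → Fin n → Fin n → M) : Prop where
  anti : ∀ k l p i j, b k l p i j + b l k p i j = 0
  alt : ∀ k l p i j, b k l p i j + b k l i p j = 0
  alt' : ∀ k l p i j, b k l p i j + b k l p j i = 0
  cyc : ∀ k l p i j, b k l p i j - b k p l i j + b k i l p j - b k j l p i = 0

section Bianchi
variable {n : ℕ} {A : Type*} [CommRing A] [Algebra ℝ A] (S : ConstCurv n A)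

/-- The symmetries are linear relations between permutations of the slots, and each Christoffel
correction replaces the same index in every term of such a relation. -/
theorem ConstCurv.nab4_isCurv {R : Fin n → Fin n → Fin n → Fin n → A} (hR : IsCurv R)
    (p : Fin n) : IsCurv (S.nab4 p R) where
  anti k l i j := by
    have e : S.nab4 p R k l i j + S.nab4 p R l k i j
        = S.d p (R k l i j + R l k i j) - ∑ s, S.γ s p k * (R s l i j + R l s i j)
          - ∑ s, S.γ s p l * (R k s i j + R s k i j) - ∑ s, S.γ s p i * (R k l s j + R l k s j)
          - ∑ s, S.γ s p j * (R k l i s + R l k i s) := by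
      simp only [nab4_apply, map_add, mul_add, Finset.sum_add_distrib]
      abel
    rw [e]
    simp [hR.anti]
  anti' k l i j := by
    have e : S.nab4 p R k l i j + S.nab4 p R k l j i
        = S.d p (R k l i j + R k l j i) - ∑ s, S.γ s p k * (R s l i j + R s l j i)
          - ∑ s, S.γ s p l * (R k s i j + R k s j i) - ∑ s, S.γ s p i * (R k l s j + R k l j s)
          - ∑ s, S.γ s p j * (R k l i s + R k l s i) := by
      simp only [nab4_apply, map_add, mul_add, Finset.sum_add_distrib]
      abel
    rw [e]
    simp [hR.anti']
  cyc k l i j := by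
    have e : S.nab4 p R k l i j + S.nab4 p R k i j l + S.nab4 p R k j l i
        = S.d p (R k l i j + R k i j l + R k j l i)
          - ∑ s, S.γ s p k * (R s l i j + R s i j l + R s j l i)
          - ∑ s, S.γ s p l * (R k s i j + R k i j s + R k j s i)
          - ∑ s, S.γ s p i * (R k l s j + R k s j l + R k j l s)
          - ∑ s, S.γ s p j * (R k l i s + R k i s l + R k s l i) := by
      simp only [nab4_apply, map_add, mul_add, Finset.sum_add_distrib]
      abel
    rw [e]
    simp [hR.cyc]

theorem ConstCurv.bia_isBian {R : Fin n → Fin n → Fin n → Fin n → A} (hR : IsCurv R) :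
    IsBian (S.bia R) where
  anti k l p i j := by
    simp only [bia]
    linear_combination (S.nab4_isCurv hR p).anti k l i j + (S.nab4_isCurv hR i).anti k l j p
      + (S.nab4_isCurv hR j).anti k l p i
  alt k l p i j := by
    simp only [bia]
    linear_combination (S.nab4_isCurv hR p).anti' k l i j + (S.nab4_isCurv hR i).anti' k l j p
      + (S.nab4_isCurv hR j).anti' k l p i
  alt' k l p i j := by
    simp only [bia]
    linear_combination (S.nab4_isCurv hR p).anti' k l i j + (S.nab4_isCurv hR i).anti' k l j p
      + (S.nab4_isCurv hR j).anti' k l p i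
  cyc k l p i j := by
    have hp := S.nab4_isCurv hR p
    have hi := S.nab4_isCurv hR i
    have hj := S.nab4_isCurv hR j
    have hl := S.nab4_isCurv hR l
    simp only [bia]
    linear_combination hp.cyc k l i j - hp.anti' k j i l + hi.cyc k l j p - hi.anti' k p j l
      - hi.anti' k j l p + hj.cyc k l p i - hj.anti' k p l i - hl.cyc k p i j + hl.anti' k i p j

end Bianchi

/-! ### Spencer cohomology of the Killing symbol, transported to antisymmetric matrices. -/

section Lowering
variable {n : ℕ} {w wi : Fin n → Fin n → ℝ}

/-- Lowering an index, as a linear equivalence. -/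
def lowEquiv (h1 : ∀ i j, ∑ r, w i r * wi r j = if i = j then 1 else 0)
    (h2 : ∀ i j, ∑ r, wi i r * w r j = if i = j then 1 else 0) :
    (Fin n → ℝ) ≃ₗ[ℝ] (Fin n → ℝ) where
  toFun := low w
  invFun := low wi
  map_add' X Y := by
    funext a
    simp only [low, Pi.add_apply, mul_add, Finset.sum_add_distrib]
  map_smul' r X := by
    funext a
    simp only [low, Pi.smul_apply, smul_eq_mul, mul_left_comm _ r, ← Finset.mul_sum,
      RingHom.id_apply]
  left_inv := low_raise h2
  right_inv := low_raise h1

theorem mem_killingSymbol (hw : ∀ i j, w i j = w j i) (ξ : Fin n → Fin n → ℝ) :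
    ξ ∈ killingSymbol w ↔ (fun i => low w (ξ i)) ∈ antisym n := by
  refine forall_congr' fun i => forall_congr' fun j => ?_
  change _ ↔ ∑ r, w j r * ξ i r + ∑ r, w i r * ξ j r = 0
  rw [Finset.sum_add_distrib]
  simp only [hw j]

variable (h1 : ∀ i j, ∑ r, w i r * wi r j = if i = j then 1 else 0)
  (h2 : ∀ i j, ∑ r, wi i r * w r j = if i = j then 1 else 0)

/-- Lowering the last index of a tensor-valued form. -/
def lowForms (s : ℕ) :
    ((Fin s → Fin n) → Fin n → Fin n → ℝ) ≃ₗ[ℝ] ((Fin s → Fin n) → Fin n → Fin n → ℝ) :=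
  LinearEquiv.piCongrRight fun _ => LinearEquiv.piCongrRight fun _ => lowEquiv h1 h2

/-- Lowering acts on the values in `T`, while `δ` only permutes the other indices. -/
theorem delta_lowForms (s : ℕ) (R : (Fin s → Fin n) → Fin n → Fin n → ℝ)
    (I : Fin (s + 1) → Fin n) :
    delta s (lowForms h1 h2 s R) I = lowEquiv h1 h2 (delta s R I) := by
  change ∑ a : Fin (s + 1), (-1 : ℝ) ^ (a : ℕ) • lowEquiv h1 h2 (R (I ∘ a.succAbove) (I a))
    = lowEquiv h1 h2 (∑ a : Fin (s + 1), (-1 : ℝ) ^ (a : ℕ) • R (I ∘ a.succAbove) (I a))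
  simp only [map_sum, map_smul]

theorem mem_cocycles_killingSymbol (hw : ∀ i j, w i j = w j i) (s : ℕ)
    (R : (Fin s → Fin n) → Fin n → Fin n → ℝ) :
    R ∈ cocycles s (killingSymbol w) ↔ lowForms h1 h2 s R ∈ cocycles s (antisym n) := by
  have e1 : ∀ I, R I ∈ killingSymbol w ↔ lowForms h1 h2 s R I ∈ antisym n := fun I =>
    mem_killingSymbol hw _
  have e2 : ∀ (σ : Equiv.Perm (Fin s)) (I : Fin s → Fin n),
      R (I ∘ σ) = ((Equiv.Perm.sign σ : ℤ) : ℝ) • R I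
        ↔ lowForms h1 h2 s R (I ∘ σ) = ((Equiv.Perm.sign σ : ℤ) : ℝ) • lowForms h1 h2 s R I := by
    intro σ I
    let E := LinearEquiv.piCongrRight (R := ℝ) fun _ : Fin n => lowEquiv h1 h2
    change _ ↔ E (R (I ∘ σ)) = ((Equiv.Perm.sign σ : ℤ) : ℝ) • E (R I)
    rw [← map_smul]
    exact E.injective.eq_iff.symm
  refine and_congr (and_congr (forall_congr' e1)
    (forall_congr' fun σ => forall_congr' fun I => e2 σ I)) ?_
  change delta s R = 0 ↔ delta s (lowForms h1 h2 s R) = 0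
  rw [funext_iff, funext_iff]
  refine forall_congr' fun I => ?_
  rw [delta_lowForms]
  exact (LinearEquiv.map_eq_zero_iff _).symm

include h1 h2 in
theorem finrank_cocycles_killingSymbol (hw : ∀ i j, w i j = w j i) (s : ℕ) :
    Module.finrank ℝ (cocycles s (killingSymbol w))
      = Module.finrank ℝ (cocycles s (antisym n)) := by
  rw [← LinearEquiv.finrank_map_eq (lowForms h1 h2 s)]
  congr 2
  all_goals
    ext R
    rw [Submodule.mem_map]
    constructor
    · rintro ⟨Q, hQ, rfl⟩
      exact (mem_cocycles_killingSymbol h1 h2 hw s Q).1 hQ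
    · intro hR
      refine ⟨(lowForms h1 h2 s).symm R, (mem_cocycles_killingSymbol h1 h2 hw s _).2 ?_, ?_⟩
      · rwa [LinearEquiv.apply_symm_apply]
      · exact LinearEquiv.apply_symm_apply _ _

-- The Killing symbol is of finite type: a tensor symmetric in its first two indices and
-- antisymmetric in its last two is zero, by the argument that makes the Levi-Civita connection
-- unique.
include h1 h2 in
theorem prolong_killingSymbol (hw : ∀ i j, w i j = w j i) : prolong (killingSymbol w) = ⊥ := by
  rw [eq_bot_iff]
  rintro v ⟨hv, hs⟩
  have ha : ∀ i j k, low w (v i j) k + low w (v i k) j = 0 := fun i =>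
    (mem_killingSymbol hw (v i)).1 (hv i)
  have h0 : ∀ i j, lowEquiv h1 h2 (v i j) = 0 := fun i j => funext fun k => by
    change low w (v i j) k = 0
    have a1 := ha i j k
    have a2 := ha k i j
    have a3 := ha j k i
    rw [hs k i] at a2
    rw [hs j k, hs j i] at a3
    linarith
  exact funext fun i => funext fun j => (LinearEquiv.map_eq_zero_iff _).1 (h0 i j)

include h1 h2 in
theorem coboundaries_killingSymbol (hw : ∀ i j, w i j = w j i) (s : ℕ) :
    coboundaries s (killingSymbol w) = ⊥ := by
  cases s with
  | zero => rfl
  | succ s =>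
    rw [coboundaries, prolong_killingSymbol h1 h2 hw, eq_bot_iff]
    rintro _ ⟨ω, hω, rfl⟩
    have : ω = 0 := funext fun I => hω.1 I
    rw [this, map_zero]
    exact Submodule.zero_mem _

theorem finrank_cohomology_of_coboundaries {W : Type*} [AddCommGroup W] [Module ℝ W] {s : ℕ}
    {g : Submodule ℝ (Fin n → W)} (h : coboundaries s g = ⊥) :
    Module.finrank ℝ (cohomology s g) = Module.finrank ℝ (cocycles s g) := by
  have : (coboundaries s g).submoduleOf (cocycles s g) = ⊥ := by
    rw [h, Submodule.submoduleOf, Submodule.comap_bot, Submodule.ker_subtype]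
  exact (Submodule.quotEquivOfEqBot _ this).finrank_eq

/-- For two-forms with values in antisymmetric matrices, `δ Q = 0` is the first Bianchi identity up
to the order of indices. -/
theorem mem_cocycles_two_antisym (Q : (Fin 2 → Fin n) → Fin n → Fin n → ℝ) :
    Q ∈ cocycles 2 (antisym n) ↔ IsCurv fun k l i j => Q ![i, j] l k := by
  have hd : delta 2 Q = 0 ↔ ∀ k l i j, Q ![i, j] l k - Q ![l, j] i k + Q ![l, i] j k = 0 := by
    constructor
    · intro h k l i j
      have := congrFun (congrFun h ![l, i, j]) k
      rwa [delta_two] at this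
    · intro h
      funext I k
      rw [← vec3_eq I, delta_two]
      exact h k _ _ _
  constructor
  · rintro ⟨hf, hk⟩
    obtain ⟨ha, hb⟩ := mem_formsIn_two.1 hf
    have hb' : ∀ k l i j, Q ![i, j] l k + Q ![j, i] l k = 0 := fun k l i j =>
      congrFun (congrFun (hb i j) l) k
    refine ⟨fun k l i j => by linear_combination ha i j l k, hb', fun k l i j => ?_⟩
    linear_combination hd.1 hk k l i j + hb' k i j l
  · rintro ⟨R1, R2, R3⟩
    refine ⟨mem_formsIn_two.2 ⟨fun i j l k => ?_, fun i j => funext fun l => funext fun k =>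
      R2 k l i j⟩, hd.2 fun k l i j => ?_⟩
    · linear_combination R1 k l i j
    · linear_combination R3 k l i j - R2 k i j l

theorem mem_cocycles_three_antisym (Q : (Fin 3 → Fin n) → Fin n → Fin n → ℝ) :
    Q ∈ cocycles 3 (antisym n) ↔ IsBian fun k l p i j => Q ![p, i, j] l k := by
  have hd : delta 3 Q = 0 ↔ ∀ k l p i j,
      Q ![p, i, j] l k - Q ![l, i, j] p k + Q ![l, p, j] i k - Q ![l, p, i] j k = 0 := by
    constructor
    · intro h k l p i j
      have := congrFun (congrFun h ![l, p, i, j]) k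
      rwa [delta_three] at this
    · intro h
      funext I k
      rw [← vec4_eq I, delta_three]
      exact h k _ _ _ _
  constructor
  · rintro ⟨hf, hk⟩
    obtain ⟨ha, hb, hc⟩ := mem_formsIn_three.1 hf
    refine ⟨fun k l p i j => ?_, fun k l p i j => congrFun (congrFun (hb p i j) l) k,
      fun k l p i j => congrFun (congrFun (hc p i j) l) k, hd.1 hk⟩
    linear_combination ha p i j l k
  · rintro ⟨R1, R2, R3, R4⟩
    refine ⟨mem_formsIn_three.2 ⟨fun p i j l k => ?_,
      fun p i j => funext fun l => funext fun k => R2 k l p i j,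
      fun p i j => funext fun l => funext fun k => R3 k l p i j⟩, hd.2 R4⟩
    linear_combination R1 k l p i j

end Lowering

/-! ### The fibres at a point. -/

section Fibres
variable {n : ℕ} {U : Set (Fin n → ℝ)} {ω : (Fin n → ℝ) → Fin n → Fin n → ℝ}

theorem metric_inv (hω : IsMetric U ω) {x : Fin n → ℝ} (hx : x ∈ U) (i j : Fin n) :
    ∑ r, ω x i r * inv (ω x) r j = if i = j then 1 else 0 := by
  have := congrFun (congrFun (Matrix.mul_nonsing_inv (Matrix.of (ω x))
    (isUnit_iff_ne_zero.2 (hω.det_ne_zero x hx))) i) j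
  rwa [Matrix.mul_apply, Matrix.one_apply] at this

theorem inv_metric (hω : IsMetric U ω) {x : Fin n → ℝ} (hx : x ∈ U) (i j : Fin n) :
    ∑ r, inv (ω x) i r * ω x r j = if i = j then 1 else 0 := by
  have := congrFun (congrFun (Matrix.nonsing_inv_mul (Matrix.of (ω x))
    (isUnit_iff_ne_zero.2 (hω.det_ne_zero x hx))) i) j
  rwa [Matrix.mul_apply, Matrix.one_apply] at this

theorem mem_cocycleBundle_two (hω : IsMetric U ω) {x : Fin n → ℝ} (hx : x ∈ U)
    (R : (Fin 2 → Fin n) → Fin n → Fin n → ℝ) :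
    R ∈ cocycleBundle ω 2 x ↔ IsCurv fun k l i j => low (ω x) (R ![i, j] l) k :=
  (mem_cocycles_killingSymbol (metric_inv hω hx) (inv_metric hω hx) (hω.symm x hx) 2 R).trans
    (mem_cocycles_two_antisym _)

theorem mem_cocycleBundle_three (hω : IsMetric U ω) {x : Fin n → ℝ} (hx : x ∈ U)
    (R : (Fin 3 → Fin n) → Fin n → Fin n → ℝ) :
    R ∈ cocycleBundle ω 3 x ↔ IsBian fun k l p i j => low (ω x) (R ![p, i, j] l) k :=
  (mem_cocycles_killingSymbol (metric_inv hω hx) (inv_metric hω hx) (hω.symm x hx) 3 R).trans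
    (mem_cocycles_three_antisym _)

theorem low_spaceForm (w : Fin n → Fin n → ℝ) (i j l a : Fin n) :
    low w (spaceForm w ![i, j] l) a = w a i * w l j - w a j * w l i := by
  simp [low, spaceForm, mul_sub, Finset.sum_sub_distrib]

theorem curvature_mem (hω : IsMetric U ω) {c : ℝ} (hc : HasConstantCurvature U ω c)
    {x : Fin n → ℝ} (hx : x ∈ U) : curvature ω x ∈ cocycleBundle ω 2 x := by
  rw [hc x hx]
  refine Submodule.smul_mem _ _ ((mem_cocycleBundle_two hω hx _).2 ?_)
  have hs := hω.symm x hx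
  constructor
  all_goals
    intro k l i j
    simp only [low_spaceForm]
  · ring
  · ring
  · rw [hs l j, hs i l, hs i j]
    ring

theorem fibres (hω : IsMetric U ω) {c : ℝ} (hc : HasConstantCurvature U ω c)
    {x : Fin n → ℝ} (hx : x ∈ U) :
    Module.finrank ℝ (tangent n x) = n ∧
    (Module.finrank ℝ (symTensors n x) : ℚ) = n * (n + 1) / 2 ∧
    coboundaries 2 (killingSymbol (ω x)) = ⊥ ∧
    (Module.finrank ℝ (cohomology 2 (killingSymbol (ω x))) : ℚ) = n ^ 2 * (n ^ 2 - 1) / 12 ∧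
    (Module.finrank ℝ (cocycleBundle ω 2 x) : ℚ) = n ^ 2 * (n ^ 2 - 1) / 12 ∧
    coboundaries 3 (killingSymbol (ω x)) = ⊥ ∧
    (Module.finrank ℝ (cohomology 3 (killingSymbol (ω x))) : ℚ)
      = n ^ 2 * (n ^ 2 - 1) * (n - 2) / 24 ∧
    (Module.finrank ℝ (cocycleBundle ω 3 x) : ℚ) = n ^ 2 * (n ^ 2 - 1) * (n - 2) / 24 ∧
    curvature ω x ∈ cocycleBundle ω 2 x := by
  have h1 := metric_inv hω hx
  have h2 := inv_metric hω hx
  have hw := hω.symm x hx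
  have b2 := coboundaries_killingSymbol h1 h2 hw 2
  have b3 := coboundaries_killingSymbol h1 h2 hw 3
  have d2 : (Module.finrank ℝ (cocycles 2 (killingSymbol (ω x))) : ℚ)
      = n ^ 2 * (n ^ 2 - 1) / 12 := by
    rw [finrank_cocycles_killingSymbol h1 h2 hw, finrank_cocycles_two_antisym]
  have d3 : (Module.finrank ℝ (cocycles 3 (killingSymbol (ω x))) : ℚ)
      = n ^ 2 * (n ^ 2 - 1) * (n - 2) / 24 := by
    rw [finrank_cocycles_killingSymbol h1 h2 hw, finrank_cocycles_three_antisym]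
  refine ⟨?_, ?_, b2, ?_, d2, b3, ?_, d3, curvature_mem hω hc hx⟩
  · rw [tangent, finrank_top, Module.finrank_fin_fun]
  · have h := congrArg (Nat.cast (R := ℚ)) (finrank_symTensors x)
    push_cast [Nat.cast_choose_two] at h
    linear_combination h
  · rw [finrank_cohomology_of_coboundaries b2, d2]
  · rw [finrank_cohomology_of_coboundaries b3, d3]

end Fibres

/-! ### The operators in mixed components, obtained by raising an index. -/

section Lower
variable {n : ℕ} {A : Type*} [CommRing A] [Algebra ℝ A]

theorem low_lin (g : Fin n → Fin n → A) (a b : ℝ) (X Y : Fin n → A) (i : Fin n) :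
    low g (fun k => a • X k + b • Y k) i = a • low g X i + b • low g Y i := by
  simp only [low, mul_add, mul_smul_comm, Finset.sum_add_distrib, Finset.smul_sum]

theorem low_mem_van {d : Fin n → Derivation ℝ A A} {ev : A →ₐ[ℝ] ℝ} (g : Fin n → Fin n → A)
    {m : ℕ} {X : Fin n → A} (h : ∀ k, X k ∈ van d ev m) (a : Fin n) : low g X a ∈ van d ev m :=
  sum_mem fun k _ => Ideal.mul_mem_left _ _ (h k)

variable (S : ConstCurv n A)

/-- The Killing operator on vector fields. -/
def killOp (X : Fin n → A) (i j : Fin n) : A := S.kil (low S.g X) i j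

/-- The Riemann operator, in mixed components. -/
def riemOp (H : Fin n → Fin n → A) (I : Fin 2 → Fin n) (l k : Fin n) : A :=
  low S.gi (fun r => half A * S.riem2 H r l (I 0) (I 1)) k

/-- Lowering the upper index of a curvature tensor. -/
def lowCurv (Q : (Fin 2 → Fin n) → Fin n → Fin n → A) (k l i j : Fin n) : A :=
  low S.g (Q ![i, j] l) k

/-- The Bianchi operator, in mixed components. -/
def bianOp (Q : (Fin 2 → Fin n) → Fin n → Fin n → A) (I : Fin 3 → Fin n) (l k : Fin n) : A :=
  low S.gi (fun r => S.bia (lowCurv S Q) r l (I 0) (I 1) (I 2)) k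

theorem killOp_lin (a b : ℝ) (X Y : Fin n → A) (i j : Fin n) :
    killOp S (fun k => a • X k + b • Y k) i j = a • killOp S X i j + b • killOp S Y i j := by
  have : low S.g (fun k => a • X k + b • Y k) = fun i => a • low S.g X i + b • low S.g Y i :=
    funext (low_lin S.g a b X Y)
  rw [killOp, this, S.kil_add, S.kil_smul, S.kil_smul, killOp, killOp]

theorem riemOp_lin (a b : ℝ) (X Y : Fin n → Fin n → A) (I : Fin 2 → Fin n) (l k : Fin n) :
    riemOp S (fun i j => a • X i j + b • Y i j) I l k
      = a • riemOp S X I l k + b • riemOp S Y I l k := by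
  rw [riemOp, riemOp, riemOp, ← low_lin]
  congr 1
  funext r
  rw [S.riem2_add, S.riem2_smul, S.riem2_smul, mul_add, mul_smul_comm, mul_smul_comm]

theorem bianOp_lin (a b : ℝ) (X Y : (Fin 2 → Fin n) → Fin n → Fin n → A) (I : Fin 3 → Fin n)
    (l k : Fin n) :
    bianOp S (fun J l k => a • X J l k + b • Y J l k) I l k
      = a • bianOp S X I l k + b • bianOp S Y I l k := by
  rw [bianOp, bianOp, bianOp, ← low_lin]
  congr 1
  funext r
  have : lowCurv S (fun J l k => a • X J l k + b • Y J l k)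
      = fun k l i j => a • lowCurv S X k l i j + b • lowCurv S Y k l i j := by
    funext k l i j
    exact low_lin _ _ _ _ _ _
  rw [this, S.bia_add, S.bia_smul, S.bia_smul]

variable {ev : A →ₐ[ℝ] ℝ}

theorem killOp_mem_van {m : ℕ} {X : Fin n → A} (h : ∀ k, X k ∈ van S.d ev (m + 1))
    (i j : Fin n) : killOp S X i j ∈ van S.d ev m :=
  S.kil_mem_van (low_mem_van _ h) i j

theorem riemOp_mem_van {m : ℕ} {H : Fin n → Fin n → A} (h : ∀ i j, H i j ∈ van S.d ev (m + 2))
    (I : Fin 2 → Fin n) (l k : Fin n) : riemOp S H I l k ∈ van S.d ev m :=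
  low_mem_van _ (fun _ => Ideal.mul_mem_left _ _ (S.riem2_mem_van h _ _ _ _)) k

theorem bianOp_mem_van {m : ℕ} {Q : (Fin 2 → Fin n) → Fin n → Fin n → A}
    (h : ∀ J l k, Q J l k ∈ van S.d ev (m + 1)) (I : Fin 3 → Fin n) (l k : Fin n) :
    bianOp S Q I l k ∈ van S.d ev m :=
  low_mem_van _ (fun _ => S.bia_mem_van (fun _ _ _ _ => low_mem_van _ (fun _ => h _ _ _) _)
    _ _ _ _ _) k

theorem lowCurv_riemOp (H : Fin n → Fin n → A) (k l i j : Fin n) :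
    lowCurv S (riemOp S H) k l i j = half A * S.riem2 H k l i j :=
  congrFun (low_raise S.g_gi fun r => half A * S.riem2 H r l i j) k

theorem low_bianOp (Q : (Fin 2 → Fin n) → Fin n → Fin n → A) (k l p i j : Fin n) :
    low S.g (bianOp S Q ![p, i, j] l) k = S.bia (lowCurv S Q) k l p i j :=
  congrFun (low_raise S.g_gi fun r => S.bia (lowCurv S Q) r l p i j) k

/-- `low_riem` followed by raising. From here on `riemOp` stands for the linearised curvature on
symmetric tensors. -/
theorem riem_eq_riemOp {H : Fin n → Fin n → A} (h : ∀ i j, H i j = H j i) (I : Fin 2 → Fin n)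
    (l k : Fin n) : S.riem H k l (I 0) (I 1) = riemOp S H I l k := by
  have e : low S.g (fun k => S.riem H k l (I 0) (I 1))
      = fun r => half A * S.riem2 H r l (I 0) (I 1) := funext fun r => by
    rw [← S.low_riem h]
    linear_combination -low S.g (fun k => S.riem H k l (I 0) (I 1)) r * two_mul_half (A := A)
  rw [riemOp, ← e, low_raise S.gi_g]

theorem covD_eq_bianOp (Q : (Fin 2 → Fin n) → Fin n → Fin n → A) (I : Fin 3 → Fin n)
    (l k : Fin n) :
    S.covD (fun i j => Q ![i, j]) (I 0) (I 1) (I 2) l k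
      + S.covD (fun i j => Q ![i, j]) (I 1) (I 2) (I 0) l k
      + S.covD (fun i j => Q ![i, j]) (I 2) (I 0) (I 1) l k = bianOp S Q I l k := by
  set c : Fin n → Fin n → Fin n → Fin n → A := fun p i j k =>
    S.covD (fun i j => Q ![i, j]) p i j l k with hc
  have h : ∀ p i j a, low S.g (c p i j) a = S.nab4 p (lowCurv S Q) a l i j := fun p i j a =>
    S.low_covD (fun i j => Q ![i, j]) p i j l a
  have e : low S.g (fun k => c (I 0) (I 1) (I 2) k + c (I 1) (I 2) (I 0) k
      + c (I 2) (I 0) (I 1) k) = fun r => S.bia (lowCurv S Q) r l (I 0) (I 1) (I 2) := by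
    funext r
    rw [ConstCurv.bia, ← h, ← h, ← h]
    simp only [low, mul_add, Finset.sum_add_distrib]
  exact (congrFun (low_raise S.gi_g _) k).symm.trans (congrFun (congrArg (low S.gi) e) k)

theorem lowCurv_riemOp_isCurv {H : Fin n → Fin n → A} (h : ∀ i j, H i j = H j i) :
    IsCurv (lowCurv S (riemOp S H)) := by
  have hc := S.riem2_isCurv h
  constructor
  all_goals
    intro k l i j
    simp only [lowCurv_riemOp]
  · linear_combination half A * hc.anti k l i j
  · linear_combination half A * hc.anti' k l i j
  · linear_combination half A * hc.cyc k l i j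

theorem riemOp_killOp (X : Fin n → A) (I : Fin 2 → Fin n) (l k : Fin n) :
    riemOp S (killOp S X) I l k = 0 := by
  have : ∀ k l i j, S.riem2 (killOp S X) k l i j = 0 := S.riem2_kil (low S.g X)
  simp only [riemOp, this, low, mul_zero, Finset.sum_const_zero]

theorem bianOp_riemOp {H : Fin n → Fin n → A} (h : ∀ i j, H i j = H j i) (I : Fin 3 → Fin n)
    (l k : Fin n) : bianOp S (riemOp S H) I l k = 0 := by
  have e : lowCurv S (riemOp S H) = fun k l i j => (1 / 2 : ℝ) • S.riem2 H k l i j := by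
    funext k l i j
    rw [lowCurv_riemOp, half, ← Algebra.smul_def]
  have : ∀ r, S.bia (lowCurv S (riemOp S H)) r l (I 0) (I 1) (I 2) = 0 := fun r => by
    rw [e, S.bia_smul]
    have h0 : S.bia (fun k l i j => S.riem2 H k l i j) r l (I 0) (I 1) (I 2) = 0 :=
      S.bia_riem2 h _ _ _ _ _
    rw [h0, smul_zero]
  simp only [bianOp, this, low, mul_zero, Finset.sum_const_zero]

end Lower

/-! ### Passage between sections of the bundles and tensors over the algebra. -/

section Sections
variable {n : ℕ} {U : Set (Fin n → ℝ)} {ω : (Fin n → ℝ) → Fin n → Fin n → ℝ}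

theorem exists_rep_one {f : (Fin n → ℝ) → Fin n → ℝ}
    (hf : ContDiffOn ℝ ((⊤ : ℕ∞) : WithTop ℕ∞) f U) :
    ∃ X : Fin n → smoothAlg U, ∀ k, Rep (fun x => f x k) (X k) :=
  ⟨fun k => toAlg (contDiffOn_pi.1 hf k), fun _ => rep_toAlg _⟩

theorem exists_rep_two {f : (Fin n → ℝ) → Fin n → Fin n → ℝ}
    (hf : ContDiffOn ℝ ((⊤ : ℕ∞) : WithTop ℕ∞) f U) :
    ∃ H : Fin n → Fin n → smoothAlg U, ∀ i j, Rep (fun x => f x i j) (H i j) :=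
  ⟨fun i j => toAlg (contDiffOn_pi.1 (contDiffOn_pi.1 hf i) j), fun _ _ => rep_toAlg _⟩

theorem exists_rep_forms {s : ℕ} {f : (Fin n → ℝ) → (Fin s → Fin n) → Fin n → Fin n → ℝ}
    (hf : ContDiffOn ℝ ((⊤ : ℕ∞) : WithTop ℕ∞) f U) :
    ∃ Q : (Fin s → Fin n) → Fin n → Fin n → smoothAlg U,
      ∀ I l k, Rep (fun x => f x I l k) (Q I l k) :=
  ⟨fun I l k => toAlg (contDiffOn_pi.1 (contDiffOn_pi.1 (contDiffOn_pi.1 hf I) l) k),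
    fun _ _ _ => rep_toAlg _⟩

theorem smooth_one {f : (Fin n → ℝ) → Fin n → ℝ} {X : Fin n → smoothAlg U}
    (h : ∀ k, Rep (fun x => f x k) (X k)) : ContDiffOn ℝ ((⊤ : ℕ∞) : WithTop ℕ∞) f U :=
  contDiffOn_pi.2 fun k => (h k).contDiffOn

theorem smooth_two {f : (Fin n → ℝ) → Fin n → Fin n → ℝ} {H : Fin n → Fin n → smoothAlg U}
    (h : ∀ i j, Rep (fun x => f x i j) (H i j)) :
    ContDiffOn ℝ ((⊤ : ℕ∞) : WithTop ℕ∞) f U :=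
  contDiffOn_pi.2 fun i => smooth_one (h i)

theorem smooth_forms {s : ℕ} {f : (Fin n → ℝ) → (Fin s → Fin n) → Fin n → Fin n → ℝ}
    {Q : (Fin s → Fin n) → Fin n → Fin n → smoothAlg U}
    (h : ∀ I l k, Rep (fun x => f x I l k) (Q I l k)) :
    ContDiffOn ℝ ((⊤ : ℕ∞) : WithTop ℕ∞) f U :=
  contDiffOn_pi.2 fun I => smooth_two (h I)

variable (hU : IsOpen U) {x : Fin n → ℝ} (hx : x ∈ U) (r : ℕ)
include hU

theorem sameJet_one {f g : (Fin n → ℝ) → Fin n → ℝ} {X Y : Fin n → smoothAlg U}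
    (hf : ∀ k, Rep (fun x => f x k) (X k)) (hg : ∀ k, Rep (fun x => g x k) (Y k)) :
    SameJet r x f g ↔ ∀ k, X k - Y k ∈ van (dAlg hU) (evalAt ⟨x, hx⟩) (r + 1) := by
  have hn := hU.mem_nhds hx
  rw [sameJet_pi ((smooth_one hf x hx).contDiffAt hn) ((smooth_one hg x hx).contDiffAt hn)]
  exact forall_congr' fun k => (hf k).sameJet_iff hU hx r (hg k)

theorem sameJet_two {f g : (Fin n → ℝ) → Fin n → Fin n → ℝ} {X Y : Fin n → Fin n → smoothAlg U}
    (hf : ∀ i j, Rep (fun x => f x i j) (X i j)) (hg : ∀ i j, Rep (fun x => g x i j) (Y i j)) :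
    SameJet r x f g ↔ ∀ i j, X i j - Y i j ∈ van (dAlg hU) (evalAt ⟨x, hx⟩) (r + 1) := by
  have hn := hU.mem_nhds hx
  rw [sameJet_pi ((smooth_two hf x hx).contDiffAt hn) ((smooth_two hg x hx).contDiffAt hn)]
  exact forall_congr' fun i => sameJet_one hU hx r (hf i) (hg i)

theorem sameJet_forms {s : ℕ} {f g : (Fin n → ℝ) → (Fin s → Fin n) → Fin n → Fin n → ℝ}
    {X Y : (Fin s → Fin n) → Fin n → Fin n → smoothAlg U}
    (hf : ∀ I l k, Rep (fun x => f x I l k) (X I l k))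
    (hg : ∀ I l k, Rep (fun x => g x I l k) (Y I l k)) :
    SameJet r x f g ↔ ∀ I l k, X I l k - Y I l k ∈ van (dAlg hU) (evalAt ⟨x, hx⟩) (r + 1) := by
  have hn := hU.mem_nhds hx
  rw [sameJet_pi ((smooth_forms hf x hx).contDiffAt hn) ((smooth_forms hg x hx).contDiffAt hn)]
  exact forall_congr' fun i => sameJet_two hU hx r (hf i) (hg i)

omit hU

theorem eval_low (hω : IsMetric U ω) (y : U) (X : Fin n → smoothAlg U) (a : Fin n) :
    evalAt y (low (gAlg hω) X a) = low (ω y) (fun k => evalAt y (X k)) a := by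
  simp only [low, map_sum, map_mul]
  rfl

theorem symm_alg_iff {f : (Fin n → ℝ) → Fin n → Fin n → ℝ} {H : Fin n → Fin n → smoothAlg U}
    (h : ∀ i j, Rep (fun x => f x i j) (H i j)) :
    (∀ x ∈ U, f x ∈ symTensors n x) ↔ ∀ i j, H i j = H j i := by
  constructor
  · intro hf i j
    refine (h i j).unique fun x => ?_
    exact (hf x x.2 i j).trans (h j i x)
  · intro hH x hx i j
    have h1 := (h i j).eval hx
    have h2 := (h j i).eval hx
    rw [hH, ← h2] at h1
    exact h1

theorem curv_alg_iff (hω : IsMetric U ω) {f : (Fin n → ℝ) → (Fin 2 → Fin n) → Fin n → Fin n → ℝ}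
    {Q : (Fin 2 → Fin n) → Fin n → Fin n → smoothAlg U}
    (h : ∀ I l k, Rep (fun x => f x I l k) (Q I l k)) :
    (∀ x ∈ U, f x ∈ cocycleBundle ω 2 x)
      ↔ IsCurv fun k l i j => low (gAlg hω) (Q ![i, j] l) k := by
  have e : ∀ (y : U) k l i j, evalAt y (low (gAlg hω) (Q ![i, j] l) k)
      = low (ω y) (f y ![i, j] l) k := fun y k l i j => by
    rw [eval_low]
    exact congrArg (fun X => low (ω y) X k) (funext fun a => (h ![i, j] l a y).symm)
  constructor
  · intro hf
    have hc := fun y : U => (mem_cocycleBundle_two hω y.2 _).1 (hf y y.2)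
    refine ⟨fun k l i j => alg_ext fun y => ?_, fun k l i j => alg_ext fun y => ?_,
      fun k l i j => alg_ext fun y => ?_⟩
    · simp only [map_add, map_zero, e]
      exact (hc y).anti k l i j
    · simp only [map_add, map_zero, e]
      exact (hc y).anti' k l i j
    · simp only [map_add, map_zero, e]
      exact (hc y).cyc k l i j
  · intro hc x hx
    refine (mem_cocycleBundle_two hω hx _).2 ⟨fun k l i j => ?_, fun k l i j => ?_,
      fun k l i j => ?_⟩
    · have := congrArg (evalAt ⟨x, hx⟩) (hc.anti k l i j)
      simpa only [map_add, map_zero, e] using this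
    · have := congrArg (evalAt ⟨x, hx⟩) (hc.anti' k l i j)
      simpa only [map_add, map_zero, e] using this
    · have := congrArg (evalAt ⟨x, hx⟩) (hc.cyc k l i j)
      simpa only [map_add, map_zero, e] using this

theorem bian_of_alg (hω : IsMetric U ω) {f : (Fin n → ℝ) → (Fin 3 → Fin n) → Fin n → Fin n → ℝ}
    {Q : (Fin 3 → Fin n) → Fin n → Fin n → smoothAlg U}
    (h : ∀ I l k, Rep (fun x => f x I l k) (Q I l k))
    (hc : IsBian fun k l p i j => low (gAlg hω) (Q ![p, i, j] l) k) :
    ∀ x ∈ U, f x ∈ cocycleBundle ω 3 x := by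
  have e : ∀ (y : U) k l p i j, evalAt y (low (gAlg hω) (Q ![p, i, j] l) k)
      = low (ω y) (f y ![p, i, j] l) k := fun y k l p i j => by
    rw [eval_low]
    exact congrArg (fun X => low (ω y) X k) (funext fun a => (h ![p, i, j] l a y).symm)
  intro x hx
  refine (mem_cocycleBundle_three hω hx _).2 ⟨fun k l p i j => ?_, fun k l p i j => ?_,
    fun k l p i j => ?_, fun k l p i j => ?_⟩
  · have := congrArg (evalAt ⟨x, hx⟩) (hc.anti k l p i j)
    simpa only [map_add, map_zero, e] using this
  · have := congrArg (evalAt ⟨x, hx⟩) (hc.alt k l p i j)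
    simpa only [map_add, map_zero, e] using this
  · have := congrArg (evalAt ⟨x, hx⟩) (hc.alt' k l p i j)
    simpa only [map_add, map_zero, e] using this
  · have := congrArg (evalAt ⟨x, hx⟩) (hc.cyc k l p i j)
    simpa only [map_add, map_sub, map_zero, e] using this

end Sections

/-! ### Orders, symbols and formal exactness of the three operators. -/

section Clauses
variable {n : ℕ} {U : Set (Fin n → ℝ)} {ω : (Fin n → ℝ) → Fin n → Fin n → ℝ}
  (hU : IsOpen U) (hω : IsMetric U ω) {c : ℝ} (hc : HasConstantCurvature U ω c)
include hU hω hc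

theorem rep_killOp {ξ : (Fin n → ℝ) → Fin n → ℝ} {X : Fin n → smoothAlg U}
    (h : ∀ k, Rep (fun x => ξ x k) (X k)) (i j : Fin n) :
    Rep (fun x => killing ω ξ x i j) (killOp (geom hU hω hc) X i j) :=
  rep_killing hU hω hc h i j

theorem rep_riemOp {Ω : (Fin n → ℝ) → Fin n → Fin n → ℝ} {H : Fin n → Fin n → smoothAlg U}
    (h : ∀ i j, Rep (fun x => Ω x i j) (H i j)) (hs : ∀ i j, H i j = H j i)
    (I : Fin 2 → Fin n) (l k : Fin n) :
    Rep (fun x => riemann c ω Ω x I l k) (riemOp (geom hU hω hc) H I l k) :=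
  riem_eq_riemOp (geom hU hω hc) hs I l k ▸ rep_riemann hU hω hc h I l k

theorem rep_bianOp {R : (Fin n → ℝ) → (Fin 2 → Fin n) → Fin n → Fin n → ℝ}
    {Q : (Fin 2 → Fin n) → Fin n → Fin n → smoothAlg U}
    (h : ∀ I l k, Rep (fun x => R x I l k) (Q I l k)) (I : Fin 3 → Fin n) (l k : Fin n) :
    Rep (fun x => bianchi ω R x I l k) (bianOp (geom hU hω hc) Q I l k) :=
  covD_eq_bianOp (geom hU hω hc) Q I l k ▸
    rep_bianchi hU hω hc (Q := fun i j => Q ![i, j]) (fun i j => h ![i, j]) I l k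

theorem isDiffOp_killing : IsDiffOp U (tangent n) (symTensors n) 1 (killing ω) where
  isSection f hf := by
    obtain ⟨X, hX⟩ := exists_rep_one hf.1
    have h := rep_killOp hU hω hc hX
    exact ⟨smooth_two h, (symm_alg_iff h).2 fun i j => (geom hU hω hc).kil_symm _ i j⟩
  linear f g hf hg a b x hx := by
    obtain ⟨X, hX⟩ := exists_rep_one hf.1
    obtain ⟨Y, hY⟩ := exists_rep_one hg.1
    have h := rep_killOp hU hω hc (ξ := a • f + b • g) (X := fun k => a • X k + b • Y k)
      fun k => ((hX k).smul a).add ((hY k).smul b)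
    funext i j
    refine (h i j ⟨x, hx⟩).trans ?_
    rw [killOp_lin]
    exact ((((rep_killOp hU hω hc hX i j).smul a).add
      ((rep_killOp hU hω hc hY i j).smul b)) ⟨x, hx⟩).symm
  order_le f g hf hg x hx hfg := by
    obtain ⟨X, hX⟩ := exists_rep_one hf.1
    obtain ⟨Y, hY⟩ := exists_rep_one hg.1
    funext i j
    -- The difference of the two sections, in the shape required by `killOp_lin`. Equal jets of
    -- order one put it in `van 2`, hence its image in `van 1`, which vanishes at `x`.
    have h := killOp_mem_van (geom hU hω hc) (m := 1) (X := fun k => (1 : ℝ) • X k + (-1 : ℝ) • Y k)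
      (fun k => by
        have := (sameJet_one hU hx 1 hX hY).1 hfg k
        rwa [one_smul, neg_one_smul, ← sub_eq_add_neg]) i j
    rw [killOp_lin, one_smul, neg_one_smul, ← sub_eq_add_neg] at h
    have h0 := ev_eq_zero h
    rw [map_sub, sub_eq_zero] at h0
    exact ((rep_killOp hU hω hc hX i j).eval hx).trans
      (h0.trans ((rep_killOp hU hω hc hY i j).eval hx).symm)

theorem isDiffOp_riemann : IsDiffOp U (symTensors n) (cocycleBundle ω 2) 2 (riemann c ω) where
  isSection f hf := by
    obtain ⟨H, hH⟩ := exists_rep_two hf.1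
    have hs := (symm_alg_iff hH).1 hf.2
    have h := rep_riemOp hU hω hc hH hs
    exact ⟨smooth_forms h, (curv_alg_iff hω h).2 (lowCurv_riemOp_isCurv (geom hU hω hc) hs)⟩
  linear f g hf hg a b x hx := by
    obtain ⟨X, hX⟩ := exists_rep_two hf.1
    obtain ⟨Y, hY⟩ := exists_rep_two hg.1
    have hXs := (symm_alg_iff hX).1 hf.2
    have hYs := (symm_alg_iff hY).1 hg.2
    have h := rep_riemOp hU hω hc (Ω := a • f + b • g) (H := fun i j => a • X i j + b • Y i j)
      (fun i j => ((hX i j).smul a).add ((hY i j).smul b))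
      (fun i j => by simp only [hXs i j, hYs i j])
    funext I l k
    refine (h I l k ⟨x, hx⟩).trans ?_
    rw [riemOp_lin]
    exact ((((rep_riemOp hU hω hc hX hXs I l k).smul a).add
      ((rep_riemOp hU hω hc hY hYs I l k).smul b)) ⟨x, hx⟩).symm
  order_le f g hf hg x hx hfg := by
    obtain ⟨X, hX⟩ := exists_rep_two hf.1
    obtain ⟨Y, hY⟩ := exists_rep_two hg.1
    have hXs := (symm_alg_iff hX).1 hf.2
    have hYs := (symm_alg_iff hY).1 hg.2
    funext I l k
    have h := riemOp_mem_van (geom hU hω hc) (m := 1)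
      (H := fun i j => (1 : ℝ) • X i j + (-1 : ℝ) • Y i j)
      (fun i j => by
        have := (sameJet_two hU hx 2 hX hY).1 hfg i j
        rwa [one_smul, neg_one_smul, ← sub_eq_add_neg]) I l k
    rw [riemOp_lin, one_smul, neg_one_smul, ← sub_eq_add_neg] at h
    have h0 := ev_eq_zero h
    rw [map_sub, sub_eq_zero] at h0
    exact ((rep_riemOp hU hω hc hX hXs I l k).eval hx).trans
      (h0.trans ((rep_riemOp hU hω hc hY hYs I l k).eval hx).symm)

theorem isDiffOp_bianchi :
    IsDiffOp U (cocycleBundle ω 2) (cocycleBundle ω 3) 1 (bianchi ω) where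
  isSection f hf := by
    obtain ⟨Q, hQ⟩ := exists_rep_forms hf.1
    have h := rep_bianOp hU hω hc hQ
    refine ⟨smooth_forms h, bian_of_alg hω h ?_⟩
    have hb := (geom hU hω hc).bia_isBian ((curv_alg_iff hω hQ).1 hf.2)
    have e : (fun k l p i j => low (gAlg hω) (bianOp (geom hU hω hc) Q ![p, i, j] l) k)
        = (geom hU hω hc).bia (lowCurv (geom hU hω hc) Q) := by
      funext k l p i j
      exact low_bianOp (geom hU hω hc) Q k l p i j
    rw [e]
    exact hb
  linear f g hf hg a b x hx := by
    obtain ⟨X, hX⟩ := exists_rep_forms hf.1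
    obtain ⟨Y, hY⟩ := exists_rep_forms hg.1
    have h := rep_bianOp hU hω hc (R := a • f + b • g)
      (Q := fun I l k => a • X I l k + b • Y I l k)
      (fun I l k => ((hX I l k).smul a).add ((hY I l k).smul b))
    funext I l k
    refine (h I l k ⟨x, hx⟩).trans ?_
    rw [bianOp_lin]
    exact ((((rep_bianOp hU hω hc hX I l k).smul a).add
      ((rep_bianOp hU hω hc hY I l k).smul b)) ⟨x, hx⟩).symm
  order_le f g hf hg x hx hfg := by
    obtain ⟨X, hX⟩ := exists_rep_forms hf.1
    obtain ⟨Y, hY⟩ := exists_rep_forms hg.1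
    funext I l k
    have h := bianOp_mem_van (geom hU hω hc) (m := 1)
      (Q := fun I l k => (1 : ℝ) • X I l k + (-1 : ℝ) • Y I l k)
      (fun I l k => by
        have := (sameJet_forms hU hx 1 hX hY).1 hfg I l k
        rwa [one_smul, neg_one_smul, ← sub_eq_add_neg]) I l k
    rw [bianOp_lin, one_smul, neg_one_smul, ← sub_eq_add_neg] at h
    have h0 := ev_eq_zero h
    rw [map_sub, sub_eq_zero] at h0
    exact ((rep_bianOp hU hω hc hX I l k).eval hx).trans
      (h0.trans ((rep_bianOp hU hω hc hY I l k).eval hx).symm)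

theorem eval_lowi {x : Fin n → ℝ} (hx : x ∈ U) (X : Fin n → smoothAlg U) (a : Fin n) :
    evalAt ⟨x, hx⟩ (low (geom hU hω hc).gi X a)
      = low (inv (ω x)) (fun k => evalAt ⟨x, hx⟩ (X k)) a := by
  simp only [low, map_sum, map_mul]
  exact Finset.sum_congr rfl fun k _ =>
    congrArg (· * _) ((rep_giAlg hω a k).eval hx).symm

theorem symbolSurjective_killing :
    SymbolSurjective U (tangent n) (symTensors n) 1 (killing ω) := by
  intro x hx v hv
  have C := coord_coordAlg hU ⟨x, hx⟩
  obtain ⟨ξ, hξ, h⟩ := C.killing_zero (h := fun i j => algebraMap ℝ (smoothAlg U) (v i j))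
    fun i j => by rw [hv i j]
  -- `killing_zero` yields a covector; its index is raised to obtain a vector field.
  set X := low (geom hU hω hc).gi ξ with hX
  have hr : ∀ k, Rep (fun y => extend (X k) y) (X k) := fun k => rep_extend _
  refine ⟨fun y k => extend (X k) y, ⟨smooth_one hr, fun _ _ => trivial⟩, fun m hm => ?_, ?_⟩
  · rw [iteratedFDeriv_pi_eq_zero ((smooth_one hr x hx).contDiffAt (hU.mem_nhds hx))]
    exact fun k => ((hr k).mem_van_iff hU hx 1).1 (low_mem_van _ hξ k) m hm
  · funext i j
    refine ((rep_killOp hU hω hc hr i j).eval hx).trans ?_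
    have h1 := (geom hU hω hc).kil_principal hξ i j
    have h2 := ev_eq_zero (add_mem h1 (neg_mem (neg_mem (neg_mem (h i j)))))
    have e : killOp (geom hU hω hc) X i j = (geom hU hω hc).kil ξ i j := by
      rw [killOp, hX, low_raise (geom hU hω hc).g_gi]
    rw [e, ← sub_eq_zero, ← h2, map_add, map_sub, neg_neg, map_neg, map_sub, AlgHom.commutes]
    change _ = _ - evalAt ⟨x, hx⟩ (dAlg hU i (ξ j) + dAlg hU j (ξ i)) + _
    simp only [Algebra.algebraMap_self, RingHom.id_apply]
    ring

/-- The quadratic deformation of `riemann_step` with `m = 0`, built from the constant tensor `v`: it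
vanishes to second order and has the prescribed curvature at `x`. The Bianchi hypothesis is then
empty. -/
theorem symbolSurjective_riemann :
    SymbolSurjective U (symTensors n) (cocycleBundle ω 2) 2 (riemann c ω) := by
  intro x hx v hv
  have C := coord_coordAlg hU ⟨x, hx⟩
  have hvc := (mem_cocycleBundle_two hω hx v).1 hv
  set R : Fin n → Fin n → Fin n → Fin n → smoothAlg U := fun k l i j =>
    algebraMap ℝ (smoothAlg U) (low (ω x) (v ![i, j] l) k) with hR
  have hRc : IsCurv R := by
    constructor
    · intro k l i j
      rw [hR, ← map_add, hvc.anti k l i j, map_zero]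
    · intro k l i j
      rw [hR, ← map_add, hvc.anti' k l i j, map_zero]
    · intro k l i j
      rw [hR, ← map_add, ← map_add, hvc.cyc k l i j, map_zero]
  obtain ⟨H, hs, hv2, hf⟩ := C.riemann_step (m := 0) hRc (fun _ _ _ _ => mem_van_zero _)
    (fun _ _ _ _ _ => mem_van_zero _)
  have hr : ∀ i j, Rep (fun y => extend (H i j) y) (H i j) := fun i j => rep_extend _
  refine ⟨fun y i j => extend (H i j) y, ⟨smooth_two hr, (symm_alg_iff hr).2 hs⟩,
    fun m hm => ?_, ?_⟩
  · rw [iteratedFDeriv_pi_eq_zero ((smooth_two hr x hx).contDiffAt (hU.mem_nhds hx))]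
    intro i
    rw [iteratedFDeriv_pi_eq_zero ((smooth_one (hr i) x hx).contDiffAt (hU.mem_nhds hx))]
    exact fun k => ((hr i k).mem_van_iff hU hx 2).1 (hv2 i k) m hm
  · funext I l k
    refine ((rep_riemOp hU hω hc hr hs I l k).eval hx).trans ?_
    rw [riemOp, eval_lowi]
    have e : ∀ a, evalAt ⟨x, hx⟩ (half _ * (geom hU hω hc).riem2 H a l (I 0) (I 1))
        = low (ω x) (v I l) a := by
      intro a
      have h1 := (geom hU hω hc).riem2_principal (m := 1) hv2 a l (I 0) (I 1)
      have h2 := ev_eq_zero (add_mem h1 (neg_mem (hf a l (I 0) (I 1))))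
      have e2 : (geom hU hω hc).riem2 H a l (I 0) (I 1) - flat (dAlg hU) H a l (I 0) (I 1)
          + -(2 * R a l (I 0) (I 1) - flat (dAlg hU) H a l (I 0) (I 1))
          = (geom hU hω hc).riem2 H a l (I 0) (I 1) - 2 * R a l (I 0) (I 1) := by ring
      have h3 := (congrArg (evalAt ⟨x, hx⟩) e2).symm.trans h2
      have h4 : evalAt ⟨x, hx⟩ (R a l (I 0) (I 1)) = low (ω x) (v I l) a := by
        rw [hR]
        simp only [vec2_eq]
        rfl
      have h5 : evalAt ⟨x, hx⟩ (half (smoothAlg U)) = 1 / 2 := rfl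
      rw [map_sub, map_mul, map_ofNat, h4] at h3
      rw [map_mul, h5]
      linear_combination (1 / 2) * h3
    simp only [e]
    exact congrFun (low_raise (inv_metric hω hx) (v I l)) k

theorem symbolSurjective_bianchi :
    SymbolSurjective U (cocycleBundle ω 2) (cocycleBundle ω 3) 1 (bianchi ω) := by
  intro x hx v hv
  have C := coord_coordAlg hU ⟨x, hx⟩
  have hvc := (mem_cocycleBundle_three hω hx v).1 hv
  set b : Fin n → Fin n → Fin n → Fin n → Fin n → ℝ :=
    fun k l p i j => low (ω x) (v ![p, i, j] l) k with hb
  have hB := isCurv_bianchiLift hvc.anti hvc.alt hvc.alt' hvc.cyc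
  have hcyc := bianchiLift_cyc hvc.anti hvc.alt hvc.alt' hvc.cyc
  set t := coordAlg (⟨x, hx⟩ : U) with ht
  -- A tensor vanishing at `x` with first derivatives a quarter of `bianchiLift b`; the quarter
  -- cancels the factor in `bianchiLift_cyc`.
  set R : Fin n → Fin n → Fin n → Fin n → smoothAlg U := fun k l i j =>
    ∑ p, t p * algebraMap ℝ (smoothAlg U) (1 / 4 * bianchiLift b p k l i j) with hR
  have hRc : IsCurv R := by
    constructor
    · intro k l i j
      simp only [hR, ← Finset.sum_add_distrib, ← mul_add, ← map_add, (hB _).anti, mul_zero,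
        map_zero, Finset.sum_const_zero]
    · intro k l i j
      simp only [hR, ← Finset.sum_add_distrib, ← mul_add, ← map_add, (hB _).anti', mul_zero,
        map_zero, Finset.sum_const_zero]
    · intro k l i j
      simp only [hR, ← Finset.sum_add_distrib, ← mul_add, ← map_add, (hB _).cyc, mul_zero,
        map_zero, Finset.sum_const_zero]
  have hRv : ∀ k l i j, R k l i j ∈ van (dAlg hU) (evalAt ⟨x, hx⟩) 1 := fun k l i j =>
    C.sum_t_mul fun p => mem_van_zero _
  have hdR : ∀ p k l i j, dAlg hU p (R k l i j)
      = algebraMap ℝ (smoothAlg U) (1 / 4 * bianchiLift b p k l i j) := by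
    intro p k l i j
    rw [hR, C.d_sum]
    simp only [Derivation.map_algebraMap, mul_zero, Finset.sum_const_zero, add_zero]
  set Q : (Fin 2 → Fin n) → Fin n → Fin n → smoothAlg U := fun I l k =>
    low (geom hU hω hc).gi (fun a => R a l (I 0) (I 1)) k with hQ
  have hlow : lowCurv (geom hU hω hc) Q = R := by
    funext k l i j
    exact congrFun (low_raise (geom hU hω hc).g_gi fun a => R a l i j) k
  have hr : ∀ I l k, Rep (fun y => extend (Q I l k) y) (Q I l k) := fun I l k => rep_extend _
  refine ⟨fun y I l k => extend (Q I l k) y, ⟨smooth_forms hr, (curv_alg_iff hω hr).2 ?_⟩,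
    fun m hm => ?_, ?_⟩
  · rw [← hlow] at hRc
    exact hRc
  · rw [iteratedFDeriv_pi_eq_zero ((smooth_forms hr x hx).contDiffAt (hU.mem_nhds hx))]
    intro I
    rw [iteratedFDeriv_pi_eq_zero ((smooth_two (hr I) x hx).contDiffAt (hU.mem_nhds hx))]
    intro l
    rw [iteratedFDeriv_pi_eq_zero ((smooth_one (hr I l) x hx).contDiffAt (hU.mem_nhds hx))]
    exact fun k => ((hr I l k).mem_van_iff hU hx 1).1
      (low_mem_van _ (fun _ => hRv _ _ _ _) k) m hm
  · funext I l k
    refine ((rep_bianOp hU hω hc hr I l k).eval hx).trans ?_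
    rw [bianOp, eval_lowi, hlow]
    have e : ∀ a, evalAt ⟨x, hx⟩ ((geom hU hω hc).bia R a l (I 0) (I 1) (I 2))
        = low (ω x) (v I l) a := by
      intro a
      have h1 := ev_eq_zero ((geom hU hω hc).bia_principal hRv a l (I 0) (I 1) (I 2))
      have e1 : (geom hU hω hc).d = dAlg hU := rfl
      rw [e1, hdR, hdR, hdR, map_sub, map_add, map_add, AlgHom.commutes, AlgHom.commutes,
        AlgHom.commutes] at h1
      simp only [Algebra.algebraMap_self, RingHom.id_apply] at h1
      have h2 := hcyc a l (I 0) (I 1) (I 2)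
      have h3 : b a l (I 0) (I 1) (I 2) = low (ω x) (v I l) a := by
        simp only [hb, vec3_eq]
      linear_combination h1 + (1 / 4) * h2 + h3
    simp only [e]
    exact congrFun (low_raise (inv_metric hω hx) (v I l)) k

/-- This serves two clauses: for `r = 0` the curvature hypothesis is empty and every 1-jet is
reached; for positive `r` it says that the Riemann image has zero jet of order `r - 1`. -/
theorem exists_killing_jet {x : Fin n → ℝ} (hx : x ∈ U) {r : ℕ}
    {η : (Fin n → ℝ) → Fin n → Fin n → ℝ} (hη : IsSection U (symTensors n) η)
    (h : ∀ {H : Fin n → Fin n → smoothAlg U}, (∀ i j, Rep (fun x => η x i j) (H i j)) →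
      (∀ i j, H i j = H j i) → ∀ k l i j,
      (geom hU hω hc).riem2 H k l i j ∈ van (dAlg hU) (evalAt ⟨x, hx⟩) r) :
    ∃ ξ, IsSection U (tangent n) ξ ∧ SameJet (r + 1) x (killing ω ξ) η := by
  obtain ⟨H, hH⟩ := exists_rep_two hη.1
  have hs := (symm_alg_iff hH).1 hη.2
  obtain ⟨ζ, hζ⟩ := (geom hU hω hc).killing_exact (coord_coordAlg hU ⟨x, hx⟩) hs
    (h hH hs) (r + 2) le_rfl
  set X := low (geom hU hω hc).gi ζ with hX
  have hr : ∀ k, Rep (fun y => extend (X k) y) (X k) := fun k => rep_extend _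
  refine ⟨fun y k => extend (X k) y, ⟨smooth_one hr, fun _ _ => trivial⟩,
    (sameJet_two hU hx (r + 1) (rep_killOp hU hω hc hr) hH).2 fun i j => ?_⟩
  have e : killOp (geom hU hω hc) X i j = (geom hU hω hc).kil ζ i j := by
    rw [killOp, hX, low_raise (geom hU hω hc).g_gi]
  rw [e, ← neg_sub]
  exact neg_mem (hζ i j)

/-- The counterpart at `F_1`: for `r = 0` every value is reached without a condition. -/
theorem exists_riemann_jet {x : Fin n → ℝ} (hx : x ∈ U) {r : ℕ}
    {η : (Fin n → ℝ) → (Fin 2 → Fin n) → Fin n → Fin n → ℝ}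
    (hη : IsSection U (cocycleBundle ω 2) η)
    (h : ∀ {Q : (Fin 2 → Fin n) → Fin n → Fin n → smoothAlg U},
      (∀ I l k, Rep (fun x => η x I l k) (Q I l k)) → ∀ k l p i j,
      (geom hU hω hc).bia (lowCurv (geom hU hω hc) Q) k l p i j
        ∈ van (dAlg hU) (evalAt ⟨x, hx⟩) r) :
    ∃ Ω, IsSection U (symTensors n) Ω ∧ SameJet r x (riemann c ω Ω) η := by
  obtain ⟨Q, hQ⟩ := exists_rep_forms hη.1
  obtain ⟨H, hs, hH⟩ := (geom hU hω hc).riemann_exact (coord_coordAlg hU ⟨x, hx⟩)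
    ((curv_alg_iff hω hQ).1 hη.2) (h hQ) (r + 1) le_rfl
  have hr : ∀ i j, Rep (fun y => extend (H i j) y) (H i j) := fun i j => rep_extend _
  refine ⟨fun y i j => extend (H i j) y, ⟨smooth_two hr, (symm_alg_iff hr).2 hs⟩,
    (sameJet_forms hU hx r (rep_riemOp hU hω hc hr hs) hQ).2 fun I l k => ?_⟩
  have h1 : ∀ a, (1 : ℝ) • (half _ * (geom hU hω hc).riem2 H a l (I 0) (I 1))
      + (-1 : ℝ) • low (geom hU hω hc).g (Q I l) a ∈ van (dAlg hU) (evalAt ⟨x, hx⟩) (r + 1) := by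
    intro a
    have := Ideal.mul_mem_left _ (-half (smoothAlg U)) (hH a l (I 0) (I 1))
    rw [vec2_eq] at this
    change _ ∈ van (dAlg hU) (evalAt ⟨x, hx⟩) (r + 1) at this
    convert this using 1
    have e : low (geom hU hω hc).g (Q I l) a = low (gAlg hω) (Q I l) a := rfl
    rw [one_smul, neg_one_smul, e]
    linear_combination low (gAlg hω) (Q I l) a * two_mul_half (A := smoothAlg U)
  have h2 := low_mem_van (geom hU hω hc).gi h1 k
  rw [low_lin, one_smul, neg_one_smul, ← sub_eq_add_neg, low_raise (geom hU hω hc).gi_g] at h2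
  exact h2

theorem generatesCC_killing :
    GeneratesCC U (tangent n) (symTensors n) 2 (killing ω) (riemann c ω) := by
  refine ⟨fun ξ hξ x hx => ?_, fun x hx r η hη hj => ?_⟩
  · obtain ⟨X, hX⟩ := exists_rep_one hξ.1
    funext I l k
    refine ((rep_riemOp hU hω hc (rep_killOp hU hω hc hX)
      ((geom hU hω hc).kil_symm _) I l k).eval hx).trans ?_
    rw [riemOp_killOp, map_zero]
    rfl
  -- A zero jet of order `r` means membership in `van (r + 1)`; the conclusion then holds for jets
  -- of order `r + 2`, as exactness demands.
  · refine exists_killing_jet hU hω hc hx (r := r + 1) hη fun {H} hH hs k l i j => ?_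
    have h := (sameJet_forms hU hx r (rep_riemOp hU hω hc hH hs)
      (g := 0) (Y := fun _ _ _ => 0) fun _ _ _ => Rep.zero).1 hj
    simp only [sub_zero] at h
    have h1 : lowCurv (geom hU hω hc) (riemOp (geom hU hω hc) H) k l i j
      ∈ van (dAlg hU) (evalAt ⟨x, hx⟩) (r + 1) := low_mem_van _ (fun a => h _ _ _) _
    rw [lowCurv_riemOp] at h1
    have h2 := Ideal.mul_mem_left _ 2 h1
    rwa [← mul_assoc, two_mul_half, one_mul] at h2

theorem noCC_killing : NoCCUpTo U (tangent n) (symTensors n) 1 (killing ω) :=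
  fun _ hx _ hη => exists_killing_jet hU hω hc hx (r := 0) hη fun _ _ _ _ _ _ => mem_van_zero _

theorem generatesCC_riemann :
    GeneratesCC U (symTensors n) (cocycleBundle ω 2) 1 (riemann c ω) (bianchi ω) := by
  refine ⟨fun Ω hΩ x hx => ?_, fun x hx r η hη hj => ?_⟩
  · obtain ⟨H, hH⟩ := exists_rep_two hΩ.1
    have hs := (symm_alg_iff hH).1 hΩ.2
    funext I l k
    refine ((rep_bianOp hU hω hc (rep_riemOp hU hω hc hH hs) I l k).eval hx).trans ?_
    rw [bianOp_riemOp _ hs, map_zero]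
    rfl
  · refine exists_riemann_jet hU hω hc hx (r := r + 1) hη fun {Q} hQ k l p i j => ?_
    have h := (sameJet_forms hU hx r (rep_bianOp hU hω hc hQ)
      (g := 0) (Y := fun _ _ _ => 0) fun _ _ _ => Rep.zero).1 hj
    simp only [sub_zero] at h
    rw [← low_bianOp]
    exact low_mem_van _ (fun a => h _ _ _) _

theorem noCC_riemann : NoCCUpTo U (symTensors n) (cocycleBundle ω 2) 0 (riemann c ω) :=
  fun _ hx _ hη => exists_riemann_jet hU hω hc hx (r := 0) hη fun _ _ _ _ _ _ => mem_van_zero _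

end Clauses

end KillingSeq
end

theorem mainTheorem3 (n : ℕ) (hn : 2 ≤ n) (U : Set (Fin n → ℝ)) (hU : IsOpen U)
    (ω : (Fin n → ℝ) → Fin n → Fin n → ℝ) (hω : IsMetric U ω)
    (c : ℝ) (hc : HasConstantCurvature U ω c) :
    -- the fibres: T, F_0 = S_2 T*, F_1 = H^2(g_1) = Z^2(g_1), F_2 = H^3(g_1) = Z^3(g_1)
    (∀ x ∈ U,
      Module.finrank ℝ (tangent n x) = n ∧
      (Module.finrank ℝ (symTensors n x) : ℚ) = n * (n + 1) / 2 ∧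
      coboundaries 2 (killingSymbol (ω x)) = ⊥ ∧
      (Module.finrank ℝ (cohomology 2 (killingSymbol (ω x))) : ℚ) = n ^ 2 * (n ^ 2 - 1) / 12 ∧
      (Module.finrank ℝ (cocycleBundle ω 2 x) : ℚ) = n ^ 2 * (n ^ 2 - 1) / 12 ∧
      coboundaries 3 (killingSymbol (ω x)) = ⊥ ∧
      (Module.finrank ℝ (cohomology 3 (killingSymbol (ω x))) : ℚ)
        = n ^ 2 * (n ^ 2 - 1) * (n - 2) / 24 ∧
      (Module.finrank ℝ (cocycleBundle ω 3 x) : ℚ) = n ^ 2 * (n ^ 2 - 1) * (n - 2) / 24 ∧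
      curvature ω x ∈ cocycleBundle ω 2 x) ∧
    -- the operators and their orders 1, 2, 1
    IsDiffOp U (tangent n) (symTensors n) 1 (killing ω) ∧
    SymbolSurjective U (tangent n) (symTensors n) 1 (killing ω) ∧
    IsDiffOp U (symTensors n) (cocycleBundle ω 2) 2 (riemann c ω) ∧
    SymbolSurjective U (symTensors n) (cocycleBundle ω 2) 2 (riemann c ω) ∧
    IsDiffOp U (cocycleBundle ω 2) (cocycleBundle ω 3) 1 (bianchi ω) ∧
    SymbolSurjective U (cocycleBundle ω 2) (cocycleBundle ω 3) 1 (bianchi ω) ∧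
    -- formal exactness: each operator generates the compatibility conditions of the preceding one
    GeneratesCC U (tangent n) (symTensors n) 2 (killing ω) (riemann c ω) ∧
    NoCCUpTo U (tangent n) (symTensors n) 1 (killing ω) ∧
    GeneratesCC U (symTensors n) (cocycleBundle ω 2) 1 (riemann c ω) (bianchi ω) ∧
    NoCCUpTo U (symTensors n) (cocycleBundle ω 2) 0 (riemann c ω) := by
  exact ⟨fun x hx => fibres hω hc hx, isDiffOp_killing hU hω hc,
    symbolSurjective_killing hU hω hc, isDiffOp_riemann hU hω hc,
    symbolSurjective_riemann hU hω hc, isDiffOp_bianchi hU hω hc,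
    symbolSurjective_bianchi hU hω hc, generatesCC_killing hU hω hc, noCC_killing hU hω hc,
    generatesCC_riemann hU hω hc, noCC_riemann hU hω hc⟩
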